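/- Consider circuits on a finite register of qubits with all-to-all connectivity, built from the gates $R_{\hat x}(\theta)=e^{-i\theta X/2}$, $R_{\hat z}(\theta)=e^{-i\theta Z/2}$ ($\theta\in\mathbb R$), $\mathrm{CNOT}$ (between any two distinct qubits), $H$, $T=\mathrm{diag}(1,e^{i\pi/4})$ and $T^\dagger$. A circuit is a sequence of time slots, each holding gates that act on pairwise disjoint sets of qubits. The cost of a gate type is the number of gates of that type, and its depth is the number of time slots that contain at least one gate of that type; $T$ and $T^\dagger$ both count as $T$ gates, and all $R_{\hat x},R_{\hat z}$ gates count as rotations. Let $n\ge 6$, $m\ge 1$ and $0\le n_\chi\le\lfloor\frac{n-6}{2}\rfloor$ be integers. Let $c_1,\dots,c_n$ (controls), $t_1,\dots,t_m$ (targets) and $\chi_1,\dots,\chi_{n_\chi}$ (dirty ancillas) be pairwise distinct qubits of the register, and let $W_1,\dots,W_m\in SU(2)$. Then the multi-controlled multi-target gate that applies $W_j$ to $t_j$ for every $j$ if all of $c_1,\dots,c_n$ are in the state $|1\rangle$, and is the identity otherwise, is implemented exactly (as an operator on the whole register, hence acting as the identity on the ancillas whatever their state) by one circuit that acts only on the qubits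 $c_i,t_j,\chi_l$ and that has * $8m$ gates from $\{R_{\hat x},R_{\hat z}\}$, in depth $8$; * CNOT cost $12n+8m-8n_\chi-40$ and depth $8n+8\lceil\log_2 m\rceil-8$; * $T$ cost $16n-16n_\chi-48$ and depth $8n-6$ if $n$ is even, $8n-3$ if $n$ is odd; * $H$ cost $8n-8n_\chi-32$ and depth $4n-11$. -/

import Mathlib

namespace QCircuit

/-- Operators on a register of qubits labelled by `Q`, as matrices in the computational basis.
A basis state is a bit string `Q → Fin 2`; rows are outputs and columns are inputs. -/
abbrev Operator (Q : Type*) := Matrix (Q → Fin 2) (Q → Fin 2) ℂ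

/-- The gate that applies the `2 × 2` matrix `U` to the qubit `t` if all qubits in `C` are in the
state `1`, and the identity otherwise (for `t ∉ C`). For `C = ∅` this is the single-qubit gate
`U` on the qubit `t`. -/
def controlled {Q : Type*} [Fintype Q] [DecidableEq Q] (C : Finset Q) (t : Q)
    (U : Matrix (Fin 2) (Fin 2) ℂ) : Operator Q :=
  fun x y =>
    if ∀ q, q ≠ t → x q = y q then
      (if ∀ q ∈ C, y q = 1 then U (x t) (y t)
        else (1 : Matrix (Fin 2) (Fin 2) ℂ) (x t) (y t))
    else 0

/-- Pauli `X`. -/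
def matX : Matrix (Fin 2) (Fin 2) ℂ := !![0, 1; 1, 0]

/-- The Hadamard gate. -/
noncomputable def matH : Matrix (Fin 2) (Fin 2) ℂ :=
  !![1 / (Real.sqrt 2 : ℂ), 1 / (Real.sqrt 2 : ℂ);
     1 / (Real.sqrt 2 : ℂ), -(1 / (Real.sqrt 2 : ℂ))]

/-- The gate `T = P(π/4)`. -/
noncomputable def matT : Matrix (Fin 2) (Fin 2) ℂ :=
  !![1, 0; 0, Complex.exp (Complex.I * (Real.pi / 4))]

/-- The inverse gate `T†`. -/
noncomputable def matTdg : Matrix (Fin 2) (Fin 2) ℂ :=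
  !![1, 0; 0, Complex.exp (-(Complex.I * (Real.pi / 4)))]

/-- The rotation `exp (-i θ X / 2)`. -/
noncomputable def matRx (θ : ℝ) : Matrix (Fin 2) (Fin 2) ℂ :=
  !![(Real.cos (θ / 2) : ℂ), -(Complex.I * (Real.sin (θ / 2) : ℂ));
     -(Complex.I * (Real.sin (θ / 2) : ℂ)), (Real.cos (θ / 2) : ℂ)]

/-- The rotation `exp (-i θ Z / 2)`. -/
noncomputable def matRz (θ : ℝ) : Matrix (Fin 2) (Fin 2) ℂ :=
  !![Complex.exp (-(Complex.I * (θ / 2))), 0; 0, Complex.exp (Complex.I * (θ / 2))]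

/-- The elementary gates. A `CNOT` is allowed between any two distinct qubits
(all-to-all connectivity). -/
inductive Gate (Q : Type*) where
  | rx (θ : ℝ) (q : Q) : Gate Q
  | rz (θ : ℝ) (q : Q) : Gate Q
  | h (q : Q) : Gate Q
  | t (q : Q) : Gate Q
  | tdg (q : Q) : Gate Q
  | cnot (control target : Q) (hne : control ≠ target) : Gate Q

/-- The types of gates that are counted separately; `T` and `T†` both count as `T` gates. -/
inductive GateType where
  | rotation
  | cnot
  | t
  | h
  deriving DecidableEq

/-- The type of a gate. -/
def Gate.type {Q : Type*} : Gate Q → GateType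
  | .rx _ _ => .rotation
  | .rz _ _ => .rotation
  | .h _ => .h
  | .t _ => .t
  | .tdg _ => .t
  | .cnot _ _ _ => .cnot

/-- The qubits that a gate acts on. -/
def Gate.qubits {Q : Type*} [DecidableEq Q] : Gate Q → Finset Q
  | .rx _ q => {q}
  | .rz _ q => {q}
  | .h q => {q}
  | .t q => {q}
  | .tdg q => {q}
  | .cnot c q _ => {c, q}

/-- The operator of a gate on the whole register. -/
noncomputable def Gate.op {Q : Type*} [Fintype Q] [DecidableEq Q] : Gate Q → Operator Q
  | .rx θ q => controlled ∅ q (matRx θ)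
  | .rz θ q => controlled ∅ q (matRz θ)
  | .h q => controlled ∅ q matH
  | .t q => controlled ∅ q matT
  | .tdg q => controlled ∅ q matTdg
  | .cnot c q _ => controlled {c} q matX

/-- A circuit is a list of time slots, in temporal order; a time slot is a list of gates, which
have to act on pairwise disjoint sets of qubits, so that they can be executed in parallel. -/
structure Circuit (Q : Type*) [DecidableEq Q] where
  slots : List (List (Gate Q))
  parallel : ∀ L ∈ slots, L.Pairwise fun g g' => Disjoint g.qubits g'.qubits

/-- All gates of a circuit, in temporal order. -/
def Circuit.gates {Q : Type*} [DecidableEq Q] (K : Circuit Q) : List (Gate Q) :=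
  K.slots.flatten

/-- The operator of a sequence of gates, where the head of the list is applied first. -/
noncomputable def seqOp {Q : Type*} [Fintype Q] [DecidableEq Q] : List (Gate Q) → Operator Q
  | [] => 1
  | g :: l => seqOp l * g.op

/-- The operator implemented by a circuit. -/
noncomputable def Circuit.op {Q : Type*} [Fintype Q] [DecidableEq Q] (K : Circuit Q) :
    Operator Q :=
  seqOp K.gates

/-- The cost of a gate type: the number of gates of this type. -/
def Circuit.cost {Q : Type*} [DecidableEq Q] (K : Circuit Q) (τ : GateType) : ℕ :=
  K.gates.countP fun g => decide (g.type = τ)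

/-- The depth of a gate type: the number of time slots that contain a gate of this type. -/
def Circuit.depth {Q : Type*} [DecidableEq Q] (K : Circuit Q) (τ : GateType) : ℕ :=
  K.slots.countP fun L => decide (∃ g ∈ L, g.type = τ)

/-- The circuit acts only on qubits in `S`. -/
def Circuit.ActsOn {Q : Type*} [DecidableEq Q] (K : Circuit Q) (S : Set Q) : Prop :=
  ∀ g ∈ K.gates, ∀ q ∈ g.qubits, q ∈ S

/-- The multi-controlled multi-target gate: the product over `j` of the gates that apply `W j` to
the target `t j` controlled by all the qubits `c i`. (The factors commute if the targets are
distinct and none of them is a control.) -/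
noncomputable def multiTarget {Q : Type*} [Fintype Q] [DecidableEq Q] {n m : ℕ}
    (c : Fin n → Q) (t : Fin m → Q) (W : Fin m → Matrix (Fin 2) (Fin 2) ℂ) : Operator Q :=
  (List.ofFn fun j => controlled (Finset.univ.image c) (t j) (W j)).prod

end QCircuit

/-!
The gate is a group commutator. By an Euler decomposition every `W j` is a rotation
`Rx (θ j)` conjugated by rotations, and two layers of rotations on each side reduce the claim to
multi-controlled `Rx (θ j)` (`exists_rotation`, `op_fullSched`). Split the controls into two groups,
and let `U` and `V` be the operators that, if all controls of the first (for `V`: second) group are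
`1`, multiply every basis state by a phase times the sign `(-1) ^ p`, where `p` is the parity of the
targets. A layer `A` of rotations `Rx (α j)` is inverted when the sign operator is moved past it, so
`A⁻¹ V⁻¹ A U⁻¹ A⁻¹ V A U` is `A⁻⁴` where both groups are `1`, and the identity elsewhere
(`commutator_eq`). This needs only four layers of rotations, and it is insensitive to the phases.

Each of `U` and `V` is a multi-controlled phase gate on a single target, conjugated by a tree of
`CNOT` gates of logarithmic depth that computes the parity (`exists_fan`, `exists_op_fanMid`). The
phase gate collects its controls in a ladder of relative-phase Toffoli gates (`tracks_ladder`) whose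
ancillas are controls of the *other* group. A rung of the ladder adds its ancilla to the value that
it computes, so the value of the ladder is the conjunction of its controls only if all the ancillas
are `1`. This suffices: starting from one control of each group that is not in a ladder, each rung of
one ladder shows that the next ancilla of the other one is `1` (`ladderTop_zip_iff`). A dirty ancilla
absorbs two controls of the first group at the cost of eight `CNOT`, eight `T` and four `H` gates
per use, in a nest of toggles (`tracks_nestOp`). The nest leaves behind an operator on the ancillas,
which permutes the basis states up to phases; it commutes with all that comes between the two uses
of the first phase gate, and cancels in the commutator (`op_midFull_cons`, `op_commSched_fanMid`).

Operators are computed by tracking how they permute the basis states up to phases (`Tracks`); a gate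
on a qubit `t` whose matrix depends on the other qubits is written as `blk t N`. Circuits are built
as lists of slots with gates of one type (`Sched`), for which costs and depths are additive. The
depths obtained are at most the required ones, and splitting slots raises them to these values
(`Sched.exists_circuit`).
-/

namespace QCircuit

open Matrix

/-! ### Operators on one qubit, controlled by the others -/

section Blocks

variable {Q : Type*} [DecidableEq Q]

/-- The function `f` of the basis state does not depend on the qubit `t`. -/
def IndepOf {α : Type*} (t : Q) (f : (Q → Fin 2) → α) : Prop :=
  ∀ z b, f (Function.update z t b) = f z

theorem IndepOf.const {α : Type*} (t : Q) (a : α) : IndepOf t fun _ => a := fun _ _ => rfl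

theorem IndepOf.apply {t q : Q} (h : q ≠ t) : IndepOf t fun z : Q → Fin 2 => z q :=
  fun z b => by simp [h]

theorem IndepOf.comp {α β : Type*} {t : Q} {f : (Q → Fin 2) → α} (F : α → β)
    (hf : IndepOf t f) : IndepOf t fun z => F (f z) := fun z b => congrArg F (hf z b)

theorem IndepOf.comp₂ {α β γ : Type*} {t : Q} {f : (Q → Fin 2) → α} {g : (Q → Fin 2) → β}
    (F : α → β → γ) (hf : IndepOf t f) (hg : IndepOf t g) :
    IndepOf t fun z => F (f z) (g z) := fun z b => congrArg₂ F (hf z b) (hg z b)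

theorem IndepOf.eq_of_eqOff {α : Type*} {t : Q} {f : (Q → Fin 2) → α} (hf : IndepOf t f)
    {x y : Q → Fin 2} (h : ∀ q, q ≠ t → x q = y q) : f x = f y := by
  have : x = Function.update y t (x t) := by
    ext q
    by_cases hq : q = t
    · subst hq; simp
    · simp [hq, h q hq]
  rw [this]
  exact hf _ _

variable [Fintype Q]

/-- The operator that applies the matrix `N z` to the qubit `t`, where `z` is the input basis
state. It is used for functions `N` that do not depend on the value of `t` itself. -/
def blk (t : Q) (N : (Q → Fin 2) → Matrix (Fin 2) (Fin 2) ℂ) : Operator Q :=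
  fun x y => if ∀ q, q ≠ t → x q = y q then N y (x t) (y t) else 0

theorem controlled_eq_blk (C : Finset Q) (t : Q) (U : Matrix (Fin 2) (Fin 2) ℂ) :
    controlled C t U = blk t fun y => if ∀ q ∈ C, y q = 1 then U else 1 := by
  ext x y
  simp only [controlled, blk]
  split_ifs <;> rfl

theorem sum_eqOff {t : Q} (x : Q → Fin 2) (F : (Q → Fin 2) → ℂ) :
    ∑ w, (if ∀ q, q ≠ t → x q = w q then F w else 0)
      = ∑ b : Fin 2, F (Function.update x t b) := by
  rw [← Finset.sum_filter]
  symm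
  refine Finset.sum_bij (fun b _ => Function.update x t b) ?_ ?_ ?_ ?_
  · intro b _
    simp only [Finset.mem_filter, Finset.mem_univ, true_and]
    intro q hq
    simp [hq]
  · intro b _ b' _ h
    simpa using congrFun h t
  · intro w hw
    simp only [Finset.mem_filter, Finset.mem_univ, true_and] at hw
    refine ⟨w t, Finset.mem_univ _, ?_⟩
    ext q
    by_cases hq : q = t
    · subst hq; simp
    · simp [hq, hw q hq]
  · intros; rfl

theorem blk_mul_apply (t : Q) (N : (Q → Fin 2) → Matrix (Fin 2) (Fin 2) ℂ) (M : Operator Q)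
    (x y : Q → Fin 2) :
    (blk t N * M) x y = ∑ b : Fin 2, N (Function.update x t b) (x t) b
      * M (Function.update x t b) y := by
  rw [Matrix.mul_apply]
  have := sum_eqOff (t := t) x (fun w => N w (x t) (w t) * M w y)
  simp only [Function.update_self] at this
  rw [← this]
  refine Finset.sum_congr rfl fun w _ => ?_
  simp only [blk]
  split_ifs <;> simp

theorem blk_mul {t : Q} {N M : (Q → Fin 2) → Matrix (Fin 2) (Fin 2) ℂ} (hN : IndepOf t N) :
    blk t N * blk t M = blk t fun z => N z * M z := by
  ext x y
  rw [blk_mul_apply]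
  by_cases h : ∀ q, q ≠ t → x q = y q
  · have h' : ∀ b, ∀ q, q ≠ t → Function.update x t b q = y q := by
      intro b q hq; simp [hq, h q hq]
    simp only [blk, if_pos h, if_pos (h' _), Function.update_self, Matrix.mul_apply]
    refine Finset.sum_congr rfl fun b _ => ?_
    rw [hN x b, hN.eq_of_eqOff h]
  · have h' : ∀ b, ¬ ∀ q, q ≠ t → Function.update x t b q = y q := by
      intro b hb
      apply h
      intro q hq
      simpa [hq] using hb q hq
    simp only [blk, if_neg h, if_neg (h' _), mul_zero, Finset.sum_const_zero]

theorem blk_one (t : Q) : blk t (fun _ => (1 : Matrix (Fin 2) (Fin 2) ℂ)) = 1 := by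
  ext x y
  simp only [blk, Matrix.one_apply]
  by_cases hxy : x = y
  · subst hxy; simp
  · rw [if_neg hxy]
    split_ifs with h h'
    · exact absurd (funext fun q => by by_cases hq : q = t
                                       · subst hq; exact h'
                                       · exact h q hq) hxy
    · rfl
    · rfl

theorem blk_mul_blk_apply {t t' : Q} (htt : t ≠ t')
    {N N' : (Q → Fin 2) → Matrix (Fin 2) (Fin 2) ℂ} (h1 : IndepOf t N)
    (h2 : IndepOf t' N) (x y : Q → Fin 2) :
    (blk t N * blk t' N') x y = if ∀ q, q ≠ t → q ≠ t' → x q = y q then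
      N y (x t) (y t) * N' y (x t') (y t') else 0 := by
  rw [blk_mul_apply]
  by_cases h : ∀ q, q ≠ t → q ≠ t' → x q = y q
  · rw [if_pos h, Finset.sum_eq_single (y t)]
    · have hu : ∀ q, q ≠ t' → Function.update x t (y t) q = y q := by
        intro q hq
        by_cases hqt : q = t
        · subst hqt; simp
        · simp [hqt, h q hqt hq]
      simp only [blk, if_pos hu]
      rw [h2.eq_of_eqOff hu]
      simp [htt.symm]
    · intro b _ hb
      rw [blk, if_neg, mul_zero]
      intro hu
      exact hb (by simpa using hu t htt)
    · simp
  · rw [if_neg h]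
    refine Finset.sum_eq_zero fun b _ => ?_
    rw [blk, if_neg, mul_zero]
    intro hu
    apply h
    intro q hq hq'
    simpa [hq] using hu q hq'

theorem blk_commute {t t' : Q} (htt : t ≠ t')
    {N N' : (Q → Fin 2) → Matrix (Fin 2) (Fin 2) ℂ} (h1 : IndepOf t N)
    (h2 : IndepOf t' N) (h3 : IndepOf t N') (h4 : IndepOf t' N') :
    Commute (blk t N) (blk t' N') := by
  ext x y
  rw [blk_mul_blk_apply htt h1 h2, blk_mul_blk_apply htt.symm h4 h3]
  have : (∀ q, q ≠ t → q ≠ t' → x q = y q) ↔ (∀ q, q ≠ t' → q ≠ t → x q = y q) :=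
    ⟨fun h q a b => h q b a, fun h q a b => h q b a⟩
  simp only [this, mul_comm]

theorem indepOf_controlled {C : Finset Q} {q : Q} (h : q ∉ C) (U : Matrix (Fin 2) (Fin 2) ℂ) :
    IndepOf q fun y : Q → Fin 2 =>
      if ∀ q ∈ C, y q = 1 then U else (1 : Matrix (Fin 2) (Fin 2) ℂ) := by
  intro z b
  have : (∀ r ∈ C, Function.update z q b r = 1) ↔ ∀ r ∈ C, z r = 1 := by
    refine forall₂_congr fun r hr => ?_
    rw [Function.update_of_ne]
    rintro rfl; exact h hr
  simp only [this]

theorem controlled_commute {C C' : Finset Q} {t t' : Q} (htt : t ≠ t') (h1 : t ∉ C)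
    (h2 : t' ∉ C) (h3 : t ∉ C') (h4 : t' ∉ C') (U U' : Matrix (Fin 2) (Fin 2) ℂ) :
    Commute (controlled C t U) (controlled C' t' U') := by
  rw [controlled_eq_blk, controlled_eq_blk]
  exact blk_commute htt (indepOf_controlled h1 U) (indepOf_controlled h2 U)
    (indepOf_controlled h3 U') (indepOf_controlled h4 U')

theorem controlled_mul {C : Finset Q} {t : Q} (h : t ∉ C) (U V : Matrix (Fin 2) (Fin 2) ℂ) :
    controlled C t U * controlled C t V = controlled C t (U * V) := by
  rw [controlled_eq_blk, controlled_eq_blk, controlled_eq_blk, blk_mul (indepOf_controlled h U)]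
  congr 1
  ext z : 1
  split_ifs <;> simp

theorem controlled_one (C : Finset Q) (t : Q) : controlled C t 1 = 1 := by
  rw [controlled_eq_blk]
  simp [blk_one]

/-- If the matrices applied to `t` are diagonal, then no independence of `t` is needed. -/
theorem blk_eq_diagonal {t : Q} {N : (Q → Fin 2) → Matrix (Fin 2) (Fin 2) ℂ}
    (h01 : ∀ z, N z 0 1 = 0) (h10 : ∀ z, N z 1 0 = 0) :
    blk t N = Matrix.diagonal fun z => N z (z t) (z t) := by
  ext x y
  rw [Matrix.diagonal_apply]
  split_ifs with hxy
  · subst hxy; simp [blk]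
  · rw [blk]
    split_ifs with h
    · have hne : x t ≠ y t := by
        intro h'
        exact hxy (funext fun q => by by_cases hq : q = t
                                      · subst hq; exact h'
                                      · exact h q hq)
      generalize x t = a at *
      generalize y t = b at *
      fin_cases a <;> fin_cases b <;> simp_all
    · rfl

theorem diagonal_commute_blk {t : Q} {f : (Q → Fin 2) → ℂ} (hf : IndepOf t f)
    (N : (Q → Fin 2) → Matrix (Fin 2) (Fin 2) ℂ) :
    Commute (Matrix.diagonal f) (blk t N) := by
  ext x y
  rw [Matrix.diagonal_mul, Matrix.mul_diagonal]
  simp only [blk]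
  split_ifs with h
  · rw [hf.eq_of_eqOff h, mul_comm]
  · simp

theorem diagonal_commute_controlled {C : Finset Q} {t : Q} {f : (Q → Fin 2) → ℂ}
    (hf : IndepOf t f) (U : Matrix (Fin 2) (Fin 2) ℂ) :
    Commute (Matrix.diagonal f) (controlled C t U) := by
  rw [controlled_eq_blk]
  exact diagonal_commute_blk hf _

end Blocks

/-! ### Operators that permute the basis states up to phases -/

section Tracking

variable {Q : Type*} [Fintype Q]

/-- The operator `M` sends every basis state `y` to a multiple of the basis state `κ y`. -/
def Tracks (M : Operator Q) (κ : (Q → Fin 2) → (Q → Fin 2)) : Prop :=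
  ∀ x y, M x y ≠ 0 → x = κ y

theorem Tracks.one : Tracks (1 : Operator Q) id := by
  intro x y h
  by_contra hxy
  exact h (Matrix.one_apply_ne hxy)

variable [DecidableEq Q]

theorem Tracks.mul {M M' : Operator Q} {κ κ' : (Q → Fin 2) → (Q → Fin 2)} (h : Tracks M κ)
    (h' : Tracks M' κ') : Tracks (M * M') (κ ∘ κ') := by
  intro x y hxy
  rw [Matrix.mul_apply] at hxy
  obtain ⟨w, -, hw⟩ := Finset.exists_ne_zero_of_sum_ne_zero hxy
  have h1 := h x w (left_ne_zero_of_mul hw)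
  have h2 := h' w y (right_ne_zero_of_mul hw)
  rw [h1, h2]; rfl

theorem Tracks.diagonal_mul {M : Operator Q} {κ : (Q → Fin 2) → (Q → Fin 2)} (h : Tracks M κ)
    (f : (Q → Fin 2) → ℂ) :
    Matrix.diagonal f * M = M * Matrix.diagonal (f ∘ κ) := by
  ext x y
  rw [Matrix.diagonal_mul, Matrix.mul_diagonal]
  by_cases hM : M x y = 0
  · simp [hM]
  · rw [h x y hM, mul_comm]; rfl

/-- Conjugating a diagonal operator by an operator that permutes the basis states up to phases:
the phases cancel. -/
theorem Tracks.conj_diagonal {M M' : Operator Q} {κ : (Q → Fin 2) → (Q → Fin 2)}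
    (h : Tracks M κ) (hinv : M' * M = 1) (f : (Q → Fin 2) → ℂ) :
    M' * Matrix.diagonal f * M = Matrix.diagonal (f ∘ κ) := by
  rw [mul_assoc, h.diagonal_mul, ← mul_assoc, hinv, one_mul]

/-- Add `w z` to the value of the qubit `t`. -/
def toggle (t : Q) (w : (Q → Fin 2) → Fin 2) (z : Q → Fin 2) : Q → Fin 2 :=
  Function.update z t (z t + w z)

theorem tracks_blk {t : Q} {N : (Q → Fin 2) → Matrix (Fin 2) (Fin 2) ℂ}
    {w : (Q → Fin 2) → Fin 2} (h : ∀ z i j, N z i j ≠ 0 → i = j + w z) :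
    Tracks (blk t N) (toggle t w) := by
  intro x y hxy
  rw [blk] at hxy
  split_ifs at hxy with hoff
  · ext1 q
    by_cases hq : q = t
    · subst hq
      rw [toggle, Function.update_self]
      exact h _ _ _ hxy
    · rw [toggle, Function.update_of_ne hq, hoff q hq]
  · exact absurd rfl hxy

/-- A controlled gate is a sum of products of functions of the controls and of one-qubit operators. -/
theorem blk_eq_sum {t : Q} {N : (Q → Fin 2) → Matrix (Fin 2) (Fin 2) ℂ} (hN : IndepOf t N) :
    blk t N = ∑ i : Fin 2, ∑ j : Fin 2, Matrix.diagonal (fun z => N z i j)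
      * controlled ∅ t (Matrix.single i j 1) := by
  ext x y
  simp only [Matrix.sum_apply, Matrix.diagonal_mul, controlled_eq_blk, blk]
  by_cases h : ∀ q, q ≠ t → x q = y q
  · simp only [if_pos h, Finset.notMem_empty, false_imp_iff, implies_true, if_true,
      Matrix.single_apply]
    rw [Finset.sum_eq_single (x t), Finset.sum_eq_single (y t)]
    · simp [hN.eq_of_eqOff h]
    · intro b _ hb; simp [hb]
    · simp
    · intro b _ hb
      refine Finset.sum_eq_zero fun j _ => ?_
      simp [hb]
    · simp
  · simp [if_neg h]

/-- A controlled gate on `t` is moved past an operator that acts on other qubits only and permutes the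
basis states up to phases: its controls are evaluated after the permutation. -/
theorem blk_mul_of_tracks {t : Q} {N : (Q → Fin 2) → Matrix (Fin 2) (Fin 2) ℂ}
    (hN : IndepOf t N) {S : Operator Q} {κ : (Q → Fin 2) → (Q → Fin 2)} (hS : Tracks S κ)
    (hc : ∀ U, Commute (controlled ∅ t U) S) (hN' : IndepOf t fun z => N (κ z)) :
    blk t N * S = S * blk t fun z => N (κ z) := by
  rw [blk_eq_sum hN, blk_eq_sum hN', Finset.sum_mul, Finset.mul_sum]
  refine Finset.sum_congr rfl fun i _ => ?_
  rw [Finset.sum_mul, Finset.mul_sum]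
  refine Finset.sum_congr rfl fun j _ => ?_
  rw [mul_assoc, (hc _).eq, ← mul_assoc, hS.diagonal_mul, mul_assoc]
  rfl

end Tracking

/-! ### Sequences of gates -/

section Sequences

variable {Q : Type*} [DecidableEq Q]

/-- All gates of the list act on qubits in `S` only. -/
def SupportedOn (l : List (Gate Q)) (S : Set Q) : Prop := ∀ g ∈ l, ∀ q ∈ g.qubits, q ∈ S

theorem SupportedOn.mono {l : List (Gate Q)} {S S' : Set Q} (h : SupportedOn l S)
    (hS : S ⊆ S') : SupportedOn l S' := fun g hg q hq => hS (h g hg q hq)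

variable [Fintype Q]

theorem seqOp_append (l l' : List (Gate Q)) : seqOp (l ++ l') = seqOp l' * seqOp l := by
  induction l with
  | nil => simp [seqOp]
  | cons g l ih => simp [seqOp, ih, mul_assoc]

theorem Gate.op_commute {g g' : Gate Q} (h : Disjoint g.qubits g'.qubits) :
    Commute g.op g'.op := by
  rw [Finset.disjoint_left] at h
  cases g <;> cases g' <;> simp [Gate.qubits] at h <;> simp only [Gate.op] <;>
    apply controlled_commute <;> simp <;> (try tauto)

theorem commute_of_forall {l : List (Gate Q)} {M : Operator Q}
    (h : ∀ g ∈ l, Commute g.op M) : Commute (seqOp l) M := by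
  induction l with
  | nil => exact Commute.one_left _
  | cons g l ih =>
    exact (ih fun g' hg' => h g' (List.mem_cons_of_mem _ hg')).mul_left
      (h g List.mem_cons_self)

theorem seqOp_commute {l l' : List (Gate Q)} {S S' : Set Q} (h : SupportedOn l S)
    (h' : SupportedOn l' S') (hd : Disjoint S S') : Commute (seqOp l) (seqOp l') := by
  refine commute_of_forall fun g hg => (commute_of_forall fun g' hg' => ?_).symm
  refine Gate.op_commute ?_
  rw [Finset.disjoint_left]
  intro q hq' hq
  exact Set.disjoint_left.1 hd (h g hg q hq) (h' g' hg' q hq')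

theorem seqOp_commute_controlled {l : List (Gate Q)} {S : Set Q} (h : SupportedOn l S) {t : Q}
    (ht : t ∉ S) (U : Matrix (Fin 2) (Fin 2) ℂ) :
    Commute (controlled ∅ t U) (seqOp l) := by
  refine (commute_of_forall fun g hg => ?_).symm
  have hq : t ∉ g.qubits := fun hq => ht (h g hg t hq)
  cases g <;> simp [Gate.qubits] at hq <;> simp only [Gate.op] <;>
    apply controlled_commute <;> simp <;> tauto

end Sequences

/-! ### Identities between `2 × 2` matrices -/

section Matrices

theorem sqrtTwo_mul_self : (Real.sqrt 2 : ℂ) * (Real.sqrt 2 : ℂ) = 2 := by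
  rw [← Complex.ofReal_mul, Real.mul_self_sqrt (by norm_num)]; simp

theorem sqrtTwo_ne_zero : (Real.sqrt 2 : ℂ) ≠ 0 := by
  intro h; have := sqrtTwo_mul_self; rw [h] at this; norm_num at this

theorem exp_pi_four_mul_self :
    Complex.exp (Complex.I * (Real.pi / 4)) * Complex.exp (Complex.I * (Real.pi / 4))
      = Complex.I := by
  rw [← Complex.exp_add, show Complex.I * (Real.pi / 4 : ℂ) + Complex.I * (Real.pi / 4)
    = Real.pi / 2 * Complex.I by ring, Complex.exp_pi_div_two_mul_I]

theorem exp_pi_four_mul_neg :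
    Complex.exp (Complex.I * (Real.pi / 4)) * Complex.exp (-(Complex.I * (Real.pi / 4)))
      = 1 := by
  rw [← Complex.exp_add, add_neg_cancel, Complex.exp_zero]

theorem exp_neg_pi_four_mul_self :
    Complex.exp (-(Complex.I * (Real.pi / 4))) * Complex.exp (-(Complex.I * (Real.pi / 4)))
      = -Complex.I := by
  have h1 := exp_pi_four_mul_self
  have h2 := exp_pi_four_mul_neg
  set a := Complex.exp (Complex.I * (Real.pi / 4))
  set b := Complex.exp (-(Complex.I * (Real.pi / 4)))
  have : b * b * (a * a) = 1 := by linear_combination (a * b + 1) * h2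
  rw [h1] at this
  linear_combination (-Complex.I) * this + (b * b) * Complex.I_sq

theorem matH_mul_self : matH * matH = 1 := by
  have h := sqrtTwo_mul_self
  have h0 := sqrtTwo_ne_zero
  ext i j
  fin_cases i <;> fin_cases j <;> simp [matH, Matrix.mul_apply] <;> field_simp <;>
    (try linear_combination -h)

theorem matX_mul_self : matX * matX = 1 := by
  ext i j
  fin_cases i <;> fin_cases j <;> simp [matX, Matrix.mul_apply]

theorem matT_mul_matTdg : matT * matTdg = 1 := by
  have := exp_pi_four_mul_neg
  ext i j
  fin_cases i <;> fin_cases j <;> simp [matT, matTdg, Matrix.mul_apply]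
  · simpa using this

theorem matTdg_mul_matT : matTdg * matT = 1 := by
  have := exp_pi_four_mul_neg
  ext i j
  fin_cases i <;> fin_cases j <;> simp [matT, matTdg, Matrix.mul_apply]
  · simpa [mul_comm] using this

theorem matRx_mul (θ φ : ℝ) : matRx θ * matRx φ = matRx (θ + φ) := by
  have hI := Complex.I_sq
  ext i j
  fin_cases i <;> fin_cases j <;>
    simp [matRx, Matrix.mul_apply, add_div, Complex.cos_add, Complex.sin_add] <;>
    first
    | linear_combination (Complex.sin (θ / 2) * Complex.sin (φ / 2)) * hI
    | ring

theorem matRx_zero : matRx 0 = 1 := by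
  ext i j
  fin_cases i <;> fin_cases j <;> simp [matRx]

theorem matRz_mul (θ φ : ℝ) : matRz θ * matRz φ = matRz (θ + φ) := by
  ext i j
  fin_cases i <;> fin_cases j <;>
    simp [matRz, Matrix.mul_apply, ← Complex.exp_add] <;> congr 1 <;> ring

theorem matRz_zero : matRz 0 = 1 := by
  ext i j
  fin_cases i <;> fin_cases j <;> simp [matRz]

/-- `X` raised to the power of a bit. -/
def powX (b : Fin 2) : Matrix (Fin 2) (Fin 2) ℂ := if b = 1 then matX else 1

/-- `T X ^ b T†`; for `b = 1` this is a reflection about an axis that makes an angle of `π / 4` with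
those of `X` and `Y`. -/
noncomputable def reflP (b : Fin 2) : Matrix (Fin 2) (Fin 2) ℂ := matT * powX b * matTdg

/-- `T† X ^ b T`; for `b = 1` this is the mirror image of `reflP 1`. -/
noncomputable def reflN (b : Fin 2) : Matrix (Fin 2) (Fin 2) ℂ := matTdg * powX b * matT

theorem powX_zero : powX 0 = 1 := rfl

theorem powX_one : powX 1 = !![0, 1; 1, 0] := rfl

theorem reflP_zero : reflP 0 = 1 := by simp [reflP, powX_zero, matT_mul_matTdg]

theorem reflN_zero : reflN 0 = 1 := by simp [reflN, powX_zero, matTdg_mul_matT]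

/-- The phase `exp (iπ/4)`. -/
noncomputable def zeta : ℂ := Complex.exp (Complex.I * (Real.pi / 4))

/-- The phase `exp (-iπ/4)`. -/
noncomputable def zetaInv : ℂ := Complex.exp (-(Complex.I * (Real.pi / 4)))

theorem reflP_one : reflP 1 = !![0, zetaInv; zeta, 0] := by
  ext i j
  fin_cases i <;> fin_cases j <;> simp [reflP, powX_one, matT, matTdg, zeta, zetaInv]

theorem reflN_one : reflN 1 = !![0, zeta; zetaInv, 0] := by
  ext i j
  fin_cases i <;> fin_cases j <;> simp [reflN, powX_one, matT, matTdg, zeta, zetaInv]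

theorem powX_mul_self (b : Fin 2) : powX b * powX b = 1 := by
  unfold powX; split_ifs <;> simp [matX_mul_self]

theorem reflN_mul_self (b : Fin 2) : reflN b * reflN b = 1 := by
  simp only [reflN, mul_assoc]
  rw [← mul_assoc matT, matT_mul_matTdg, one_mul, ← mul_assoc (powX b), powX_mul_self, one_mul,
    matTdg_mul_matT]

theorem zeta_mul_self : zeta * zeta = Complex.I := exp_pi_four_mul_self

theorem zetaInv_mul_self : zetaInv * zetaInv = -Complex.I := exp_neg_pi_four_mul_self

theorem zeta_mul_zetaInv : zeta * zetaInv = 1 := exp_pi_four_mul_neg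

theorem powX_reflN_powX_one : powX 1 * reflN 1 * powX 1 = reflP 1 := by
  rw [powX_one, reflN_one, reflP_one]
  ext i j
  fin_cases i <;> fin_cases j <;> simp

theorem powX_reflP_powX_one : powX 1 * reflP 1 * powX 1 = reflN 1 := by
  rw [powX_one, reflN_one, reflP_one]
  ext i j
  fin_cases i <;> fin_cases j <;> simp

/-- The phase gate `(-i Z) ^ b`. -/
def phaseZ (b : Fin 2) : Matrix (Fin 2) (Fin 2) ℂ :=
  if b = 1 then !![-Complex.I, 0; 0, Complex.I] else 1

theorem reflP_mul_reflN_one : reflP 1 * reflN 1 = phaseZ 1 := by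
  rw [reflN_one, reflP_one]
  ext i j
  fin_cases i <;> fin_cases j <;> simp [phaseZ, zeta_mul_self, zetaInv_mul_self]

theorem reflN_mul_reflP_one : reflN 1 * reflP 1 = -phaseZ 1 := by
  rw [reflN_one, reflP_one]
  ext i j
  fin_cases i <;> fin_cases j <;> simp [phaseZ, zeta_mul_self, zetaInv_mul_self]

/-- The doubly controlled phase gate, with `b` a positive and `a` a negative control. -/
theorem ccPhase (a b : Fin 2) :
    powX a * reflP b * powX a * reflN b = phaseZ (b * (1 + a)) := by
  fin_cases a <;> fin_cases b <;>
    simp [powX_zero, reflP_zero, reflN_zero, powX_mul_self, phaseZ]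
  · simpa [phaseZ] using reflP_mul_reflN_one
  · rw [powX_reflP_powX_one, reflN_mul_self]

/-- If a bit is `a` at first and `a + f` later, then the two uses as a control of a conjugated
reflection combine to a phase gate up to sign if both `b` and `f` are `1`, and cancel otherwise. -/
theorem togglePhase (a b f : Fin 2) :
    powX (a + f) * reflN b * powX (a + f) * (powX a * reflN b * powX a)
      = (if b * f = 1 ∧ a = 1 then -1 else 1 : ℂ) • phaseZ (b * f) := by
  have e : ∀ M : Matrix (Fin 2) (Fin 2) ℂ, powX 1 * M * powX 1 * (powX 1 * M * powX 1)
      = powX 1 * (M * M) * powX 1 := by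
    intro M
    calc _ = powX 1 * M * (powX 1 * powX 1) * M * powX 1 := by simp only [mul_assoc]
      _ = _ := by rw [powX_mul_self]; simp only [mul_assoc, mul_one]
  fin_cases a <;> fin_cases b <;> fin_cases f <;>
    simp [powX_zero, reflN_zero, e, reflN_mul_self, powX_mul_self, phaseZ]
  · rw [powX_reflN_powX_one, reflP_mul_reflN_one]; simp [phaseZ]
  · rw [powX_reflN_powX_one, reflN_mul_reflP_one]; simp [phaseZ]

/-- A matrix with `M i j = 0` unless `i = j + w`. -/
def ShiftBy (M : Matrix (Fin 2) (Fin 2) ℂ) (w : Fin 2) : Prop := ∀ i j, M i j ≠ 0 → i = j + w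

theorem ShiftBy.smul {M : Matrix (Fin 2) (Fin 2) ℂ} {w : Fin 2} (h : ShiftBy M w) (c : ℂ) :
    ShiftBy (c • M) w := fun i j hij => h i j (by
  simp only [Matrix.smul_apply, smul_eq_mul] at hij
  exact right_ne_zero_of_mul hij)

theorem shiftBy_one : ShiftBy 1 0 := by
  intro i j h
  by_contra hij
  exact h (Matrix.one_apply_ne (by simpa using hij))

theorem shiftBy_hadamard_zero (a b : ℂ) : ShiftBy (matH * !![a, b; b, a] * matH) 0 := by
  intro i j h
  fin_cases i <;> fin_cases j <;> simp [matH, Matrix.mul_apply] at h ⊢ <;>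
    exact h (by ring)

theorem shiftBy_hadamard_one (a b : ℂ) : ShiftBy (matH * !![a, b; -b, -a] * matH) 1 := by
  intro i j h
  fin_cases i <;> fin_cases j <;> simp [matH, Matrix.mul_apply] at h ⊢ <;>
    exact h (by ring)

theorem one_eq_of : (1 : Matrix (Fin 2) (Fin 2) ℂ) = !![1, 0; 0, 1] := by
  ext i j; fin_cases i <;> fin_cases j <;> rfl

/-- The relative-phase Toffoli gate with a positive control `c` and a negative control `a`. -/
theorem shiftBy_rung_neg (c a : Fin 2) :
    ShiftBy (matH * (reflP c * powX a * reflN c) * matH) (c * (1 + a)) := by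
  have h00 := shiftBy_hadamard_zero 1 0
  have h01 := shiftBy_hadamard_zero 0 1
  have h10 := shiftBy_hadamard_one (-Complex.I) 0
  fin_cases c <;> fin_cases a
  · simpa [reflP_zero, reflN_zero, powX_zero, one_eq_of] using h00
  · simpa [reflP_zero, reflN_zero, powX_one] using h01
  · simpa [powX_zero, reflP_mul_reflN_one, phaseZ] using h10
  · have : reflP 1 * powX 1 * reflN 1 = !![0, 1; 1, 0] := by
      rw [reflP_one, powX_one, reflN_one]
      ext i j
      fin_cases i <;> fin_cases j <;> simp [zeta_mul_zetaInv, mul_comm zetaInv]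
    simpa [this] using h01

/-- The relative-phase Toffoli gate with two positive controls. -/
theorem shiftBy_rung_pos (c a : Fin 2) :
    ShiftBy (matH * (reflN c * powX a * reflN c) * matH) (c * a) := by
  have h00 := shiftBy_hadamard_zero 1 0
  have h01 := shiftBy_hadamard_zero 0 1
  have h11 := shiftBy_hadamard_one 0 Complex.I
  fin_cases c <;> fin_cases a
  · simpa [reflP_zero, reflN_zero, powX_zero, one_eq_of] using h00
  · simpa [reflP_zero, reflN_zero, powX_one] using h01
  · simpa [powX_zero, reflN_mul_self, ← one_eq_of] using h00
  · have : reflN 1 * powX 1 * reflN 1 = !![0, Complex.I; -Complex.I, 0] := by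
      rw [powX_one, reflN_one]
      ext i j
      fin_cases i <;> fin_cases j <;> simp [zeta_mul_self, zetaInv_mul_self]
    simpa [this] using h11

/-- Conjugating a phase gate by a controlled reflection that exchanges the axes of `Z` and `Y`. -/
theorem shiftBy_conj_phaseZ (c w : Fin 2) :
    ShiftBy (matH * reflN c * matH * phaseZ w * (matH * reflN c * matH)) (c * w) := by
  have hHH := matH_mul_self
  fin_cases w
  · have h : matH * reflN c * matH * phaseZ 0 * (matH * reflN c * matH) = 1 := by
      calc _ = matH * (reflN c * (matH * matH) * reflN c) * matH := by
            simp [phaseZ, mul_assoc]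
        _ = 1 := by rw [hHH, mul_one, reflN_mul_self, mul_one, hHH]
    simpa [h] using shiftBy_one
  · fin_cases c
    · intro i j
      simp only [Fin.zero_eta, reflN_zero, mul_one, hHH, one_mul]
      fin_cases i <;> fin_cases j <;> simp [phaseZ]
    · have h1 : matH * phaseZ 1 * matH = -Complex.I • !![0, 1; 1, 0] := by
        have h := sqrtTwo_mul_self
        have h0 := sqrtTwo_ne_zero
        ext i j
        fin_cases i <;> fin_cases j <;> simp [matH, phaseZ, Matrix.mul_apply] <;> field_simp <;>
          linear_combination h
      have h2 : reflN 1 * (-Complex.I • !![0, 1; 1, 0]) * reflN 1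
          = !![0, 1; -1, 0] := by
        rw [reflN_one]
        ext i j
        fin_cases i <;> fin_cases j <;> simp [Matrix.mul_apply] <;>
          first
          | linear_combination (-Complex.I) * zeta_mul_self - Complex.I_sq
          | linear_combination Complex.I * zetaInv_mul_self - Complex.I_sq
      have h3 : matH * reflN 1 * matH * phaseZ 1 * (matH * reflN 1 * matH)
          = matH * !![0, 1; -1, 0] * matH := by
        rw [← h2, ← h1]; simp only [mul_assoc]
      have h11 := shiftBy_hadamard_one 0 1
      simp only [neg_zero] at h11
      simpa [h3] using h11

end Matrices

/-! ### Inverse gates -/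

section Inverse

variable {Q : Type*}

/-- The inverse gate. -/
def Gate.inv : Gate Q → Gate Q
  | .rx θ q => .rx (-θ) q
  | .rz θ q => .rz (-θ) q
  | .h q => .h q
  | .t q => .tdg q
  | .tdg q => .t q
  | .cnot c q hne => .cnot c q hne

theorem Gate.inv_type (g : Gate Q) : g.inv.type = g.type := by cases g <;> rfl

theorem Gate.inv_qubits [DecidableEq Q] (g : Gate Q) : g.inv.qubits = g.qubits := by
  cases g <;> rfl

variable [Fintype Q] [DecidableEq Q]

theorem Gate.inv_op_mul (g : Gate Q) : g.inv.op * g.op = 1 := by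
  cases g <;> simp only [Gate.inv, Gate.op] <;> rw [controlled_mul (by simp_all [eq_comm])]
  · rw [matRx_mul, neg_add_cancel, matRx_zero, controlled_one]
  · rw [matRz_mul, neg_add_cancel, matRz_zero, controlled_one]
  · rw [matH_mul_self, controlled_one]
  · rw [matTdg_mul_matT, controlled_one]
  · rw [matT_mul_matTdg, controlled_one]
  · rw [matX_mul_self, controlled_one]

theorem seqOp_inv_mul (l : List (Gate Q)) :
    seqOp (l.map Gate.inv).reverse * seqOp l = 1 := by
  induction l with
  | nil => simp [seqOp]
  | cons g l ih =>
    simp only [List.map_cons, List.reverse_cons, seqOp_append, seqOp, one_mul]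
    calc _ = g.inv.op * (seqOp (l.map Gate.inv).reverse * seqOp l) * g.op := by
          simp only [mul_assoc]
      _ = 1 := by rw [ih, mul_one, Gate.inv_op_mul]

end Inverse

/-! ### Schedules -/

/-- A list of time slots, each labelled with the type of the gates it holds. -/
abbrev Sched (Q : Type*) := List (GateType × List (Gate Q))

namespace Sched

section

variable {Q : Type*}

/-- All gates of a schedule, in temporal order. -/
def gates (A : Sched Q) : List (Gate Q) := A.flatMap Prod.snd

/-- The number of gates in the slots labelled `τ`. -/
def cost (τ : GateType) (A : Sched Q) : ℕ := (A.map fun s => if s.1 = τ then s.2.length else 0).sum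

/-- The number of slots labelled `τ`. -/
def depth (τ : GateType) (A : Sched Q) : ℕ := (A.map fun s => if s.1 = τ then 1 else 0).sum

/-- The inverse schedule. -/
def inv (A : Sched Q) : Sched Q :=
  (A.map fun s => (s.1, (s.2.map Gate.inv).reverse)).reverse

/-- The labels of the slots are correct, and the gates of a slot act on disjoint sets of qubits. -/
def Valid [DecidableEq Q] (A : Sched Q) : Prop :=
  ∀ s ∈ A, (∀ g ∈ s.2, g.type = s.1) ∧ s.2.Pairwise fun g g' => Disjoint g.qubits g'.qubits

@[simp] theorem gates_nil : gates ([] : Sched Q) = [] := rfl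

@[simp] theorem gates_cons (s : GateType × List (Gate Q)) (A : Sched Q) :
    gates (s :: A) = s.2 ++ gates A := by simp [gates]

@[simp] theorem gates_append (A B : Sched Q) : gates (A ++ B) = gates A ++ gates B := by
  simp [gates]

@[simp] theorem cost_nil (τ : GateType) : cost τ ([] : Sched Q) = 0 := rfl

@[simp] theorem cost_cons (τ : GateType) (s : GateType × List (Gate Q)) (A : Sched Q) :
    cost τ (s :: A) = (if s.1 = τ then s.2.length else 0) + cost τ A := by simp [cost]

@[simp] theorem cost_append (τ : GateType) (A B : Sched Q) :
    cost τ (A ++ B) = cost τ A + cost τ B := by simp [cost]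

@[simp] theorem depth_nil (τ : GateType) : depth τ ([] : Sched Q) = 0 := rfl

@[simp] theorem depth_cons (τ : GateType) (s : GateType × List (Gate Q)) (A : Sched Q) :
    depth τ (s :: A) = (if s.1 = τ then 1 else 0) + depth τ A := by simp [depth]

@[simp] theorem depth_append (τ : GateType) (A B : Sched Q) :
    depth τ (A ++ B) = depth τ A + depth τ B := by simp [depth]

@[simp] theorem inv_append (A B : Sched Q) : inv (A ++ B) = inv B ++ inv A := by
  simp [inv]

@[simp] theorem cost_inv (τ : GateType) (A : Sched Q) : cost τ (inv A) = cost τ A := by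
  simp [cost, inv, List.sum_reverse, Function.comp_def]

@[simp] theorem depth_inv (τ : GateType) (A : Sched Q) : depth τ (inv A) = depth τ A := by
  simp [depth, inv, List.sum_reverse, Function.comp_def]

theorem gates_inv (A : Sched Q) : gates (inv A) = ((gates A).map Gate.inv).reverse := by
  induction A with
  | nil => rfl
  | cons s A ih =>
    have : inv (s :: A) = inv A ++ [(s.1, (s.2.map Gate.inv).reverse)] := by simp [inv]
    rw [this]
    simp [ih]

section

variable [DecidableEq Q]

theorem valid_nil : Valid ([] : Sched Q) := by simp [Valid]

theorem valid_cons {s : GateType × List (Gate Q)} {A : Sched Q} :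
    Valid (s :: A) ↔ ((∀ g ∈ s.2, g.type = s.1) ∧
      s.2.Pairwise fun g g' => Disjoint g.qubits g'.qubits) ∧ Valid A := by
  simp [Valid]

theorem valid_append {A B : Sched Q} : Valid (A ++ B) ↔ Valid A ∧ Valid B := by
  simp only [Valid, List.mem_append]
  exact ⟨fun h => ⟨fun s hs => h s (Or.inl hs), fun s hs => h s (Or.inr hs)⟩,
    fun h s hs => hs.elim (h.1 s) (h.2 s)⟩

theorem Valid.inv {A : Sched Q} (h : Valid A) : Valid (inv A) := by
  intro s hs
  simp only [Sched.inv, List.mem_reverse, List.mem_map] at hs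
  obtain ⟨s, hs, rfl⟩ := hs
  obtain ⟨h1, h2⟩ := h s hs
  constructor
  · intro g hg
    simp only [List.mem_reverse, List.mem_map] at hg
    obtain ⟨g, hg, rfl⟩ := hg
    rw [Gate.inv_type, h1 g hg]
  · rw [List.pairwise_reverse, List.pairwise_map]
    simp only [Gate.inv_qubits]
    exact h2.imp fun h => h.symm

theorem supportedOn_inv {A : Sched Q} {S : Set Q} (h : SupportedOn (gates A) S) :
    SupportedOn (gates (inv A)) S := by
  intro g hg q hq
  rw [gates_inv] at hg
  simp only [List.mem_reverse, List.mem_map] at hg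
  obtain ⟨g, hg, rfl⟩ := hg
  rw [Gate.inv_qubits] at hq
  exact h g hg q hq

end

variable [Fintype Q] [DecidableEq Q]

/-- The operator of a schedule. -/
noncomputable def op (A : Sched Q) : Operator Q := seqOp (gates A)

@[simp] theorem op_nil : op ([] : Sched Q) = 1 := rfl

theorem op_cons (s : GateType × List (Gate Q)) (A : Sched Q) :
    op (s :: A) = op A * seqOp s.2 := by simp [op, seqOp_append]

theorem op_append (A B : Sched Q) : op (A ++ B) = op B * op A := by
  simp [op, seqOp_append]

theorem op_inv_mul (A : Sched Q) : op (inv A) * op A = 1 := by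
  rw [op, op, gates_inv, seqOp_inv_mul]

theorem op_mul_inv (A : Sched Q) : op A * op (inv A) = 1 :=
  mul_eq_one_comm.1 (op_inv_mul A)

theorem op_commute {A B : Sched Q} {S S' : Set Q} (h : SupportedOn (gates A) S)
    (h' : SupportedOn (gates B) S') (hd : Disjoint S S') : Commute (op A) (op B) :=
  seqOp_commute h h' hd

end

end Sched

/-! ### Gadgets with one target qubit -/

section Gadgets

variable {Q : Type*} [DecidableEq Q]

/-- The `CNOT` gate as a total function of its qubits; the value for `c = t` is irrelevant. -/
def cx (c t : Q) : Gate Q := if h : c = t then .t t else .cnot c t h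

theorem cx_type {c t : Q} (h : c ≠ t) : (cx c t).type = .cnot := by simp [cx, h, Gate.type]

theorem cx_qubits_subset (c t : Q) : (cx c t).qubits ⊆ {c, t} := by
  unfold cx; split_ifs <;> simp [Gate.qubits]

variable [Fintype Q]

theorem op_cx {c t : Q} (h : c ≠ t) : (cx c t).op = blk t fun z => powX (z c) := by
  simp [cx, h, Gate.op, controlled_eq_blk, powX]

theorem op_h (t : Q) : (Gate.h t).op = blk t fun _ => matH := by
  simp [Gate.op, controlled_eq_blk]

theorem op_t (t : Q) : (Gate.t t).op = blk t fun _ => matT := by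
  simp [Gate.op, controlled_eq_blk]

theorem op_tdg (t : Q) : (Gate.tdg t).op = blk t fun _ => matTdg := by
  simp [Gate.op, controlled_eq_blk]

/-- A single `CNOT` gate. -/
def cxS (c t : Q) : Sched Q := [(.cnot, [cx c t])]

/-- A single `H` gate. -/
def hS (t : Q) : Sched Q := [(.h, [.h t])]

/-- The schedule for `reflN`, controlled by `c`. -/
def halfN (c t : Q) : Sched Q := [(.t, [.t t]), (.cnot, [cx c t]), (.t, [.tdg t])]

/-- The schedule for `reflP`, controlled by `c`. -/
def halfP (c t : Q) : Sched Q := [(.t, [.tdg t]), (.cnot, [cx c t]), (.t, [.t t])]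

theorem op_cxS {c t : Q} (h : c ≠ t) : Sched.op (cxS c t) = blk t fun z => powX (z c) := by
  simp [cxS, Sched.op, seqOp, op_cx h]

theorem op_hS (t : Q) : Sched.op (hS t) = blk t fun _ => matH := by
  simp [hS, Sched.op, seqOp, op_h]

theorem op_halfN {c t : Q} (h : c ≠ t) : Sched.op (halfN c t) = blk t fun z => reflN (z c) := by
  simp only [halfN, Sched.op, Sched.gates_cons, Sched.gates_nil, List.cons_append, List.nil_append,
    seqOp, one_mul, op_cx h, op_t, op_tdg]
  rw [blk_mul (IndepOf.const t matTdg), blk_mul ((IndepOf.apply h).comp (fun b => matTdg * powX b))]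
  rfl

theorem op_halfP {c t : Q} (h : c ≠ t) : Sched.op (halfP c t) = blk t fun z => reflP (z c) := by
  simp only [halfP, Sched.op, Sched.gates_cons, Sched.gates_nil, List.cons_append, List.nil_append,
    seqOp, one_mul, op_cx h, op_t, op_tdg]
  rw [blk_mul (IndepOf.const t matT), blk_mul ((IndepOf.apply h).comp (fun b => matT * powX b))]
  rfl

/-- A reflection on `t` controlled by `b` and conjugated by a `CNOT` gate with control `a`. -/
def conjN (a b t : Q) : Sched Q := cxS a t ++ (halfN b t ++ cxS a t)

theorem op_conjN {a b t : Q} (ha : a ≠ t) (hb : b ≠ t) :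
    Sched.op (conjN a b t) = blk t fun z => powX (z a) * reflN (z b) * powX (z a) := by
  simp only [conjN, Sched.op_append, op_cxS ha, op_halfN hb]
  rw [blk_mul ((IndepOf.apply ha).comp powX),
    blk_mul ((IndepOf.apply ha).comp₂ (fun x y => powX x * reflN y) (IndepOf.apply hb))]

/-- The same as `conjN`, with the other reflection. -/
def conjP (a b t : Q) : Sched Q := cxS a t ++ (halfP b t ++ cxS a t)

theorem op_conjP {a b t : Q} (ha : a ≠ t) (hb : b ≠ t) :
    Sched.op (conjP a b t) = blk t fun z => powX (z a) * reflP (z b) * powX (z a) := by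
  simp only [conjP, Sched.op_append, op_cxS ha, op_halfP hb]
  rw [blk_mul ((IndepOf.apply ha).comp powX),
    blk_mul ((IndepOf.apply ha).comp₂ (fun x y => powX x * reflP y) (IndepOf.apply hb))]

/-- A reflection on `d`, controlled by `e`, that exchanges the axes of `Z` and `Y`. -/
def swapZY (e d : Q) : Sched Q := hS d ++ (halfN e d ++ hS d)

theorem op_swapZY {e d : Q} (h : e ≠ d) :
    Sched.op (swapZY e d) = blk d fun z => matH * reflN (z e) * matH := by
  simp only [swapZY, Sched.op_append, op_hS, op_halfN h]
  rw [blk_mul (IndepOf.const d matH), blk_mul ((IndepOf.apply h).comp (fun b => matH * reflN b))]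

end Gadgets

/-! ### Supports and validity of the gadgets -/

section Supports

variable {Q : Type*} [DecidableEq Q]

theorem supportedOn_nil (S : Set Q) : SupportedOn [] S := by simp [SupportedOn]

theorem SupportedOn.append {l l' : List (Gate Q)} {S : Set Q} (h : SupportedOn l S)
    (h' : SupportedOn l' S) : SupportedOn (l ++ l') S := by
  intro g hg
  rcases List.mem_append.1 hg with hg | hg
  exacts [h g hg, h' g hg]

theorem supportedOn_gates_append {A B : Sched Q} {S : Set Q} (h : SupportedOn A.gates S)
    (h' : SupportedOn B.gates S) : SupportedOn (A ++ B).gates S := by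
  rw [Sched.gates_append]; exact h.append h'

theorem supportedOn_map {α : Type*} {f : α → Gate Q} {l : List α} {S : Set Q}
    (h : ∀ a ∈ l, ∀ q ∈ (f a).qubits, q ∈ S) : SupportedOn (l.map f) S := by
  intro g hg
  obtain ⟨a, ha, rfl⟩ := List.mem_map.1 hg
  exact h a ha

theorem mem_of_mem_cx {c t q : Q} {S : Set Q} (hc : c ∈ S) (ht : t ∈ S)
    (hq : q ∈ (cx c t).qubits) : q ∈ S := by
  have := cx_qubits_subset c t hq
  simp only [Finset.mem_insert, Finset.mem_singleton] at this
  rcases this with rfl | rfl <;> assumption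

variable {c e t : Q} {S : Set Q}

theorem supportedOn_cxS (hc : c ∈ S) (ht : t ∈ S) : SupportedOn (cxS c t).gates S := by
  intro g hg q hq
  simp [cxS] at hg
  subst hg
  exact mem_of_mem_cx hc ht hq

theorem supportedOn_hS (ht : t ∈ S) : SupportedOn (hS t).gates S := by
  intro g hg q hq
  simp [hS] at hg
  subst hg
  simp [Gate.qubits] at hq
  exact hq ▸ ht

theorem supportedOn_halfN (hc : c ∈ S) (ht : t ∈ S) : SupportedOn (halfN c t).gates S := by
  intro g hg q hq
  simp [halfN] at hg
  rcases hg with rfl | rfl | rfl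
  · simp [Gate.qubits] at hq; exact hq ▸ ht
  · exact mem_of_mem_cx hc ht hq
  · simp [Gate.qubits] at hq; exact hq ▸ ht

theorem supportedOn_halfP (hc : c ∈ S) (ht : t ∈ S) : SupportedOn (halfP c t).gates S := by
  intro g hg q hq
  simp [halfP] at hg
  rcases hg with rfl | rfl | rfl
  · simp [Gate.qubits] at hq; exact hq ▸ ht
  · exact mem_of_mem_cx hc ht hq
  · simp [Gate.qubits] at hq; exact hq ▸ ht

theorem supportedOn_conjN (hc : c ∈ S) (he : e ∈ S) (ht : t ∈ S) :
    SupportedOn (conjN c e t).gates S :=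
  supportedOn_gates_append (supportedOn_cxS hc ht)
    (supportedOn_gates_append (supportedOn_halfN he ht) (supportedOn_cxS hc ht))

theorem supportedOn_conjP (hc : c ∈ S) (he : e ∈ S) (ht : t ∈ S) :
    SupportedOn (conjP c e t).gates S :=
  supportedOn_gates_append (supportedOn_cxS hc ht)
    (supportedOn_gates_append (supportedOn_halfP he ht) (supportedOn_cxS hc ht))

theorem supportedOn_swapZY (hc : c ∈ S) (ht : t ∈ S) : SupportedOn (swapZY c t).gates S :=
  supportedOn_gates_append (supportedOn_hS ht)
    (supportedOn_gates_append (supportedOn_halfN hc ht) (supportedOn_hS ht))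

theorem valid_cxS (h : c ≠ t) : (cxS c t).Valid := by simp [cxS, Sched.Valid, cx_type h]

theorem valid_hS (t : Q) : (hS t).Valid := by simp [hS, Sched.Valid, Gate.type]

theorem valid_halfN (h : c ≠ t) : (halfN c t).Valid := by
  simp [halfN, Sched.Valid, cx_type h, show (Gate.t t).type = .t from rfl,
    show (Gate.tdg t).type = .t from rfl]

theorem valid_halfP (h : c ≠ t) : (halfP c t).Valid := by
  simp [halfP, Sched.Valid, cx_type h, show (Gate.t t).type = .t from rfl,
    show (Gate.tdg t).type = .t from rfl]

theorem Sched.Valid.append {A B : Sched Q} (hA : A.Valid) (hB : B.Valid) : (A ++ B).Valid :=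
  Sched.valid_append.2 ⟨hA, hB⟩

theorem valid_conjN (hc : c ≠ t) (he : e ≠ t) : (conjN c e t).Valid :=
  (valid_cxS hc).append ((valid_halfN he).append (valid_cxS hc))

theorem valid_conjP (hc : c ≠ t) (he : e ≠ t) : (conjP c e t).Valid :=
  (valid_cxS hc).append ((valid_halfP he).append (valid_cxS hc))

theorem valid_swapZY (hc : c ≠ t) : (swapZY c t).Valid :=
  (valid_hS t).append ((valid_halfN hc).append (valid_hS t))

end Supports

/-! ### The ladder of relative-phase Toffoli gates -/

section Ladder

variable {Q : Type*}

/-- The qubit that carries the partial conjunction of the rungs `L`; at the bottom of the ladder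
this is the control `xb`. -/
def prevQ (L : List (Q × Q)) (xb : Q) : Q :=
  match L with
  | [] => xb
  | p :: _ => p.2

/-- The partial conjunction carried by `prevQ L xb`. It is stored inverted, except at the bottom. -/
def prevVal (L : List (Q × Q)) (xb : Q) (z : Q → Fin 2) : Fin 2 :=
  match L with
  | [] => z xb
  | p :: _ => 1 + z p.2

/-- The layer of `H` gates at the beginning of the ladder. -/
def hLayer (L : List (Q × Q)) : Sched Q := [(.h, L.map fun p => .h p.2)]

/-- The qubits of a ladder are pairwise distinct. -/
def LadderNodup (L : List (Q × Q)) (xb : Q) : Prop :=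
  (xb :: (L.map Prod.fst ++ L.map Prod.snd)).Nodup

/-- The qubits of a ladder. -/
def ladderQubits (L : List (Q × Q)) (xb : Q) : Set Q :=
  {q | q = xb ∨ q ∈ L.map Prod.fst ∨ q ∈ L.map Prod.snd}

theorem LadderNodup.cons {p : Q × Q} {L : List (Q × Q)} {xb : Q} (h : LadderNodup (p :: L) xb) :
    LadderNodup L xb ∧ p.1 ≠ p.2 ∧ p.1 ∉ ladderQubits L xb ∧ p.2 ∉ ladderQubits L xb := by
  unfold LadderNodup at h ⊢
  rw [List.map_cons, List.map_cons, List.cons_append] at h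
  have hperm : (xb :: p.1 :: (L.map Prod.fst ++ p.2 :: L.map Prod.snd)).Perm
      (p.1 :: p.2 :: xb :: (L.map Prod.fst ++ L.map Prod.snd)) := by
    refine (List.Perm.swap _ _ _).trans (List.Perm.cons _ ?_)
    refine (List.Perm.cons _ List.perm_middle).trans (List.Perm.swap _ _ _)
  rw [hperm.nodup_iff, List.nodup_cons, List.nodup_cons] at h
  obtain ⟨h1, h2, h3⟩ := h
  simp only [List.mem_cons, List.mem_append, not_or] at h1 h2
  simp only [ladderQubits, Set.mem_ofPred_eq, not_or]
  tauto

theorem prevQ_mem (L : List (Q × Q)) (xb : Q) : prevQ L xb ∈ ladderQubits L xb := by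
  cases L <;> simp [prevQ, ladderQubits]

theorem ladderQubits_subset_cons (p : Q × Q) (L : List (Q × Q)) (xb : Q) :
    ladderQubits L xb ⊆ ladderQubits (p :: L) xb := by
  intro q hq
  simp only [ladderQubits, Set.mem_ofPred_eq, List.map_cons, List.mem_cons] at hq ⊢
  tauto

theorem fst_mem_ladderQubits (p : Q × Q) (L : List (Q × Q)) (xb : Q) :
    p.1 ∈ ladderQubits (p :: L) xb := by simp [ladderQubits]

theorem snd_mem_ladderQubits (p : Q × Q) (L : List (Q × Q)) (xb : Q) :
    p.2 ∈ ladderQubits (p :: L) xb := by simp [ladderQubits]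

theorem mem_ladderQubits {L : List (Q × Q)} {xb : Q} {p : Q × Q} (hp : p ∈ L) :
    p.1 ∈ ladderQubits L xb ∧ p.2 ∈ ladderQubits L xb :=
  ⟨Or.inr (Or.inl (List.mem_map_of_mem hp)), Or.inr (Or.inr (List.mem_map_of_mem hp))⟩

theorem pairwise_of_ladderNodup {L : List (Q × Q)} {xb : Q} (h : LadderNodup L xb) :
    L.Pairwise fun p p' => p.1 ≠ p'.1 ∧ p.1 ≠ p'.2 ∧ p.2 ≠ p'.1 ∧ p.2 ≠ p'.2 := by
  induction L with
  | nil => exact List.Pairwise.nil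
  | cons p L ih =>
    obtain ⟨h0, h1, h2, h3⟩ := h.cons
    refine List.Pairwise.cons (fun p' hp' => ?_) (ih h0)
    have := mem_ladderQubits (xb := xb) hp'
    refine ⟨?_, ?_, ?_, ?_⟩ <;> rintro h' <;> first | (rw [h'] at h2; tauto) | (rw [h'] at h3; tauto)

theorem fst_ne_snd_of_ladderNodup {L : List (Q × Q)} {xb : Q} (h : LadderNodup L xb) :
    ∀ p ∈ L, p.1 ≠ p.2 := by
  induction L with
  | nil => simp
  | cons p L ih =>
    obtain ⟨h0, h1, -, -⟩ := h.cons
    intro p' hp'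
    rcases List.mem_cons.1 hp' with rfl | hp'
    exacts [h1, ih h0 p' hp']

theorem disjoint_ladderQubits {p : Q × Q} {L : List (Q × Q)} {xb : Q}
    (h : LadderNodup (p :: L) xb) : Disjoint ({p.1, p.2} : Set Q) (ladderQubits L xb) := by
  obtain ⟨-, -, h2, h3⟩ := h.cons
  rw [Set.disjoint_left]
  rintro q (rfl | rfl) <;> assumption

variable [DecidableEq Q]

/-- The part of the rung `p` on top of `L` that depends on `L`. -/
def rung (L : List (Q × Q)) (xb : Q) (p : Q × Q) : Sched Q :=
  cxS (prevQ L xb) p.2 ++ ((match L with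
    | [] => halfN p.1 p.2
    | _ :: _ => halfP p.1 p.2) ++ hS p.2)

/-- The sequential part of the ladder, from the bottom to the top. -/
def chain : List (Q × Q) → Q → Sched Q
  | [], _ => []
  | p :: L, xb => chain L xb ++ rung L xb p

/-- The gates `halfN` for all pairs in `L`, in parallel. -/
def pre (L : List (Q × Q)) : Sched Q :=
  [(.t, L.map fun p => .t p.2), (.cnot, L.map fun p => cx p.1 p.2), (.t, L.map fun p => .tdg p.2)]

/-- A ladder with the rungs `L`, the top rung first. The rung `(x, y)` is a relative-phase Toffoli
gate with target `y`, whose controls are `x` and the target of the rung below, or `xb` at the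
bottom. The parts of the rungs that come before the dependence on the rung below are executed in
parallel. -/
def ladder (L : List (Q × Q)) (xb : Q) : Sched Q := hLayer L ++ (pre L ++ chain L xb)

/-- The permutation of the basis states that a ladder performs. -/
def ladderMap : List (Q × Q) → Q → (Q → Fin 2) → (Q → Fin 2)
  | [], _ => id
  | p :: L, xb => toggle p.2 (fun z => z p.1 * prevVal L xb z) ∘ ladderMap L xb

/-- The value at the top of the ladder, as a function of the state before the ladder. -/
def ladderTop (L : List (Q × Q)) (xb : Q) (z : Q → Fin 2) : Fin 2 :=
  prevVal L xb (ladderMap L xb z)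

theorem supportedOn_pre {L : List (Q × Q)} {S : Set Q} (h : ∀ p ∈ L, p.1 ∈ S ∧ p.2 ∈ S) :
    SupportedOn (pre L).gates S := by
  simp only [pre, Sched.gates_cons, Sched.gates_nil, List.append_nil]
  refine .append (supportedOn_map fun p hp q hq => ?_) (.append (supportedOn_map fun p hp q hq => ?_)
    (supportedOn_map fun p hp q hq => ?_))
  · simp only [Gate.qubits, Finset.mem_singleton] at hq; exact hq ▸ (h p hp).2
  · exact mem_of_mem_cx (h p hp).1 (h p hp).2 hq
  · simp only [Gate.qubits, Finset.mem_singleton] at hq; exact hq ▸ (h p hp).2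

theorem supportedOn_hLayer {L : List (Q × Q)} {S : Set Q} (h : ∀ p ∈ L, p.2 ∈ S) :
    SupportedOn (hLayer L).gates S := by
  simp only [hLayer, Sched.gates_cons, Sched.gates_nil, List.append_nil]
  refine supportedOn_map fun p hp q hq => ?_
  simp only [Gate.qubits, Finset.mem_singleton] at hq; exact hq ▸ h p hp

theorem supportedOn_rung {L : List (Q × Q)} {xb : Q} {p : Q × Q} {S : Set Q}
    (h : prevQ L xb ∈ S) (h1 : p.1 ∈ S) (h2 : p.2 ∈ S) : SupportedOn (rung L xb p).gates S := by
  refine supportedOn_gates_append (supportedOn_cxS h h2)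
    (supportedOn_gates_append ?_ (supportedOn_hS h2))
  cases L
  · exact supportedOn_halfN h1 h2
  · exact supportedOn_halfP h1 h2

theorem supportedOn_chain (L : List (Q × Q)) (xb : Q) :
    SupportedOn (chain L xb).gates (ladderQubits L xb) := by
  induction L with
  | nil => exact supportedOn_nil _
  | cons p L ih =>
    exact supportedOn_gates_append (ih.mono (ladderQubits_subset_cons p L xb))
      (supportedOn_rung (ladderQubits_subset_cons p L xb (prevQ_mem L xb))
        (fst_mem_ladderQubits p L xb) (snd_mem_ladderQubits p L xb))

theorem supportedOn_ladder (L : List (Q × Q)) (xb : Q) :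
    SupportedOn (ladder L xb).gates (ladderQubits L xb) :=
  supportedOn_gates_append (supportedOn_hLayer fun _ hp => (mem_ladderQubits hp).2)
    (supportedOn_gates_append (supportedOn_pre fun _ hp => mem_ladderQubits hp)
      (supportedOn_chain L xb))

theorem valid_rung {L : List (Q × Q)} {xb : Q} {p : Q × Q} (h : LadderNodup (p :: L) xb) :
    (rung L xb p).Valid := by
  obtain ⟨-, h1, -, h3⟩ := h.cons
  refine (valid_cxS ?_).append (Sched.Valid.append ?_ (valid_hS _))
  · rintro h'; exact h3 (h' ▸ prevQ_mem L xb)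
  · cases L
    · exact valid_halfN h1
    · exact valid_halfP h1

theorem valid_chain {L : List (Q × Q)} {xb : Q} (h : LadderNodup L xb) : (chain L xb).Valid := by
  induction L with
  | nil => exact Sched.valid_nil
  | cons p L ih => exact (ih h.cons.1).append (valid_rung h)

theorem valid_pre {L : List (Q × Q)} (h : ∀ p ∈ L, p.1 ≠ p.2)
    (hp : L.Pairwise fun p p' => p.1 ≠ p'.1 ∧ p.1 ≠ p'.2 ∧ p.2 ≠ p'.1 ∧ p.2 ≠ p'.2) :
    (pre L).Valid := by
  simp only [pre, Sched.valid_cons, List.pairwise_map, List.mem_map]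
  refine ⟨⟨?_, hp.imp ?_⟩, ⟨?_, hp.imp ?_⟩, ⟨?_, hp.imp ?_⟩, Sched.valid_nil⟩
  · rintro _ ⟨p, -, rfl⟩; rfl
  · rintro p p' ⟨-, -, -, h4⟩; simpa [Gate.qubits] using h4
  · rintro _ ⟨p, hp, rfl⟩; exact cx_type (h p hp)
  · rintro p p' ⟨h1, h2, h3, h4⟩
    refine Disjoint.mono (cx_qubits_subset _ _) (cx_qubits_subset _ _) ?_
    simp [h1, h2, h4, eq_comm]
    tauto
  · rintro _ ⟨p, -, rfl⟩; rfl
  · rintro p p' ⟨-, -, -, h4⟩; simpa [Gate.qubits] using h4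

theorem ladderMap_apply {L : List (Q × Q)} {xb q : Q} (hq : q ∉ L.map Prod.snd)
    (z : Q → Fin 2) : ladderMap L xb z q = z q := by
  induction L with
  | nil => rfl
  | cons p L ih =>
    simp only [List.map_cons, List.mem_cons, not_or] at hq
    simp only [ladderMap, Function.comp_apply, toggle]
    rw [Function.update_of_ne hq.1, ih hq.2]

/-- The ancilla `p.2` of the top rung is added to the value of the ladder; the value is the conjunction
of `p.1` and the value of the ladder below only if `p.2` is `1`. -/
theorem ladderTop_cons {p : Q × Q} {L : List (Q × Q)} {xb : Q} (h : LadderNodup (p :: L) xb)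
    (z : Q → Fin 2) :
    ladderTop (p :: L) xb z = 1 + (z p.2 + z p.1 * ladderTop L xb z) := by
  obtain ⟨-, h1, h2, h3⟩ := h.cons
  simp only [ladderQubits, Set.mem_ofPred_eq, not_or] at h2 h3
  simp only [ladderTop, ladderMap, prevVal, Function.comp_apply, toggle, Function.update_self]
  rw [ladderMap_apply h2.2.2, ladderMap_apply h3.2.2]

/-- A ladder depends only on its own qubits. -/
theorem ladderTop_congr {L : List (Q × Q)} {xb : Q} (h : LadderNodup L xb) {z z' : Q → Fin 2}
    (hz : ∀ q ∈ ladderQubits L xb, z q = z' q) : ladderTop L xb z = ladderTop L xb z' := by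
  induction L with
  | nil => exact hz xb (by simp [ladderQubits])
  | cons p L ih =>
    rw [ladderTop_cons h, ladderTop_cons h,
      ih h.cons.1 fun q hq => hz q (ladderQubits_subset_cons p L xb hq),
      hz p.1 (fst_mem_ladderQubits p L xb), hz p.2 (snd_mem_ladderQubits p L xb)]

variable [Fintype Q]

/-- The gates on the first pair commute with those on the other pairs. -/
theorem op_pre_cons {p : Q × Q} {L : List (Q × Q)}
    (h : ∀ p' ∈ L, p.1 ≠ p'.1 ∧ p.1 ≠ p'.2 ∧ p.2 ≠ p'.1 ∧ p.2 ≠ p'.2) :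
    (pre (p :: L)).op = (pre L).op * (halfN p.1 p.2).op := by
  have hp : ∀ {f : Q × Q → Gate Q} {l : List (Gate Q)} , SupportedOn l {p.1, p.2} →
      (∀ p' ∈ L, ∀ q ∈ (f p').qubits, q = p'.1 ∨ q = p'.2) →
      Commute (seqOp l) (seqOp (L.map f)) := by
    intro f l hl hf
    refine seqOp_commute hl (S' := {q | ∃ p' ∈ L, q = p'.1 ∨ q = p'.2}) ?_ ?_
    · exact supportedOn_map fun p' hp' q hq => ⟨p', hp', hf p' hp' q hq⟩
    · rw [Set.disjoint_left]
      rintro q hq ⟨p', hp', hq'⟩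
      have := h p' hp'
      simp only [Set.mem_insert_iff, Set.mem_singleton_iff] at hq
      rcases hq with rfl | rfl <;> tauto
  have hT : ∀ p' ∈ L, ∀ q ∈ (Gate.t p'.2).qubits, q = p'.1 ∨ q = p'.2 := by
    intro p' _ q hq; simp [Gate.qubits] at hq; exact Or.inr hq
  have hC : ∀ p' ∈ L, ∀ q ∈ (cx p'.1 p'.2).qubits, q = p'.1 ∨ q = p'.2 := by
    intro p' _ q hq; simpa using cx_qubits_subset _ _ hq
  have hsc : SupportedOn [cx p.1 p.2] {p.1, p.2} := by
    intro g hg q hq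
    simp at hg; subst hg
    simpa using cx_qubits_subset _ _ hq
  have hsd : SupportedOn [Gate.tdg p.2] {p.1, p.2} := by
    intro g hg q hq
    simp at hg; subst hg
    simp [Gate.qubits] at hq; simp [hq]
  have h1 := hp hsc hT
  have h2 := hp hsd hT
  have h3 := hp hsd hC
  simp only [seqOp, one_mul] at h1 h2 h3
  simp only [pre, halfN, Sched.op_cons, Sched.op_nil, one_mul, List.map_cons, seqOp]
  generalize seqOp (L.map fun p => Gate.t p.2) = LT at *
  generalize seqOp (L.map fun p => cx p.1 p.2) = LC at *
  generalize seqOp (L.map fun p => Gate.tdg p.2) = LD at *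
  calc _ = LD * ((Gate.tdg p.2).op * LC) * ((cx p.1 p.2).op * LT) * (Gate.t p.2).op := by
        simp only [mul_assoc]
    _ = LD * LC * ((Gate.tdg p.2).op * LT) * (cx p.1 p.2).op * (Gate.t p.2).op := by
        rw [h3.eq, h1.eq]; simp only [mul_assoc]
    _ = _ := by rw [h2.eq]; simp only [mul_assoc]

/-- The relative-phase Toffoli gate of the rung `p` on top of `L`. -/
noncomputable def rungOp (L : List (Q × Q)) (xb : Q) (p : Q × Q) : Operator Q :=
  blk p.2 fun z => matH * ((match L with
    | [] => reflN (z p.1)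
    | _ :: _ => reflP (z p.1)) * powX (z (prevQ L xb)) * reflN (z p.1)) * matH

/-- The part of the top rung that is executed in parallel with the others is moved to the end. -/
theorem op_ladder_cons {p : Q × Q} {L : List (Q × Q)} {xb : Q} (h : LadderNodup (p :: L) xb) :
    (ladder (p :: L) xb).op = rungOp L xb p * (ladder L xb).op := by
  obtain ⟨h0, h1, h2, h3⟩ := h.cons
  have hne : prevQ L xb ≠ p.2 := fun h' => h3 (h' ▸ prevQ_mem L xb)
  have hd := disjoint_ladderQubits h
  have c1 : Commute (hS p.2 ++ halfN p.1 p.2).op (pre L ++ chain L xb).op :=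
    Sched.op_commute (supportedOn_gates_append (supportedOn_hS (by simp))
      (supportedOn_halfN (by simp) (by simp)))
      (supportedOn_gates_append (supportedOn_pre fun _ hp => mem_ladderQubits hp)
        (supportedOn_chain L xb)) hd
  have c2 : Commute (halfN p.1 p.2).op (hLayer L).op :=
    Sched.op_commute (supportedOn_halfN (by simp) (by simp))
      (supportedOn_hLayer fun _ hp => (mem_ladderQubits hp).2) hd
  have c3 : Commute (hS p.2).op (hLayer L).op :=
    Sched.op_commute (supportedOn_hS (by simp))
      (supportedOn_hLayer fun _ hp => (mem_ladderQubits hp).2) hd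
  have c4 : Commute (hS p.2 ++ halfN p.1 p.2).op (hLayer L).op := by
    rw [Sched.op_append]; exact c2.mul_left c3
  have hrung : (hS p.2 ++ (halfN p.1 p.2 ++ rung L xb p)).op = rungOp L xb p := by
    have i1 : IndepOf p.2 fun z : Q → Fin 2 => z p.1 := IndepOf.apply h1
    have i2 : IndepOf p.2 fun z : Q → Fin 2 => z (prevQ L xb) := IndepOf.apply hne
    simp only [rung, rungOp]
    cases L
    · simp only [Sched.op_append, op_hS, op_halfN h1, op_cxS hne]
      rw [blk_mul (IndepOf.const _ _), blk_mul (i1.comp fun b => matH * reflN b),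
        blk_mul (i1.comp₂ (fun b a => matH * reflN b * powX a) i2),
        blk_mul ((i1.comp₂ (fun b a => matH * reflN b * powX a * reflN b) i2))]
      simp only [mul_assoc]
    · simp only [Sched.op_append, op_hS, op_halfN h1, op_halfP h1, op_cxS hne]
      rw [blk_mul (IndepOf.const _ _), blk_mul (i1.comp fun b => matH * reflP b),
        blk_mul (i1.comp₂ (fun b a => matH * reflP b * powX a) i2),
        blk_mul ((i1.comp₂ (fun b a => matH * reflP b * powX a * reflN b) i2))]
      simp only [mul_assoc]
  have hpre : ∀ p' ∈ L, p.1 ≠ p'.1 ∧ p.1 ≠ p'.2 ∧ p.2 ≠ p'.1 ∧ p.2 ≠ p'.2 :=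
    (List.pairwise_cons.1 (pairwise_of_ladderNodup h)).1
  have hh : (hLayer (p :: L)).op = (hLayer L).op * (hS p.2).op := by
    simp [hLayer, hS, Sched.op, seqOp]
  rw [← hrung]
  simp only [ladder, Sched.op_append, chain, op_pre_cons hpre, hh] at c1 c2 c4 ⊢
  generalize (hLayer L).op = HL at *
  generalize (hS p.2).op = H at *
  generalize (halfN p.1 p.2).op = N at *
  generalize (pre L).op = PL at *
  generalize (chain L xb).op = CL at *
  calc _ = (rung L xb p).op * (CL * PL) * (N * HL) * H := by simp only [mul_assoc]
    _ = (rung L xb p).op * ((CL * PL) * HL) * (N * H) := by rw [c2.eq]; simp only [mul_assoc]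
    _ = (rung L xb p).op * (N * H) * ((CL * PL) * HL) := by
        have : Commute (N * H) ((CL * PL) * HL) := c1.mul_right c4
        rw [mul_assoc, ← this.eq, ← mul_assoc]
    _ = _ := by simp only [mul_assoc]

theorem tracks_rungOp {p : Q × Q} {L : List (Q × Q)} {xb : Q} :
    Tracks (rungOp L xb p) (toggle p.2 fun z => z p.1 * prevVal L xb z) := by
  refine tracks_blk fun z => ?_
  cases L
  · exact shiftBy_rung_pos _ _
  · exact shiftBy_rung_neg _ _

theorem tracks_ladder {L : List (Q × Q)} {xb : Q} (h : LadderNodup L xb) :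
    Tracks (ladder L xb).op (ladderMap L xb) := by
  induction L with
  | nil =>
    have : (ladder ([] : List (Q × Q)) xb).op = 1 := by
      simp [ladder, hLayer, pre, chain, Sched.op, seqOp]
    rw [this]
    exact Tracks.one
  | cons p L ih =>
    rw [op_ladder_cons h]
    exact tracks_rungOp.mul (ih h.cons.1)

end Ladder

/-! ### Dirty ancillas -/

section Nest

variable {Q : Type*}

/-- The qubits of a list of triples. -/
def trips (E : List (Q × Q × Q)) : List Q := E.flatMap fun p => [p.1, p.2.1, p.2.2]

theorem trips_cons (p : Q × Q × Q) (E : List (Q × Q × Q)) :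
    trips (p :: E) = p.1 :: p.2.1 :: p.2.2 :: trips E := by simp [trips]

theorem fst_mem_trips {E : List (Q × Q × Q)} {q : Q} (h : q ∈ E.map Prod.fst) : q ∈ trips E := by
  obtain ⟨p, hp, rfl⟩ := List.mem_map.1 h
  exact List.mem_flatMap.2 ⟨p, hp, by simp⟩

/-- The qubits of a ladder and of a list of triples. -/
def nestQubits (L : List (Q × Q)) (xb : Q) (E : List (Q × Q × Q)) : Set Q :=
  {q | q ∈ ladderQubits L xb ∨ q ∈ trips E}

theorem prevVal_of_ne_nil {L : List (Q × Q)} (h : L ≠ []) (xb : Q) (z : Q → Fin 2) :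
    prevVal L xb z = 1 + z (prevQ L xb) := by
  cases L
  · exact absurd rfl h
  · rfl

theorem nestQubits_subset_cons (L : List (Q × Q)) (xb : Q) (p : Q × Q × Q)
    (E : List (Q × Q × Q)) : nestQubits L xb E ⊆ nestQubits L xb (p :: E) :=
  fun _ hq => hq.imp id fun hq => by rw [trips_cons]; simp [hq]

theorem mem_nestQubits_cons (L : List (Q × Q)) (xb : Q) (p : Q × Q × Q) (E : List (Q × Q × Q)) :
    p.1 ∈ nestQubits L xb (p :: E) ∧ p.2.1 ∈ nestQubits L xb (p :: E) ∧
      p.2.2 ∈ nestQubits L xb (p :: E) := by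
  refine ⟨Or.inr ?_, Or.inr ?_, Or.inr ?_⟩ <;> rw [trips_cons] <;> simp

/-- The qubits used by `mid` are pairwise distinct, and the ladder is not trivial. -/
structure MidNodup (L : List (Q × Q)) (xb b τ : Q) (E : List (Q × Q × Q)) : Prop where
  ladder : LadderNodup L xb
  ne_nil : L ≠ []
  nodup : (b :: τ :: trips E).Nodup
  disjoint : ∀ q ∈ b :: τ :: trips E, q ∉ ladderQubits L xb

variable [DecidableEq Q]

/-- The conjunction of the controls of all triples and of the ladder. -/
def nestVal (L : List (Q × Q)) (xb : Q) : List (Q × Q × Q) → (Q → Fin 2) → Fin 2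
  | [] => ladderTop L xb
  | p :: E => fun z => z p.2.1 * (z p.2.2 * nestVal L xb E z)

/-- The permutation of the basis states performed by `nest`: the ancilla of every triple is toggled
by the conjunction of the controls of this triple, those below, and the ladder. -/
def nestMap (L : List (Q × Q)) (xb : Q) : List (Q × Q × Q) → (Q → Fin 2) → (Q → Fin 2)
  | [] => id
  | p :: E => nestMap L xb E ∘ toggle p.1 (nestVal L xb (p :: E))

/-- A relative-phase Toffoli gate with target `d`, positive controls `e` and `e'`, and negative
control `a`. -/
def triple (a d e e' : Q) : Sched Q :=
  swapZY e d ++ (halfN e' d ++ (conjP a e' d ++ swapZY e d))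

/-- For a triple `(d, e, e')` consisting of a dirty ancilla `d` and two controls, and a list of
further triples, toggle `d` by the conjunction of all the controls and the value of the ladder. The
ancillas of the further triples are toggled as well. The parallel part of the ladder is assumed to
have been executed before. -/
def nest (L : List (Q × Q)) (xb : Q) : Q × Q × Q → List (Q × Q × Q) → Sched Q
  | p, [] => chain L xb ++ (triple (prevQ L xb) p.1 p.2.1 p.2.2 ++ Sched.inv (chain L xb))
  | p, p' :: E => (swapZY p.2.1 p.1 ++ conjN p'.1 p.2.2 p.1) ++ (nest L xb p' E ++
      (conjN p'.1 p.2.2 p.1 ++ swapZY p.2.1 p.1))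

/-- The middle part of a multi-controlled phase gate on `τ`: the controls are `b`, those in the
triples `E`, and those of the ladder. -/
def mid (L : List (Q × Q)) (xb b τ : Q) : List (Q × Q × Q) → Sched Q
  | [] => pre ((b, τ) :: L) ++ (chain L xb ++ (conjP (prevQ L xb) b τ ++
      (Sched.inv (chain L xb) ++ Sched.inv (pre L))))
  | p :: E => cxS p.1 τ ++ (pre ((b, τ) :: L) ++ (cxS p.1 τ ++ (nest L xb p E ++
      (conjN p.1 b τ ++ Sched.inv (pre L)))))

theorem nestVal_congr {L : List (Q × Q)} {xb : Q} (h : LadderNodup L xb) {E : List (Q × Q × Q)}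
    {z z' : Q → Fin 2} (hz : ∀ q ∈ nestQubits L xb E, z q = z' q) :
    nestVal L xb E z = nestVal L xb E z' := by
  induction E with
  | nil => exact ladderTop_congr h fun q hq => hz q (Or.inl hq)
  | cons p E ih =>
    simp only [nestVal]
    have h1 : ∀ q ∈ trips (p :: E), z q = z' q := fun q hq => hz q (Or.inr hq)
    rw [trips_cons] at h1
    rw [ih fun q hq => hz q (hq.imp id fun hq => by rw [trips_cons]; simp [hq]),
      h1 p.2.1 (by simp), h1 p.2.2 (by simp)]

theorem nestVal_indepOf {L : List (Q × Q)} {xb : Q} (h : LadderNodup L xb) {E : List (Q × Q × Q)}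
    {q : Q} (hq : q ∉ nestQubits L xb E) : IndepOf q (nestVal L xb E) := by
  intro z b
  refine nestVal_congr h fun q' hq' => ?_
  rw [Function.update_of_ne]
  rintro rfl
  exact hq hq'

theorem nestMap_apply {L : List (Q × Q)} {xb : Q} {E : List (Q × Q × Q)} {q : Q}
    (hq : q ∉ E.map Prod.fst) (z : Q → Fin 2) : nestMap L xb E z q = z q := by
  induction E generalizing z with
  | nil => rfl
  | cons p E ih =>
    simp only [List.map_cons, List.mem_cons, not_or] at hq
    simp only [nestMap, Function.comp_apply]
    rw [ih hq.2, toggle, Function.update_of_ne hq.1]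

theorem supportedOn_triple {a d e e' : Q} {S : Set Q} (ha : a ∈ S) (hd : d ∈ S) (he : e ∈ S)
    (he' : e' ∈ S) : SupportedOn (triple a d e e').gates S :=
  supportedOn_gates_append (supportedOn_swapZY he hd) (supportedOn_gates_append
    (supportedOn_halfN he' hd) (supportedOn_gates_append (supportedOn_conjP ha he' hd)
      (supportedOn_swapZY he hd)))

theorem valid_triple {a d e e' : Q} (ha : a ≠ d) (he : e ≠ d) (he' : e' ≠ d) :
    (triple a d e e').Valid :=
  (valid_swapZY he).append ((valid_halfN he').append ((valid_conjP ha he').append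
    (valid_swapZY he)))

theorem supportedOn_nest (L : List (Q × Q)) (xb : Q) (p : Q × Q × Q) (E : List (Q × Q × Q)) :
    SupportedOn (nest L xb p E).gates (nestQubits L xb (p :: E)) := by
  induction E generalizing p with
  | nil =>
    have hc : SupportedOn (chain L xb).gates (nestQubits L xb [p]) :=
      (supportedOn_chain L xb).mono fun _ => Or.inl
    obtain ⟨h1, h2, h3⟩ := mem_nestQubits_cons L xb p []
    exact supportedOn_gates_append hc (supportedOn_gates_append
      (supportedOn_triple (Or.inl (prevQ_mem L xb)) h1 h2 h3) (Sched.supportedOn_inv hc))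
  | cons p' E ih =>
    obtain ⟨h1, h2, h3⟩ := mem_nestQubits_cons L xb p (p' :: E)
    have h4 := nestQubits_subset_cons L xb p _ (mem_nestQubits_cons L xb p' E).1
    exact supportedOn_gates_append (supportedOn_gates_append (supportedOn_swapZY h2 h1)
      (supportedOn_conjN h4 h3 h1)) (supportedOn_gates_append
        ((ih p').mono (nestQubits_subset_cons L xb p _))
        (supportedOn_gates_append (supportedOn_conjN h4 h3 h1) (supportedOn_swapZY h2 h1)))

theorem valid_nest {L : List (Q × Q)} {xb : Q} {p : Q × Q × Q} {E : List (Q × Q × Q)}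
    (hL : LadderNodup L xb) (hnd : (trips (p :: E)).Nodup)
    (hd : ∀ q ∈ trips (p :: E), q ∉ ladderQubits L xb) : (nest L xb p E).Valid := by
  induction E generalizing p with
  | nil =>
    rw [trips_cons] at hnd hd
    simp only [List.nodup_cons, List.mem_cons, not_or] at hnd
    have hp := hd p.1 (by simp)
    refine (valid_chain hL).append (Sched.Valid.append (valid_triple ?_ ?_ ?_)
      (valid_chain hL).inv)
    · exact fun h => hp (h ▸ prevQ_mem L xb)
    · exact fun h => hnd.1.1 h.symm
    · exact fun h => hnd.1.2.1 h.symm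
  | cons p' E ih =>
    rw [trips_cons] at hnd hd
    have hr : ∀ q ∈ trips (p' :: E), q ∉ ladderQubits L xb := fun q hq => hd q (by simp [hq])
    have hn : (trips (p' :: E)).Nodup := by
      simp only [List.nodup_cons] at hnd; exact hnd.2.2.2
    rw [trips_cons p' E] at hnd
    simp only [List.nodup_cons, List.mem_cons, not_or] at hnd
    have h1 : p.2.1 ≠ p.1 := fun h => hnd.1.1 h.symm
    have h2 : p.2.2 ≠ p.1 := fun h => hnd.1.2.1 h.symm
    have h3 : p'.1 ≠ p.1 := fun h => hnd.1.2.2.1 h.symm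
    exact ((valid_swapZY h1).append (valid_conjN h3 h2)).append ((ih hn hr).append
      ((valid_conjN h3 h2).append (valid_swapZY h1)))

/-- The operator of `nest`, with the parallel part of the ladder before it and its inverse after
it. -/
def nestOp (L : List (Q × Q)) (xb : Q) (p : Q × Q × Q) (E : List (Q × Q × Q)) :
    Sched Q := (hLayer L ++ pre L) ++ (nest L xb p E ++ Sched.inv (hLayer L ++ pre L))

theorem supportedOn_nestOp (L : List (Q × Q)) (xb : Q) (p : Q × Q × Q) (E : List (Q × Q × Q)) :
    SupportedOn (nestOp L xb p E).gates (nestQubits L xb (p :: E)) := by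
  have h : SupportedOn (hLayer L ++ pre L).gates (nestQubits L xb (p :: E)) :=
    supportedOn_gates_append (supportedOn_hLayer fun _ hp => Or.inl (mem_ladderQubits hp).2)
      (supportedOn_pre fun _ hp => ⟨Or.inl (mem_ladderQubits hp).1, Or.inl (mem_ladderQubits hp).2⟩)
  exact supportedOn_gates_append h
    (supportedOn_gates_append (supportedOn_nest L xb p E) (Sched.supportedOn_inv h))

variable [Fintype Q]

theorem op_triple {a d e e' : Q} (ha : a ≠ d) (he : e ≠ d) (he' : e' ≠ d) :
    (triple a d e e').op = blk d fun z => matH * reflN (z e) * matH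
      * phaseZ (z e' * (1 + z a)) * (matH * reflN (z e) * matH) := by
  have i1 : IndepOf d fun z : Q → Fin 2 => z a := IndepOf.apply ha
  have i2 : IndepOf d fun z : Q → Fin 2 => z e := IndepOf.apply he
  have i3 : IndepOf d fun z : Q → Fin 2 => z e' := IndepOf.apply he'
  simp only [triple, Sched.op_append, op_swapZY he, op_halfN he', op_conjP ha he']
  simp only [mul_assoc (blk d _)]
  rw [blk_mul (i3.comp reflN), blk_mul (i1.comp₂ (fun x y => powX x * reflP y * powX x) i3),
    blk_mul (i2.comp fun b => matH * reflN b * matH)]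
  simp only [← ccPhase, mul_assoc]

/-- The ladder, or the ancilla `p'.1` of the next triple, is a control of two gates on `p.1`, once before
and once after it is toggled. Both gates together contribute the change of its value, so that the
unknown initial value of a dirty ancilla only leads to a sign. -/
theorem tracks_nestOp {L : List (Q × Q)} {xb : Q} {p : Q × Q × Q} {E : List (Q × Q × Q)}
    (hL : LadderNodup L xb) (hne : L ≠ []) (hnd : (trips (p :: E)).Nodup)
    (hd : ∀ q ∈ trips (p :: E), q ∉ ladderQubits L xb) :
    Tracks (nestOp L xb p E).op (nestMap L xb (p :: E)) := by
  induction E generalizing p with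
  | nil =>
    rw [trips_cons] at hnd hd
    simp only [List.nodup_cons, List.mem_cons, not_or] at hnd
    have hp1 := hd p.1 (by simp)
    have hp2 := hd p.2.1 (by simp)
    have hp3 := hd p.2.2 (by simp)
    have ha : prevQ L xb ≠ p.1 := fun h => hp1 (h ▸ prevQ_mem L xb)
    have he : p.2.1 ≠ p.1 := fun h => hnd.1.1 h.symm
    have he' : p.2.2 ≠ p.1 := fun h => hnd.1.2.1 h.symm
    have hmap : ∀ q, q ∉ ladderQubits L xb → q ∉ L.map Prod.snd := fun q hq h =>
      hq (Or.inr (Or.inr h))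
    have hop : (nestOp L xb p []).op = (Sched.inv (ladder L xb)).op
        * ((triple (prevQ L xb) p.1 p.2.1 p.2.2).op * (ladder L xb).op) := by
      simp only [nestOp, nest, ladder, Sched.op_append, Sched.inv_append, mul_assoc]
    -- The value at the top of the ladder is stored inverted, hence the negative control of `triple`.
    have key : ∀ z : Q → Fin 2, z p.2.2 * (1 + ladderMap L xb z (prevQ L xb))
        = z p.2.2 * ladderTop L xb z := by
      intro z; rw [ladderTop, prevVal_of_ne_nil hne]
    have i1 : IndepOf p.1 fun z : Q → Fin 2 => z (prevQ L xb) := IndepOf.apply ha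
    have i2 : IndepOf p.1 fun z : Q → Fin 2 => z p.2.1 := IndepOf.apply he
    have i3 : IndepOf p.1 fun z : Q → Fin 2 => z p.2.2 := IndepOf.apply he'
    have i4 : IndepOf p.1 (ladderTop L xb) :=
      nestVal_indepOf (E := []) hL (by simp [nestQubits, trips, hp1])
    rw [hop, op_triple ha he he', blk_mul_of_tracks
      (i2.comp₂ (fun b c => matH * reflN b * matH * phaseZ c * (matH * reflN b * matH))
        (i3.comp₂ (fun b c => b * (1 + c)) i1)) (tracks_ladder hL)
      (seqOp_commute_controlled (supportedOn_ladder L xb) hp1), ← mul_assoc, Sched.op_inv_mul,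
      one_mul]
    · simp only [nestMap, Function.id_comp]
      refine tracks_blk fun z => ?_
      simp only [ladderMap_apply (hmap _ hp2), ladderMap_apply (hmap _ hp3), key]
      exact shiftBy_conj_phaseZ _ _
    · simp only [ladderMap_apply (hmap _ hp2), ladderMap_apply (hmap _ hp3), key]
      exact i2.comp₂ (fun b c => matH * reflN b * matH * phaseZ c * (matH * reflN b * matH))
        (i3.comp₂ (fun b c => b * c) i4)
  | cons p' E ih =>
    rw [trips_cons] at hnd hd
    have hr : ∀ q ∈ trips (p' :: E), q ∉ ladderQubits L xb := fun q hq => hd q (by simp [hq])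
    have hn : (trips (p' :: E)).Nodup := by
      simp only [List.nodup_cons] at hnd; exact hnd.2.2.2
    have ih := ih hn hr
    have hp1 := hd p.1 (by simp)
    have hp2 := hd p.2.1 (by simp)
    have hp3 := hd p.2.2 (by simp)
    simp only [List.nodup_cons, List.mem_cons, not_or] at hnd
    obtain ⟨⟨h12, h13, h14⟩, ⟨h23, h24⟩, h34, -⟩ := hnd
    have hp'E : p'.1 ∉ E.map Prod.fst := by
      rw [trips_cons, List.nodup_cons] at hn
      intro h
      exact hn.1 (by simp [fst_mem_trips h])
    have hp' : p'.1 ∈ trips (p' :: E) := by rw [trips_cons]; simp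
    have ha : p'.1 ≠ p.1 := fun h => h14 (h ▸ hp')
    have he : p.2.1 ≠ p.1 := fun h => h12 h.symm
    have he' : p.2.2 ≠ p.1 := fun h => h13 h.symm
    have hne1 : p.1 ∉ nestQubits L xb (p' :: E) := by
      rintro (h | h)
      exacts [hp1 h, h14 h]
    have hdis : Disjoint ({p.1, p.2.1, p.2.2, p'.1} : Set Q) (ladderQubits L xb) := by
      rw [Set.disjoint_left]
      rintro q (rfl | rfl | rfl | rfl)
      exacts [hp1, hp2, hp3, hr _ hp']
    have hlad : SupportedOn (hLayer L ++ pre L).gates (ladderQubits L xb) :=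
      supportedOn_gates_append (supportedOn_hLayer fun _ hp => (mem_ladderQubits hp).2)
        (supportedOn_pre fun _ hp => mem_ladderQubits hp)
    have hc1 : Commute (swapZY p.2.1 p.1 ++ conjN p'.1 p.2.2 p.1).op (hLayer L ++ pre L).op :=
      Sched.op_commute (supportedOn_gates_append (supportedOn_swapZY (by simp) (by simp))
        (supportedOn_conjN (by simp) (by simp) (by simp))) hlad hdis
    have hc2 : Commute (conjN p'.1 p.2.2 p.1 ++ swapZY p.2.1 p.1).op
        (Sched.inv (hLayer L ++ pre L)).op :=
      Sched.op_commute (supportedOn_gates_append (supportedOn_conjN (by simp) (by simp) (by simp))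
        (supportedOn_swapZY (by simp) (by simp))) (Sched.supportedOn_inv hlad) hdis
    have i1 : IndepOf p.1 fun z : Q → Fin 2 => z p'.1 := IndepOf.apply ha
    have i2 : IndepOf p.1 fun z : Q → Fin 2 => z p.2.1 := IndepOf.apply he
    have i3 : IndepOf p.1 fun z : Q → Fin 2 => z p.2.2 := IndepOf.apply he'
    have i4 : IndepOf p.1 (nestVal L xb (p' :: E)) := nestVal_indepOf hL hne1
    have hop : (nestOp L xb p (p' :: E)).op
        = (conjN p'.1 p.2.2 p.1 ++ swapZY p.2.1 p.1).op * ((nestOp L xb p' E).op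
          * (swapZY p.2.1 p.1 ++ conjN p'.1 p.2.2 p.1).op) := by
      rw [nestOp, nest, nestOp]
      generalize swapZY p.2.1 p.1 ++ conjN p'.1 p.2.2 p.1 = A at *
      generalize conjN p'.1 p.2.2 p.1 ++ swapZY p.2.1 p.1 = B at *
      generalize hLayer L ++ pre L = H at *
      simp only [Sched.op_append] at *
      calc _ = (Sched.inv H).op * B.op * (nest L xb p' E).op * (A.op * H.op) := by
            simp only [mul_assoc]
        _ = _ := by rw [hc1.eq, ← hc2.eq]; simp only [mul_assoc]
    have hS : Sched.op (conjN p'.1 p.2.2 p.1 ++ swapZY p.2.1 p.1)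
        = blk p.1 fun z => matH * reflN (z p.2.1) * matH
          * (powX (z p'.1) * reflN (z p.2.2) * powX (z p'.1)) := by
      rw [Sched.op_append, op_swapZY he, op_conjN ha he',
        blk_mul (i2.comp fun b => matH * reflN b * matH)]
    have hS' : Sched.op (swapZY p.2.1 p.1 ++ conjN p'.1 p.2.2 p.1)
        = blk p.1 fun z => (powX (z p'.1) * reflN (z p.2.2) * powX (z p'.1))
          * (matH * reflN (z p.2.1) * matH) := by
      rw [Sched.op_append, op_swapZY he, op_conjN ha he',
        blk_mul (i1.comp₂ (fun x y => powX x * reflN y * powX x) i3)]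
    have hmap : ∀ q, q ∉ trips (p' :: E) → ∀ z, nestMap L xb (p' :: E) z q = z q :=
      fun q hq z => nestMap_apply (fun h => hq (fst_mem_trips h)) z
    have hmap' : ∀ z, nestMap L xb (p' :: E) z p'.1 = z p'.1 + nestVal L xb (p' :: E) z := by
      intro z
      rw [nestMap, Function.comp_apply, nestMap_apply hp'E, toggle, Function.update_self]
    have hind : IndepOf p.1 fun z => matH * reflN (z p.2.1) * matH
          * (powX (z p'.1 + nestVal L xb (p' :: E) z) * reflN (z p.2.2)
            * powX (z p'.1 + nestVal L xb (p' :: E) z)) :=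
      (i2.comp fun b => matH * reflN b * matH).comp₂ (· * ·)
        ((i1.comp₂ (· + ·) i4).comp₂ (fun x y => powX x * reflN y * powX x) i3)
    rw [hop, hS, hS', ← mul_assoc, blk_mul_of_tracks ((i2.comp fun b =>
      matH * reflN b * matH).comp₂ (· * ·) (i1.comp₂ (fun x y => powX x * reflN y * powX x) i3)) ih
      (seqOp_commute_controlled (supportedOn_nestOp L xb p' E) hne1), mul_assoc]
    · refine ih.mul ?_
      simp only [hmap _ h24, hmap _ h34, hmap']
      rw [blk_mul hind]
      refine tracks_blk fun z => ?_
      -- The two reflections controlled by `p.2.2` and `p'.1` combine to a phase gate, up to sign.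
      have := togglePhase (z p'.1) (z p.2.2) (nestVal L xb (p' :: E) z)
      have e : matH * reflN (z p.2.1) * matH
          * (powX (z p'.1 + nestVal L xb (p' :: E) z) * reflN (z p.2.2)
            * powX (z p'.1 + nestVal L xb (p' :: E) z))
          * (powX (z p'.1) * reflN (z p.2.2) * powX (z p'.1) * (matH * reflN (z p.2.1) * matH))
          = (if z p.2.2 * nestVal L xb (p' :: E) z = 1 ∧ z p'.1 = 1 then -1 else 1 : ℂ) •
            (matH * reflN (z p.2.1) * matH * phaseZ (z p.2.2 * nestVal L xb (p' :: E) z)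
              * (matH * reflN (z p.2.1) * matH)) := by
        rw [← Matrix.smul_mul, ← Matrix.mul_smul, ← this]
        simp only [mul_assoc]
      rw [e]
      exact (shiftBy_conj_phaseZ _ _).smul _
    · simp only [hmap _ h24, hmap _ h34, hmap']
      exact hind

end Nest

/-! ### Multi-controlled phase gates -/

section Mid

variable {Q : Type*} {L : List (Q × Q)} {xb b τ : Q} {E : List (Q × Q × Q)}

theorem MidNodup.facts (h : MidNodup L xb b τ E) : b ≠ τ ∧ b ∉ nestQubits L xb E ∧
    τ ∉ nestQubits L xb E := by
  have h1 := h.nodup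
  have h2 := h.disjoint
  simp only [List.nodup_cons, List.mem_cons, not_or] at h1
  refine ⟨h1.1.1, ?_, ?_⟩
  · rintro (h3 | h3)
    exacts [h2 b (by simp) h3, h1.1.2 h3]
  · rintro (h3 | h3)
    exacts [h2 τ (by simp) h3, h1.2.1 h3]

theorem MidNodup.pairwise (h : MidNodup L xb b τ E) :
    ∀ p' ∈ L, b ≠ p'.1 ∧ b ≠ p'.2 ∧ τ ≠ p'.1 ∧ τ ≠ p'.2 := by
  obtain ⟨-, hb, ht⟩ := h.facts
  intro p hp
  have := mem_ladderQubits (xb := xb) hp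
  refine ⟨?_, ?_, ?_, ?_⟩ <;> rintro rfl
  · exact hb (Or.inl this.1)
  · exact hb (Or.inl this.2)
  · exact ht (Or.inl this.1)
  · exact ht (Or.inl this.2)

variable [DecidableEq Q]

/-- The schedule `mid`, with the `H` gates of the ladder before and after it. -/
def midFull (L : List (Q × Q)) (xb b τ : Q) (E : List (Q × Q × Q)) : Sched Q :=
  hLayer L ++ (mid L xb b τ E ++ Sched.inv (hLayer L))

/-- The qubits used by `mid`. -/
def midQubits (L : List (Q × Q)) (xb b τ : Q) (E : List (Q × Q × Q)) : Set Q :=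
  {q | q = b ∨ q = τ ∨ q ∈ nestQubits L xb E}

theorem supportedOn_mid : SupportedOn (mid L xb b τ E).gates (midQubits L xb b τ E) := by
  have hb : b ∈ midQubits L xb b τ E := Or.inl rfl
  have ht : τ ∈ midQubits L xb b τ E := Or.inr (Or.inl rfl)
  have hl : ladderQubits L xb ⊆ midQubits L xb b τ E := fun q hq => Or.inr (Or.inr (Or.inl hq))
  have hpre : SupportedOn (pre L).gates (midQubits L xb b τ E) :=
    supportedOn_pre fun p hp => ⟨hl (mem_ladderQubits hp).1, hl (mem_ladderQubits hp).2⟩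
  have hpre' : SupportedOn (pre ((b, τ) :: L)).gates (midQubits L xb b τ E) := by
    refine supportedOn_pre fun p hp => ?_
    rcases List.mem_cons.1 hp with rfl | hp
    · exact ⟨hb, ht⟩
    · exact ⟨hl (mem_ladderQubits hp).1, hl (mem_ladderQubits hp).2⟩
  have hch := (supportedOn_chain L xb).mono hl
  cases E with
  | nil =>
    exact supportedOn_gates_append hpre' (supportedOn_gates_append hch (supportedOn_gates_append
      (supportedOn_conjP (hl (prevQ_mem L xb)) hb ht) (supportedOn_gates_append
        (Sched.supportedOn_inv hch) (Sched.supportedOn_inv hpre))))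
  | cons p E =>
    have hn : nestQubits L xb (p :: E) ⊆ midQubits L xb b τ (p :: E) :=
      fun q hq => Or.inr (Or.inr hq)
    have hp := hn (mem_nestQubits_cons L xb p E).1
    exact supportedOn_gates_append (supportedOn_cxS hp ht) (supportedOn_gates_append hpre'
      (supportedOn_gates_append (supportedOn_cxS hp ht) (supportedOn_gates_append
        ((supportedOn_nest L xb p E).mono hn) (supportedOn_gates_append
          (supportedOn_conjN hp hb ht) (Sched.supportedOn_inv hpre)))))

theorem valid_mid (h : MidNodup L xb b τ E) : (mid L xb b τ E).Valid := by
  obtain ⟨hbt, hb, ht⟩ := h.facts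
  have hpw := pairwise_of_ladderNodup h.ladder
  have hpre : (pre L).Valid := valid_pre (fst_ne_snd_of_ladderNodup h.ladder) hpw
  have hpre' : (pre ((b, τ) :: L)).Valid := by
    refine valid_pre (fun p hp => ?_) (List.Pairwise.cons h.pairwise hpw)
    rcases List.mem_cons.1 hp with rfl | hp
    exacts [hbt, fst_ne_snd_of_ladderNodup h.ladder p hp]
  have hch := valid_chain h.ladder
  cases E with
  | nil =>
    refine hpre'.append (hch.append (Sched.Valid.append (valid_conjP ?_ hbt)
      (hch.inv.append hpre.inv)))
    rintro rfl
    exact ht (Or.inl (prevQ_mem L xb))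
  | cons p E =>
    have hp : p.1 ≠ τ := by
      rintro rfl
      exact ht (mem_nestQubits_cons L xb p E).1
    have hnd := h.nodup
    simp only [List.nodup_cons] at hnd
    exact (valid_cxS hp).append (hpre'.append ((valid_cxS hp).append
      ((valid_nest h.ladder hnd.2.2 fun q hq => h.disjoint q (by simp [hq])).append
        ((valid_conjN hp hbt).append hpre.inv))))

theorem valid_hLayer (h : LadderNodup L xb) : (hLayer L).Valid := by
  simp only [hLayer, Sched.valid_cons, List.pairwise_map, List.mem_map]
  refine ⟨⟨?_, (pairwise_of_ladderNodup h).imp ?_⟩, Sched.valid_nil⟩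
  · rintro _ ⟨p, -, rfl⟩; rfl
  · rintro p p' ⟨-, -, -, h4⟩; simpa [Gate.qubits] using h4

theorem cost_chain_t (L : List (Q × Q)) (xb : Q) : (chain L xb).cost .t = 2 * L.length := by
  induction L with
  | nil => rfl
  | cons p L ih =>
    cases L <;> (simp [chain, rung, cxS, halfN, halfP, hS] at ih ⊢; try omega)

theorem cost_chain_cnot (L : List (Q × Q)) (xb : Q) :
    (chain L xb).cost .cnot = 2 * L.length := by
  induction L with
  | nil => rfl
  | cons p L ih =>
    cases L <;> (simp [chain, rung, cxS, halfN, halfP, hS] at ih ⊢; try omega)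

theorem cost_chain_h (L : List (Q × Q)) (xb : Q) : (chain L xb).cost .h = L.length := by
  induction L with
  | nil => rfl
  | cons p L ih =>
    cases L <;> (simp [chain, rung, cxS, halfN, halfP, hS] at ih ⊢; try omega)

theorem cost_chain_rotation (L : List (Q × Q)) (xb : Q) : (chain L xb).cost .rotation = 0 := by
  induction L with
  | nil => rfl
  | cons p L ih =>
    cases L <;> (simp [chain, rung, cxS, halfN, halfP, hS] at ih ⊢; try omega)

/-- All slots of the sequential part hold a single gate. -/
theorem depth_chain (τ : GateType) (L : List (Q × Q)) (xb : Q) :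
    (chain L xb).depth τ = (chain L xb).cost τ := by
  induction L with
  | nil => rfl
  | cons p L ih =>
    rw [chain, Sched.depth_append, Sched.cost_append, ih]
    cases L <;> simp [rung, cxS, halfN, halfP, hS]

theorem depth_nest (τ : GateType) (L : List (Q × Q)) (xb : Q) (p : Q × Q × Q)
    (E : List (Q × Q × Q)) : (nest L xb p E).depth τ = (nest L xb p E).cost τ := by
  induction E generalizing p with
  | nil => simp [nest, triple, swapZY, halfN, hS, conjP, cxS, halfP, depth_chain]
  | cons p' E ih => simp [nest, swapZY, halfN, hS, conjN, cxS, ih]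

theorem cost_nest (L : List (Q × Q)) (xb : Q) (p : Q × Q × Q) (E : List (Q × Q × Q)) :
    (nest L xb p E).cost .t = 4 * L.length + 8 * E.length + 8 ∧
    (nest L xb p E).cost .cnot = 4 * L.length + 8 * E.length + 6 ∧
    (nest L xb p E).cost .h = 2 * L.length + 4 * E.length + 4 ∧
    (nest L xb p E).cost .rotation = 0 := by
  induction E generalizing p with
  | nil =>
    simp [nest, triple, swapZY, halfN, hS, conjP, cxS, halfP, cost_chain_t, cost_chain_cnot,
      cost_chain_h, cost_chain_rotation]
    omega
  | cons p' E ih =>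
    obtain ⟨h1, h2, h3, h4⟩ := ih p'
    simp [nest, swapZY, halfN, hS, conjN, cxS, h1, h2, h3, h4]
    omega

theorem cost_mid : (mid L xb b τ E).cost .t = 8 * L.length + 8 * E.length + 4 ∧
    (mid L xb b τ E).cost .cnot = 6 * L.length + 8 * E.length + 4 ∧
    (mid L xb b τ E).cost .h = 2 * L.length + 4 * E.length ∧
    (mid L xb b τ E).cost .rotation = 0 := by
  cases E with
  | nil =>
    simp [mid, pre, conjP, cxS, halfP, cost_chain_t, cost_chain_cnot, cost_chain_h,
      cost_chain_rotation]
    omega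
  | cons p E =>
    obtain ⟨h1, h2, h3, h4⟩ := cost_nest L xb p E
    simp [mid, pre, conjN, cxS, halfN, h1, h2, h3, h4]
    omega

theorem depth_mid : (mid L xb b τ E).depth .t ≤ 4 * L.length + 8 * E.length + 6 ∧
    (mid L xb b τ E).depth .cnot ≤ 4 * L.length + 8 * E.length + 5 ∧
    (mid L xb b τ E).depth .h = 2 * L.length + 4 * E.length ∧
    (mid L xb b τ E).depth .rotation = 0 := by
  cases E with
  | nil =>
    simp [mid, pre, conjP, cxS, halfP, depth_chain, cost_chain_t, cost_chain_cnot, cost_chain_h,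
      cost_chain_rotation]
    omega
  | cons p E =>
    obtain ⟨h1, h2, h3, h4⟩ := cost_nest L xb p E
    simp [mid, pre, conjN, cxS, halfN, depth_nest, h1, h2, h3, h4]
    omega

theorem phaseZ_offDiag (w : Fin 2) : phaseZ w 0 1 = 0 ∧ phaseZ w 1 0 = 0 := by
  unfold phaseZ; split_ifs <;> simp

variable [Fintype Q]

/-- Without dirty ancillas, the phase gate is controlled directly by `b` and the top of the ladder. -/
theorem op_midFull_nil (h : MidNodup L xb b τ []) : (midFull L xb b τ []).op
    = Matrix.diagonal fun z => phaseZ (z b * nestVal L xb [] z) (z τ) (z τ) := by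
  obtain ⟨hbt, hb, ht⟩ := h.facts
  have ha : prevQ L xb ≠ τ := by rintro rfl; exact ht (Or.inl (prevQ_mem L xb))
  have htl : τ ∉ ladderQubits L xb := fun h => ht (Or.inl h)
  have hbl : b ∉ ladderQubits L xb := fun h => hb (Or.inl h)
  have hc : Commute (halfN b τ).op (hLayer L).op := by
    refine Sched.op_commute (S := {b, τ}) (supportedOn_halfN (by simp) (by simp))
      (supportedOn_hLayer fun _ hp => (mem_ladderQubits (xb := xb) hp).2) ?_
    rw [Set.disjoint_left]
    rintro q (rfl | rfl) <;> assumption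
  have hpre : (pre ((b, τ) :: L)).op = (pre L).op * (halfN b τ).op := op_pre_cons h.pairwise
  have hop : (midFull L xb b τ []).op = (Sched.inv (ladder L xb)).op
      * ((conjP (prevQ L xb) b τ).op * (ladder L xb).op) * (halfN b τ).op := by
    simp only [midFull, mid, ladder, Sched.op_append, Sched.inv_append, hpre, mul_assoc]
    rw [hc.eq]
  have i1 : IndepOf τ fun z : Q → Fin 2 => z b := IndepOf.apply hbt
  have i2 : IndepOf τ fun z : Q → Fin 2 => z (prevQ L xb) := IndepOf.apply ha
  have i3 : IndepOf τ (ladderTop L xb) := nestVal_indepOf (E := []) h.ladder ht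
  have hmap : ∀ z, ladderMap L xb z b = z b :=
    ladderMap_apply fun hq => hbl (Or.inr (Or.inr hq))
  have hpow : ∀ z : Q → Fin 2, ladderMap L xb z (prevQ L xb) = 1 + ladderTop L xb z := by
    intro z
    rw [ladderTop, prevVal_of_ne_nil h.ne_nil]
    generalize ladderMap L xb z (prevQ L xb) = a
    fin_cases a <;> rfl
  have i4 : IndepOf τ fun z => powX (1 + ladderTop L xb z) * reflP (z b)
      * powX (1 + ladderTop L xb z) :=
    i3.comp₂ (fun x y => powX (1 + x) * reflP y * powX (1 + x)) i1
  rw [hop, op_conjP ha hbt, blk_mul_of_tracks (i2.comp₂ (fun x y => powX x * reflP y * powX x) i1)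
    (tracks_ladder h.ladder) (seqOp_commute_controlled (supportedOn_ladder L xb) htl),
    ← mul_assoc, Sched.op_inv_mul, one_mul, op_halfN hbt]
  · simp only [hmap, hpow]
    rw [blk_mul i4]
    have e : ∀ a : Fin 2, 1 + (1 + a) = a := by decide
    simp only [ccPhase, e]
    exact blk_eq_diagonal (fun z => (phaseZ_offDiag _).1) fun z => (phaseZ_offDiag _).2
  · simp only [hmap, hpow]
    exact i4

/-- With dirty ancillas, the target is controlled by the first of them before and after it is toggled.
The operator `nestOp` on the ancillas remains, and the initial value of the ancilla leads to a sign. -/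
theorem op_midFull_cons {p : Q × Q × Q} (h : MidNodup L xb b τ (p :: E)) :
    (midFull L xb b τ (p :: E)).op = (nestOp L xb p E).op * Matrix.diagonal fun z =>
      (if z b * nestVal L xb (p :: E) z = 1 ∧ z p.1 = 1 then -1 else 1)
        * phaseZ (z b * nestVal L xb (p :: E) z) (z τ) (z τ) := by
  obtain ⟨hbt, hb, ht⟩ := h.facts
  have hp1 := (mem_nestQubits_cons L xb p E).1
  have ha : p.1 ≠ τ := by rintro rfl; exact ht hp1
  have hnd := h.nodup
  simp only [List.nodup_cons] at hnd
  have hdl : Disjoint ({p.1, b, τ} : Set Q) (ladderQubits L xb) := by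
    rw [Set.disjoint_left]
    rintro q (rfl | rfl | rfl)
    · exact h.disjoint _ (by rw [trips_cons]; simp)
    · exact h.disjoint _ (by simp)
    · exact h.disjoint _ (by simp)
  have hlad : SupportedOn (hLayer L ++ pre L).gates (ladderQubits L xb) :=
    supportedOn_gates_append (supportedOn_hLayer fun _ hp => (mem_ladderQubits hp).2)
      (supportedOn_pre fun _ hp => mem_ladderQubits hp)
  have hc2 : Commute (conjN p.1 b τ).op (Sched.inv (hLayer L ++ pre L)).op :=
    Sched.op_commute (supportedOn_conjN (by simp) (by simp) (by simp))
      (Sched.supportedOn_inv hlad) hdl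
  have hc3 : Commute (cxS p.1 τ).op (hLayer L).op :=
    Sched.op_commute (supportedOn_cxS (by simp) (by simp))
      (supportedOn_hLayer fun _ hp => (mem_ladderQubits hp).2) hdl
  have hc4 : Commute (halfN b τ).op (hLayer L).op :=
    Sched.op_commute (supportedOn_halfN (by simp) (by simp))
      (supportedOn_hLayer fun _ hp => (mem_ladderQubits hp).2) hdl
  have hpre : (pre ((b, τ) :: L)).op = (pre L).op * (halfN b τ).op := op_pre_cons h.pairwise
  have hc5 : Commute (cxS p.1 τ).op (hLayer L ++ pre L).op :=
    Sched.op_commute (supportedOn_cxS (by simp) (by simp)) hlad hdl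
  -- The gates on the target commute with the parallel part of the ladder.
  have hop : (midFull L xb b τ (p :: E)).op = (conjN p.1 b τ).op
      * ((nestOp L xb p E).op * (conjN p.1 b τ).op) := by
    rw [midFull, mid, nestOp]
    have e : (conjN p.1 b τ).op = (cxS p.1 τ).op * (halfN b τ).op * (cxS p.1 τ).op := by
      simp only [conjN, Sched.op_append, mul_assoc]
    simp only [Sched.op_append, Sched.inv_append, hpre] at *
    generalize (conjN p.1 b τ).op = C at *
    generalize (cxS p.1 τ).op = X at *
    generalize (halfN b τ).op = N at *
    generalize (hLayer L).op = H at *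
    generalize (pre L).op = P at *
    generalize (Sched.inv (hLayer L)).op = H' at *
    generalize (Sched.inv (pre L)).op = P' at *
    calc _ = H' * P' * C * (nest L xb p E).op * X * P * N * (X * H) := by simp only [mul_assoc]
      _ = H' * P' * C * (nest L xb p E).op * X * P * (N * H) * X := by
        rw [hc3.eq]; simp only [mul_assoc]
      _ = H' * P' * C * (nest L xb p E).op * X * (P * H) * N * X := by
        rw [hc4.eq]; simp only [mul_assoc]
      _ = (H' * P' * C) * (nest L xb p E).op * (P * H) * (X * N * X) := by
        have := hc5.eq
        calc _ = H' * P' * C * (nest L xb p E).op * (X * (P * H)) * N * X := by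
              simp only [mul_assoc]
          _ = _ := by rw [this]; simp only [mul_assoc]
      _ = _ := by rw [← hc2.eq, e]; simp only [mul_assoc]
  have hp1E : p.1 ∉ E.map Prod.fst := by
    have h2 := hnd.2.2
    rw [trips_cons, List.nodup_cons] at h2
    intro h
    exact h2.1 (by simp [fst_mem_trips h])
  have hmap : ∀ z, nestMap L xb (p :: E) z b = z b :=
    fun z => nestMap_apply (fun h => hb (Or.inr (fst_mem_trips h))) z
  have hmap' : ∀ z, nestMap L xb (p :: E) z p.1 = z p.1 + nestVal L xb (p :: E) z := by
    intro z
    rw [nestMap, Function.comp_apply, nestMap_apply hp1E, toggle, Function.update_self]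
  have i1 : IndepOf τ fun z : Q → Fin 2 => z b := IndepOf.apply hbt
  have i2 : IndepOf τ fun z : Q → Fin 2 => z p.1 := IndepOf.apply ha
  have i3 : IndepOf τ (nestVal L xb (p :: E)) := nestVal_indepOf h.ladder ht
  have i4 : IndepOf τ fun z => powX (z p.1 + nestVal L xb (p :: E) z) * reflN (z b)
      * powX (z p.1 + nestVal L xb (p :: E) z) :=
    (i2.comp₂ (· + ·) i3).comp₂ (fun x y => powX x * reflN y * powX x) i1
  rw [hop, op_conjN ha hbt, ← mul_assoc, blk_mul_of_tracks
    (i2.comp₂ (fun x y => powX x * reflN y * powX x) i1)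
    (tracks_nestOp h.ladder h.ne_nil hnd.2.2 fun q hq => h.disjoint q (by simp [hq]))
    (seqOp_commute_controlled (supportedOn_nestOp L xb p E) ht), mul_assoc]
  · simp only [hmap, hmap']
    rw [blk_mul i4]
    simp only [togglePhase]
    rw [blk_eq_diagonal]
    · simp only [Matrix.smul_apply, smul_eq_mul]
    · intro z; simp [(phaseZ_offDiag _).1]
    · intro z; simp [(phaseZ_offDiag _).2]
  · simp only [hmap, hmap']
    exact i4

end Mid

/-! ### Computing the parity in logarithmic depth -/

section Fan

variable {Q : Type*}

/-- One qubit out of every pair of consecutive entries, and the last one if the length is odd. -/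
def fanRest : List Q → List Q
  | a :: _ :: l => a :: fanRest l
  | l => l

theorem length_fanRest (l : List Q) : (fanRest l).length = (l.length + 1) / 2 := by
  fun_induction fanRest l with
  | case1 a b l ih => simp [ih]; omega
  | case2 l h =>
    match l, h with
    | [], _ => simp
    | [a], _ => simp
    | a :: b :: l, h => exact absurd rfl (h a b l)

theorem fanRest_sublist (l : List Q) : (fanRest l).Sublist l := by
  fun_induction fanRest l with
  | case1 a b l ih => exact (ih.cons b).cons_cons a
  | case2 l h => exact List.Sublist.refl _

theorem head?_fanRest (l : List Q) : (fanRest l).head? = l.head? := by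
  fun_induction fanRest l <;> simp

variable [DecidableEq Q]

/-- The `CNOT` gates within the pairs of consecutive entries. -/
def fanSlot : List Q → List (Gate Q)
  | a :: b :: l => cx b a :: fanSlot l
  | _ => []

/-- The permutation of the basis states performed by `fanSlot`. -/
def fanMap : List Q → (Q → Fin 2) → (Q → Fin 2)
  | a :: b :: l => fanMap l ∘ toggle a fun z => z b
  | _ => id

theorem length_fanSlot (l : List Q) : (fanSlot l).length = l.length / 2 := by
  fun_induction fanSlot l with
  | case1 a b l ih => simp [ih]; omega
  | case2 l h =>
    match l, h with
    | [], _ => simp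
    | [a], _ => simp
    | a :: b :: l, h => exact absurd rfl (h a b l)

theorem fanMap_apply {l : List Q} {q : Q} (hq : q ∉ l) (z : Q → Fin 2) : fanMap l z q = z q := by
  fun_induction fanMap l generalizing z with
  | case1 a b l ih =>
    simp only [List.mem_cons, not_or] at hq
    rw [Function.comp_apply, ih hq.2.2, toggle, Function.update_of_ne hq.1]
  | case2 l h => rfl

theorem sum_fanRest {l : List Q} (h : l.Nodup) (z : Q → Fin 2) :
    ((fanRest l).map (fanMap l z)).sum = (l.map z).sum := by
  fun_induction fanRest l generalizing z with
  | case1 a b l ih =>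
    simp only [List.nodup_cons, List.mem_cons, not_or] at h
    obtain ⟨⟨hab, hal⟩, hbl, hl⟩ := h
    have e : l.map (toggle a (fun z => z b) z) = l.map z := by
      refine List.map_congr_left fun q hq => ?_
      rw [toggle, Function.update_of_ne]
      rintro rfl; exact hal hq
    simp only [List.map_cons, List.sum_cons, fanMap, Function.comp_apply, ih hl, e]
    rw [fanMap_apply hal, toggle, Function.update_self, add_assoc]
  | case2 l h' =>
    match l, h' with
    | [], _ => simp
    | [a], _ => simp [fanMap]
    | a :: b :: l, h => exact absurd rfl (h a b l)

theorem supportedOn_fanSlot (l : List Q) : SupportedOn (fanSlot l) {q | q ∈ l} := by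
  fun_induction fanSlot l with
  | case1 a b l ih =>
    intro g hg q hq
    rcases List.mem_cons.1 hg with rfl | hg
    · exact mem_of_mem_cx (by simp) (by simp) hq
    · have := ih g hg q hq
      simp only [Set.mem_ofPred_eq] at this
      simp [this]
  | case2 l h => exact supportedOn_nil _

theorem valid_fanSlot {l : List Q} (h : l.Nodup) : Sched.Valid [(.cnot, fanSlot l)] := by
  simp only [Sched.valid_cons, Sched.valid_nil, and_true]
  fun_induction fanSlot l with
  | case1 a b l ih =>
    simp only [List.nodup_cons, List.mem_cons, not_or] at h
    obtain ⟨⟨hab, hal⟩, hbl, hl⟩ := h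
    obtain ⟨h1, h2⟩ := ih hl
    constructor
    · intro g hg
      rcases List.mem_cons.1 hg with rfl | hg
      exacts [cx_type (Ne.symm hab), h1 g hg]
    · refine List.Pairwise.cons (fun g hg => ?_) h2
      rw [Finset.disjoint_left]
      intro q hq hq'
      have h3 : q ∈ l := supportedOn_fanSlot l g hg q hq'
      have h4 := cx_qubits_subset _ _ hq
      simp only [Finset.mem_insert, Finset.mem_singleton] at h4
      rcases h4 with rfl | rfl
      exacts [hbl h3, hal h3]
  | case2 l h' => simp

variable [Fintype Q]

theorem tracks_fanSlot {l : List Q} (h : l.Nodup) : Tracks (seqOp (fanSlot l)) (fanMap l) := by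
  fun_induction fanSlot l with
  | case1 a b l ih =>
    simp only [List.nodup_cons, List.mem_cons, not_or] at h
    obtain ⟨⟨hab, hal⟩, hbl, hl⟩ := h
    rw [seqOp, op_cx (Ne.symm hab), fanMap]
    refine (ih hl).mul (tracks_blk fun z => ?_)
    generalize z b = w
    intro i j hij
    fin_cases w <;> fin_cases i <;> fin_cases j <;> simp_all [powX, matX]
  | case2 l h' =>
    have e : fanMap l = id := by
      match l, h' with
      | [], _ => rfl
      | [a], _ => rfl
      | a :: b :: l, h => exact absurd rfl (h a b l)
    rw [e]
    exact Tracks.one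

/-- The parity of the qubits of the list `l` can be computed into its first entry `τ` by a tree of
`CNOT` gates of logarithmic depth. -/
theorem exists_fan (n : ℕ) (l : List Q) (hn : l.length = n) (hl : l.Nodup) (τ : Q)
    (hτ : l.head? = some τ) :
    ∃ A : Sched Q, A.Valid ∧ SupportedOn A.gates {q | q ∈ l} ∧
      (∀ σ, A.cost σ = if σ = .cnot then n - 1 else 0) ∧
      (∀ σ, A.depth σ = if σ = .cnot then Nat.clog 2 n else 0) ∧
      ∃ ρ, Tracks A.op ρ ∧ (∀ z q, q ∉ l → ρ z q = z q) ∧ ∀ z, ρ z τ = (l.map z).sum := by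
  induction n using Nat.strong_induction_on generalizing l with
  | _ n ih =>
    rcases Nat.lt_or_ge n 2 with h2 | h2
    · obtain ⟨a, rfl⟩ : ∃ a, l = [a] := by
        match l, hτ with
        | [a], _ => exact ⟨a, rfl⟩
        | a :: b :: l, _ => simp at hn; omega
      simp only [List.head?_cons, Option.some.injEq] at hτ
      subst hτ
      simp only [List.length_cons, List.length_nil] at hn
      subst hn
      refine ⟨[], Sched.valid_nil, supportedOn_nil _, by simp, by simp, id, Tracks.one,
        by simp, by simp⟩
    · have hlen : (fanRest l).length = (n + 1) / 2 := by rw [length_fanRest, hn]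
      obtain ⟨A, hv, hs, hc, hd, ρ, hρ, hρ1, hρ2⟩ := ih ((n + 1) / 2) (by omega) (fanRest l) hlen
        (hl.sublist (fanRest_sublist l)) ((head?_fanRest l).trans hτ)
      refine ⟨(.cnot, fanSlot l) :: A, ?_, ?_, ?_, ?_, ρ ∘ fanMap l, ?_, ?_, ?_⟩
      · exact (valid_fanSlot hl).append hv
      · rw [Sched.gates_cons]
        exact (supportedOn_fanSlot l).append (hs.mono fun q hq => (fanRest_sublist l).subset hq)
      · intro σ
        rw [Sched.cost_cons, hc, length_fanSlot, hn]
        by_cases hσ : σ = .cnot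
        · simp [hσ]; omega
        · simp [hσ, Ne.symm hσ]
      · intro σ
        rw [Sched.depth_cons, hd]
        by_cases hσ : σ = .cnot
        · simp only [hσ, if_true]
          rw [Nat.clog_of_two_le one_lt_two h2, add_comm]
          rfl
        · simp [hσ, Ne.symm hσ]
      · rw [Sched.op_cons]
        exact hρ.mul (tracks_fanSlot hl)
      · intro z q hq
        rw [Function.comp_apply, hρ1 _ _ fun h => hq ((fanRest_sublist l).subset h),
          fanMap_apply hq]
      · intro z
        rw [Function.comp_apply, hρ2, sum_fanRest hl]

end Fan

/-! ### Rotations -/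

section Euler

theorem exists_polar (u v : ℝ) : ∃ φ : ℝ, u = Real.sqrt (u ^ 2 + v ^ 2) * Real.cos φ ∧
    v = Real.sqrt (u ^ 2 + v ^ 2) * Real.sin φ := by
  have h : ‖(⟨u, v⟩ : ℂ)‖ = Real.sqrt (u ^ 2 + v ^ 2) := by
    rw [Complex.norm_def, Complex.normSq_mk, pow_two, pow_two]
  refine ⟨Complex.arg ⟨u, v⟩, ?_, ?_⟩
  · rw [← h, Complex.norm_mul_cos_arg]
  · rw [← h, Complex.norm_mul_sin_arg]

/-- A point of the three-dimensional sphere in spherical coordinates. -/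
theorem exists_spherical {w x y z : ℝ} (h : w ^ 2 + x ^ 2 + y ^ 2 + z ^ 2 = 1) :
    ∃ θ b a : ℝ, w = Real.cos θ ∧ x = Real.sin θ * Real.cos b ∧
      y = Real.sin θ * Real.sin b * Real.cos a ∧ z = Real.sin θ * Real.sin b * Real.sin a := by
  obtain ⟨a, ha1, ha2⟩ := exists_polar y z
  set r := Real.sqrt (y ^ 2 + z ^ 2) with hr
  have hr2 : r ^ 2 = y ^ 2 + z ^ 2 := Real.sq_sqrt (by positivity)
  obtain ⟨b, hb1, hb2⟩ := exists_polar x r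
  set s := Real.sqrt (x ^ 2 + r ^ 2) with hs
  have hs2 : s ^ 2 = x ^ 2 + r ^ 2 := Real.sq_sqrt (by positivity)
  obtain ⟨θ, hθ1, hθ2⟩ := exists_polar w s
  have h1 : Real.sqrt (w ^ 2 + s ^ 2) = 1 := by
    rw [show w ^ 2 + s ^ 2 = 1 by rw [hs2, hr2]; linarith, Real.sqrt_one]
  rw [h1, one_mul] at hθ1 hθ2
  refine ⟨θ, b, a, hθ1, ?_, ?_, ?_⟩
  · rw [← hθ2]; exact hb1
  · rw [← hθ2, ← hb2]; exact ha1
  · rw [← hθ2, ← hb2]; exact ha2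

theorem matRz_eq (θ : ℝ) : matRz θ =
    !![(Real.cos (θ / 2) : ℂ) - Complex.I * (Real.sin (θ / 2) : ℂ), 0;
      0, (Real.cos (θ / 2) : ℂ) + Complex.I * (Real.sin (θ / 2) : ℂ)] := by
  ext i j
  fin_cases i <;> fin_cases j <;> simp [matRz]
  · rw [← mul_neg, mul_comm, Complex.exp_mul_I, Complex.cos_neg, Complex.sin_neg]; ring
  · rw [mul_comm, Complex.exp_mul_I]; ring

/-- Every element of `SU(2)` is a rotation about some axis, which two rotations about the axes of `Z`
and `X` move to the axis of `X`. -/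
theorem exists_rotation (W : Matrix.specialUnitaryGroup (Fin 2) ℂ) : ∃ a b θ : ℝ,
    (W : Matrix (Fin 2) (Fin 2) ℂ)
      = matRx a * (matRz b * (matRx θ * (matRz (-b) * matRx (-a)))) := by
  obtain ⟨M, hM⟩ := W
  rw [Matrix.mem_specialUnitaryGroup_iff, Matrix.mem_unitaryGroup_iff] at hM
  obtain ⟨hU, hdet⟩ := hM
  have hadj : star M = M.adjugate := by
    have h1 : M * M.adjugate = 1 := by rw [Matrix.mul_adjugate, hdet, one_smul]
    have h2 : star M * M = 1 := mul_eq_one_comm.1 hU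
    calc star M = star M * (M * M.adjugate) := by rw [h1, mul_one]
      _ = M.adjugate := by rw [← mul_assoc, h2, one_mul]
  have h00 : star (M 0 0) = M 1 1 := by
    have := congrFun (congrFun hadj 0) 0
    simpa [Matrix.adjugate_fin_two, Matrix.star_apply] using this
  have h01 : star (M 1 0) = - M 0 1 := by
    have := congrFun (congrFun hadj 0) 1
    simpa [Matrix.adjugate_fin_two, Matrix.star_apply] using this
  set p := M 0 0 with hp
  set q := M 1 0 with hq
  have h11 : M 1 1 = star p := h00.symm
  have h10 : M 0 1 = - star q := by rw [h01, neg_neg]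
  have hnorm : p.re ^ 2 + (-q.im) ^ 2 + q.re ^ 2 + (-p.im) ^ 2 = 1 := by
    rw [Matrix.det_fin_two, h11, h10, ← hp, ← hq] at hdet
    have := congrArg Complex.re hdet
    simp at this
    nlinarith [this]
  obtain ⟨θ, b, a, e1, e2, e3, e4⟩ := exists_spherical hnorm
  refine ⟨a, b, 2 * θ, ?_⟩
  have hM : M = !![(⟨p.re, p.im⟩ : ℂ), -star (⟨q.re, q.im⟩ : ℂ); ⟨q.re, q.im⟩,
      star (⟨p.re, p.im⟩ : ℂ)] := by
    ext i j
    fin_cases i <;> fin_cases j <;> simp [h11, h10, ← hp, ← hq]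
  have ha1 := Real.cos_two_mul' (a / 2)
  have ha2 := Real.sin_two_mul (a / 2)
  have hb1 := Real.cos_two_mul' (b / 2)
  have hb2 := Real.sin_two_mul (b / 2)
  rw [show 2 * (a / 2) = a by ring] at ha1 ha2
  rw [show 2 * (b / 2) = b by ring] at hb1 hb2
  have ha0 := Real.sin_sq_add_cos_sq (a / 2)
  have hb0 := Real.sin_sq_add_cos_sq (b / 2)
  simp only [matRz_eq, matRx, neg_div, Real.cos_neg, Real.sin_neg,
    show 2 * θ / 2 = θ by ring]
  rw [hb1] at e2
  rw [hb2, ha1] at e3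
  rw [hb2, ha2] at e4
  set ca := Real.cos (a / 2)
  set sa := Real.sin (a / 2)
  set cb := Real.cos (b / 2)
  set sb := Real.sin (b / 2)
  set c := Real.cos θ
  set s := Real.sin θ
  have e2' : q.im = - (s * (cb ^ 2 - sb ^ 2)) := by linarith
  have e4' : p.im = - (s * (2 * sb * cb) * (2 * sa * ca)) := by linarith
  have hmul : (ca ^ 2 + sa ^ 2) * (cb ^ 2 + sb ^ 2) = 1 := by
    rw [add_comm, ha0, add_comm, hb0, one_mul]
  rw [hM, e1, e2', e3, e4']
  ext i j
  fin_cases i <;> fin_cases j <;> apply Complex.ext <;> simp [Matrix.mul_apply] <;>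
  first
  | linear_combination (-c) * hmul
  | linear_combination (s * (cb ^ 2 - sb ^ 2)) * ha0
  | linear_combination (0 : ℝ) * ha0

end Euler

/-! ### Layers of one-qubit gates on the targets -/

section Layers

variable {Q ι : Type*} {t : ι → Q} {J : List ι}

/-- The sign `(-1) ^ b` of a bit. -/
def bitSign (b : Fin 2) : ℂ := if b = 1 then -1 else 1

/-- The parity of the qubits `t j`. -/
def parity (t : ι → Q) (J : List ι) (z : Q → Fin 2) : Fin 2 := (J.map fun j => z (t j)).sum

theorem bitSign_mul_self (b : Fin 2) : bitSign b * bitSign b = 1 := by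
  unfold bitSign; split_ifs <;> norm_num

theorem bitSign_add (a b : Fin 2) : bitSign (a + b) = bitSign a * bitSign b := by
  fin_cases a <;> fin_cases b <;> simp [bitSign]

variable [DecidableEq Q]

/-- The parity of the targets is the value of any one of them plus a function of the others. -/
theorem exists_parity_eq (ht : Function.Injective t) (hJ : J.Nodup) {j : ι} (hj : j ∈ J) :
    ∃ r : (Q → Fin 2) → Fin 2, IndepOf (t j) r ∧ ∀ z, parity t J z = z (t j) + r z := by
  induction J with
  | nil => simp at hj
  | cons i J ih =>
    rw [List.nodup_cons] at hJ
    rcases List.mem_cons.1 hj with rfl | hj'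
    · refine ⟨parity t J, ?_, fun z => by simp [parity]⟩
      intro z b
      unfold parity
      congr 1
      refine List.map_congr_left fun i hi => ?_
      rw [Function.update_of_ne]
      intro h
      exact hJ.1 (ht h ▸ hi)
    · obtain ⟨r, hr, hr'⟩ := ih hJ.2 hj'
      refine ⟨fun z => z (t i) + r z, IndepOf.comp₂ (· + ·) (IndepOf.apply ?_) hr, fun z => ?_⟩
      · intro h; exact hJ.1 (ht h ▸ hj')
      · have := hr' z
        simp only [parity, List.map_cons, List.sum_cons] at this ⊢
        rw [this]; abel

variable [Fintype Q]

/-- The operator that applies `U j` to the qubit `t j`, for all `j` in the list `J`. -/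
def layer (t : ι → Q) (J : List ι) (U : ι → Matrix (Fin 2) (Fin 2) ℂ) : Operator Q :=
  (J.map fun j => controlled ∅ (t j) (U j)).prod

theorem controlled_commute_layer (ht : Function.Injective t) {j : ι} (hj : j ∉ J)
    (V : Matrix (Fin 2) (Fin 2) ℂ) (U : ι → Matrix (Fin 2) (Fin 2) ℂ) :
    Commute (controlled ∅ (t j) V) (layer t J U) := by
  refine Commute.list_prod_right _ _ fun M hM => ?_
  obtain ⟨i, hi, rfl⟩ := List.mem_map.1 hM
  refine controlled_commute (fun h => hj (by rw [ht h]; exact hi)) ?_ ?_ ?_ ?_ _ _ <;> simp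

theorem layer_mul (ht : Function.Injective t) (hJ : J.Nodup)
    (U V : ι → Matrix (Fin 2) (Fin 2) ℂ) :
    layer t J U * layer t J V = layer t J fun j => U j * V j := by
  induction J with
  | nil => simp [layer]
  | cons j J ih =>
    rw [List.nodup_cons] at hJ
    have hc := (controlled_commute_layer ht hJ.1 (V j) U).eq
    have ih := ih hJ.2
    simp only [layer, List.map_cons, List.prod_cons] at hc ih ⊢
    rw [← ih, ← controlled_mul (Finset.notMem_empty _)]
    calc _ = controlled ∅ (t j) (U j) * ((J.map fun j => controlled ∅ (t j) (U j)).prod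
          * controlled ∅ (t j) (V j)) * (J.map fun j => controlled ∅ (t j) (V j)).prod := by
          simp only [mul_assoc]
      _ = _ := by rw [← hc]; simp only [mul_assoc]

theorem layer_one : layer t J (fun _ => 1) = 1 := by
  unfold layer
  refine List.prod_eq_one fun M hM => ?_
  obtain ⟨j, -, rfl⟩ := List.mem_map.1 hM
  exact controlled_one _ _

theorem seqOp_map_eq_layer (ht : Function.Injective t) (hJ : J.Nodup) {g : ι → Gate Q}
    {U : ι → Matrix (Fin 2) (Fin 2) ℂ} (h : ∀ j, (g j).op = controlled ∅ (t j) (U j)) :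
    seqOp (J.map g) = layer t J U := by
  induction J with
  | nil => rfl
  | cons j J ih =>
    rw [List.nodup_cons] at hJ
    rw [List.map_cons, seqOp, ih hJ.2, h, ← (controlled_commute_layer ht hJ.1 _ _).eq]
    rfl

theorem diagonal_commute_layer {f : (Q → Fin 2) → ℂ} (hf : ∀ j ∈ J, IndepOf (t j) f)
    (U : ι → Matrix (Fin 2) (Fin 2) ℂ) : Commute (Matrix.diagonal f) (layer t J U) := by
  refine Commute.list_prod_right _ _ fun M hM => ?_
  obtain ⟨i, hi, rfl⟩ := List.mem_map.1 hM
  exact diagonal_commute_controlled (hf i hi) _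

/-- The parity sign is a Pauli `Z` on every target, which anticommutes with the generator of `Rx`. -/
theorem diagonal_bitSign_mul_controlled (ht : Function.Injective t) (hJ : J.Nodup) {j : ι}
    (hj : j ∈ J) (θ : ℝ) :
    Matrix.diagonal (fun z => bitSign (parity t J z)) * controlled ∅ (t j) (matRx θ)
      = controlled ∅ (t j) (matRx (-θ)) * Matrix.diagonal fun z => bitSign (parity t J z) := by
  obtain ⟨r, hr, hr'⟩ := exists_parity_eq ht hJ hj
  have e1 : controlled ∅ (t j) !![1, 0; 0, -1] = Matrix.diagonal fun z => bitSign (z (t j)) := by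
    rw [controlled_eq_blk, blk_eq_diagonal (by simp) (by simp)]
    congr 1
    ext z
    simp only [Finset.notMem_empty, false_imp_iff, implies_true, if_true]
    generalize z (t j) = b
    fin_cases b <;> simp [bitSign]
  have e2 : Matrix.diagonal (fun z => bitSign (parity t J z))
      = controlled ∅ (t j) !![1, 0; 0, -1] * Matrix.diagonal fun z => bitSign (r z) := by
    rw [e1, Matrix.diagonal_mul_diagonal]
    simp only [hr', bitSign_add]
  have hc := (diagonal_commute_controlled (C := ∅) (hr.comp bitSign) (matRx θ)).eq
  have hm : !![1, 0; 0, -1] * matRx θ = matRx (-θ) * !![1, 0; 0, -1] := by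
    ext i j
    fin_cases i <;> fin_cases j <;> simp [matRx, neg_div]
  rw [e2, mul_assoc, hc, ← mul_assoc, controlled_mul (Finset.notMem_empty _), hm,
    ← controlled_mul (Finset.notMem_empty _), mul_assoc]

theorem diagonal_bitSign_mul_layer (ht : Function.Injective t) (hJ : J.Nodup) (θ : ι → ℝ) :
    Matrix.diagonal (fun z => bitSign (parity t J z)) * layer t J (fun j => matRx (θ j))
      = layer t J (fun j => matRx (-θ j)) * Matrix.diagonal fun z => bitSign (parity t J z) := by
  have : ∀ K : List ι, (∀ j ∈ K, j ∈ J) →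
      Matrix.diagonal (fun z => bitSign (parity t J z)) * layer t K (fun j => matRx (θ j))
      = layer t K (fun j => matRx (-θ j)) * Matrix.diagonal fun z => bitSign (parity t J z) := by
    intro K hK
    induction K with
    | nil => simp [layer]
    | cons j K ih =>
      have ih := ih fun i hi => hK i (by simp [hi])
      simp only [layer, List.map_cons, List.prod_cons] at ih ⊢
      rw [← mul_assoc, diagonal_bitSign_mul_controlled ht hJ (hK j (by simp)), mul_assoc, ih,
        mul_assoc]
  exact this J fun _ h => h

theorem indepOf_ite {C : Finset Q} {q : Q} (h : q ∉ C) :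
    IndepOf q fun z : Q → Fin 2 => if ∀ r ∈ C, z r = 1 then (1 : ℂ) else 0 := by
  intro z b
  have : (∀ r ∈ C, Function.update z q b r = 1) ↔ ∀ r ∈ C, z r = 1 := by
    refine forall₂_congr fun r hr => ?_
    rw [Function.update_of_ne]
    rintro rfl; exact h hr
  simp only [this]

/-- The projection onto the basis states in which all qubits in `C` are `1`. -/
def allOnes (C : Finset Q) : Operator Q :=
  Matrix.diagonal fun z => if ∀ q ∈ C, z q = 1 then 1 else 0

theorem controlled_eq_allOnes {C : Finset Q} {q : Q} (h : q ∉ C)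
    (U : Matrix (Fin 2) (Fin 2) ℂ) :
    controlled C q U = 1 - allOnes C + allOnes C * controlled ∅ q U := by
  ext x y
  rw [Matrix.add_apply, Matrix.sub_apply, allOnes, Matrix.diagonal_mul]
  by_cases hoff : ∀ r, r ≠ q → x r = y r
  · have e := (indepOf_ite h).eq_of_eqOff hoff
    rw [e]
    have hxy : x = y ↔ x q = y q := ⟨fun h => h ▸ rfl, fun h' => funext fun r => by
      by_cases hr : r = q
      · subst hr; exact h'
      · exact hoff r hr⟩
    simp only [controlled, if_pos hoff, Finset.notMem_empty, false_imp_iff, implies_true, if_true,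
      Matrix.diagonal_apply, Matrix.one_apply, hxy, e]
    split_ifs <;> simp_all
  · have hxy : x ≠ y := by rintro rfl; exact hoff fun _ _ => rfl
    simp [controlled, if_neg hoff, hxy]

theorem allOnes_mul_self (C : Finset Q) : allOnes C * allOnes C = allOnes C := by
  rw [allOnes, Matrix.diagonal_mul_diagonal]
  congr 1
  ext z
  split_ifs <;> simp

theorem allOnes_commute_layer {C : Finset Q} (h : ∀ j ∈ J, t j ∉ C)
    (U : ι → Matrix (Fin 2) (Fin 2) ℂ) : Commute (allOnes C) (layer t J U) :=
  diagonal_commute_layer (fun j hj => indepOf_ite (h j hj)) U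

theorem prod_controlled {C : Finset Q} (h : ∀ j ∈ J, t j ∉ C)
    (U : ι → Matrix (Fin 2) (Fin 2) ℂ) :
    (J.map fun j => controlled C (t j) (U j)).prod
      = 1 - allOnes C + allOnes C * layer t J U := by
  induction J with
  | nil => simp [layer]
  | cons j J ih =>
    have hj := h j (by simp)
    have hc : Commute (allOnes C) (controlled ∅ (t j) (U j)) :=
      diagonal_commute_controlled (indepOf_ite hj) (U j)
    have hP := allOnes_mul_self C
    rw [List.map_cons, List.prod_cons, ih fun i hi => h i (by simp [hi]),
      controlled_eq_allOnes hj, layer, layer, List.map_cons, List.prod_cons]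
    generalize allOnes C = P at *
    generalize controlled ∅ (t j) (U j) = M at *
    generalize (J.map fun j => controlled ∅ (t j) (U j)).prod = N at *
    have e1 : P * M * P = P * M := by rw [mul_assoc, ← hc.eq, ← mul_assoc, hP]
    have e2 : P * M * (P * N) = P * (M * N) := by rw [← mul_assoc, e1, mul_assoc]
    have e3 : P * (P * N) = P * N := by rw [← mul_assoc, hP]
    simp only [add_mul, sub_mul, mul_add, mul_sub, one_mul, mul_one, hP, e1, e2, e3]
    abel

theorem bitSign_inv (b : Fin 2) : (bitSign b)⁻¹ = bitSign b := by
  unfold bitSign; split_ifs <;> norm_num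

theorem bitSign_ne_zero (b : Fin 2) : bitSign b ≠ 0 := by
  unfold bitSign; split_ifs <;> norm_num

theorem eq_diagonal_inv {f : (Q → Fin 2) → ℂ} {M : Operator Q} (hf : ∀ z, f z ≠ 0)
    (h : M * Matrix.diagonal f = 1) : M = Matrix.diagonal fun z => (f z)⁻¹ := by
  have h1 : Matrix.diagonal f * Matrix.diagonal (fun z => (f z)⁻¹) = 1 := by
    rw [Matrix.diagonal_mul_diagonal, ← Matrix.diagonal_one]
    congr 1
    ext z
    exact mul_inv_cancel₀ (hf z)
  calc M = M * (Matrix.diagonal f * Matrix.diagonal fun z => (f z)⁻¹) := by rw [h1, mul_one]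
    _ = _ := by rw [← mul_assoc, h, one_mul]

theorem diagonal_commute_diagonal (f f' : (Q → Fin 2) → ℂ) :
    Commute (Matrix.diagonal f : Operator Q) (Matrix.diagonal f') := by
  rw [Commute, SemiconjBy, Matrix.diagonal_mul_diagonal, Matrix.diagonal_mul_diagonal]
  simp only [mul_comm]

/-- On the range of a projection `p`, the factors of a product may be replaced by operators that
commute with `p` and agree with them there. -/
theorem prod_mul_congr {R : Type*} [Monoid R] {p A B U U' V V' u u' v v' : R}
    (hA : Commute p A) (hB : Commute p B) (hu : U * p = u * p) (hu' : U' * p = u' * p)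
    (hv : V * p = v * p) (hv' : V' * p = v' * p) (cu : Commute p u) (cu' : Commute p u')
    (cv : Commute p v) (cv' : Commute p v') :
    B * V' * A * U' * B * V * A * U * p = B * v' * A * u' * B * v * A * u * p := by
  have agree : ∀ {F F' G G' : R}, F * p = F' * p → G * p = G' * p → Commute p G' →
      F * G * p = F' * G' * p := by
    intro F F' G G' h1 h2 h3
    rw [mul_assoc, h2, ← h3.eq, ← mul_assoc, h1, mul_assoc, h3.eq, mul_assoc]
  exact agree (agree (agree (agree (agree (agree (agree rfl hv' cv') rfl hA) hu' cu') rfl hB) hv cv)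
    rfl hA) hu cu

/-- Operators that are inverted when they are moved past `A` turn the commutator-like product into
the fourth power of `B`, the inverse of `A`. -/
theorem prod_eq_of_flip {R : Type*} [Monoid R] {A B x x' y y' : R} (hAB : A * B = 1)
    (hx' : x' * A = B * x') (hy : y * A = B * y) (hy' : y' * A = B * y')
    (h1 : y' * x' * y * x = 1) : B * y' * A * x' * B * y * A * x = B * B * B * B := by
  have hx'B : x' * B = A * x' := by
    calc x' * B = A * (B * x') * B := by rw [← mul_assoc, hAB, one_mul]
      _ = A * x' := by rw [← hx', mul_assoc, mul_assoc, hAB, mul_one]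
  have e1 : ∀ r, y' * (A * r) = B * (y' * r) := fun r => by rw [← mul_assoc, hy', mul_assoc]
  have e2 : ∀ r, x' * (B * r) = A * (x' * r) := fun r => by rw [← mul_assoc, hx'B, mul_assoc]
  have e3 : ∀ r, y * (A * r) = B * (y * r) := fun r => by rw [← mul_assoc, hy, mul_assoc]
  calc B * y' * A * x' * B * y * A * x = B * B * B * B * (y' * x' * y * x) := by
        simp only [mul_assoc, e1, e2, e3]
    _ = _ := by rw [h1, mul_one]

/-- The group commutator of the two multi-controlled phase gates, the second one conjugated by the
rotations `Rx`: it is trivial if one of the conditions `g` and `h` fails, and a rotation by four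
times the angle if both hold. -/
theorem commutator_eq (ht : Function.Injective t) (hJ : J.Nodup) {C : Finset Q}
    {g h : (Q → Fin 2) → Fin 2} {c₁ c₂ : (Q → Fin 2) → ℂ}
    (hg : ∀ j ∈ J, IndepOf (t j) g) (hh : ∀ j ∈ J, IndepOf (t j) h)
    (hc₁ : ∀ j ∈ J, IndepOf (t j) c₁) (hc₂ : ∀ j ∈ J, IndepOf (t j) c₂)
    (hn₁ : ∀ z, c₁ z ≠ 0) (hn₂ : ∀ z, c₂ z ≠ 0)
    (hgh : ∀ z, (g z = 1 ∧ h z = 1) ↔ ∀ q ∈ C, z q = 1) {U U' V V' : Operator Q}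
    (hU : U = Matrix.diagonal fun z => if g z = 1 then c₁ z * bitSign (parity t J z) else 1)
    (hV : V = Matrix.diagonal fun z => if h z = 1 then c₂ z * bitSign (parity t J z) else 1)
    (hU' : U' * U = 1) (hV' : V' * V = 1) (θ : ι → ℝ) :
    layer t J (fun j => matRx (-θ j)) * V' * layer t J (fun j => matRx (θ j)) * U'
      * layer t J (fun j => matRx (-θ j)) * V * layer t J (fun j => matRx (θ j)) * U
      = 1 - allOnes C + allOnes C * layer t J fun j => matRx (-(4 * θ j)) := by
  have hBA : layer t J (fun j => matRx (-θ j)) * layer t J (fun j => matRx (θ j)) = 1 := by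
    rw [layer_mul ht hJ]
    simp only [matRx_mul, neg_add_cancel, matRx_zero, layer_one]
  have hAB := mul_eq_one_comm.1 hBA
  have hB4 : layer t J (fun j => matRx (-θ j)) * layer t J (fun j => matRx (-θ j)) *
      layer t J (fun j => matRx (-θ j)) * layer t J (fun j => matRx (-θ j))
      = layer t J (fun j => matRx (-(4 * θ j))) := by
    rw [layer_mul ht hJ, layer_mul ht hJ, layer_mul ht hJ]
    simp only [matRx_mul]
    congr 1
    ext j : 1
    congr 1
    ring
  have hne : ∀ {f : (Q → Fin 2) → Fin 2} {c : (Q → Fin 2) → ℂ}, (∀ z, c z ≠ 0) →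
      ∀ z, (if f z = 1 then c z * bitSign (parity t J z) else 1) ≠ 0 := by
    intro f c hc z
    split_ifs
    exacts [mul_ne_zero (hc z) (bitSign_ne_zero _), one_ne_zero]
  have hUd := eq_diagonal_inv (hne hn₁) (hU ▸ hU')
  have hVd := eq_diagonal_inv (hne hn₂) (hV ▸ hV')
  have flip : ∀ {c : (Q → Fin 2) → ℂ}, (∀ j ∈ J, IndepOf (t j) c) →
      Matrix.diagonal (fun z => c z * bitSign (parity t J z)) * layer t J (fun j => matRx (θ j))
        = layer t J (fun j => matRx (-θ j))
          * Matrix.diagonal fun z => c z * bitSign (parity t J z) := by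
    intro c hc
    rw [← Matrix.diagonal_mul_diagonal, mul_assoc, diagonal_bitSign_mul_layer ht hJ, ← mul_assoc,
      (diagonal_commute_layer hc _).eq, mul_assoc]
  have fx' := flip fun j hj => (hc₁ j hj).comp (·⁻¹)
  have fy := flip hc₂
  have fy' := flip fun j hj => (hc₂ j hj).comp (·⁻¹)
  have hall : allOnes C = Matrix.diagonal fun z => if g z = 1 ∧ h z = 1 then (1 : ℂ) else 0 := by
    unfold allOnes
    congr 1
    ext z
    exact if_congr (hgh z).symm rfl rfl
  rw [hall]
  have ip₁ : ∀ j ∈ J, IndepOf (t j) fun z => if h z = 1 then (0 : ℂ) else 1 :=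
    fun j hj => (hh j hj).comp fun b => if b = 1 then (0 : ℂ) else 1
  have ip₂ : ∀ j ∈ J, IndepOf (t j) fun z =>
      if h z = 1 then (if g z = 1 then (0 : ℂ) else 1) else 0 :=
    fun j hj => (hh j hj).comp₂ (fun b a => if b = 1 then (if a = 1 then (0 : ℂ) else 1) else 0)
      (hg j hj)
  have ip₃ : ∀ j ∈ J, IndepOf (t j) fun z => if g z = 1 ∧ h z = 1 then (1 : ℂ) else 0 :=
    fun j hj => (hg j hj).comp₂ (fun a b => if a = 1 ∧ b = 1 then (1 : ℂ) else 0) (hh j hj)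
  have cA₁ := diagonal_commute_layer ip₁ fun j => matRx (θ j)
  have cB₁ := diagonal_commute_layer ip₁ fun j => matRx (-θ j)
  have cA₂ := diagonal_commute_layer ip₂ fun j => matRx (θ j)
  have cB₂ := diagonal_commute_layer ip₂ fun j => matRx (-θ j)
  have cA₃ := diagonal_commute_layer ip₃ fun j => matRx (θ j)
  have cB₃ := diagonal_commute_layer ip₃ fun j => matRx (-θ j)
  have cC := diagonal_commute_layer ip₃ fun j => matRx (-(4 * θ j))
  have hsum : (Matrix.diagonal (fun z => if h z = 1 then (0 : ℂ) else 1) : Operator Q)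
      + Matrix.diagonal (fun z => if h z = 1 then (if g z = 1 then (0 : ℂ) else 1) else 0)
      + Matrix.diagonal (fun z => if g z = 1 ∧ h z = 1 then (1 : ℂ) else 0) = 1 := by
    rw [Matrix.diagonal_add, Matrix.diagonal_add, ← Matrix.diagonal_one]
    congr 1
    ext z
    by_cases h1 : g z = 1 <;> by_cases h2 : h z = 1 <;> simp [h1, h2]
  generalize layer t J (fun j => matRx (θ j)) = A at *
  generalize layer t J (fun j => matRx (-θ j)) = B at *
  generalize layer t J (fun j => matRx (-(4 * θ j))) = E at *
  -- If `h` fails, then `V` is trivial.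
  have k₁ : B * V' * A * U' * B * V * A * U
      * Matrix.diagonal (fun z => if h z = 1 then (0 : ℂ) else 1)
      = Matrix.diagonal (fun z => if h z = 1 then (0 : ℂ) else 1) := by
    rw [prod_mul_congr (v := 1) (v' := 1) cA₁ cB₁ rfl rfl ?_ ?_ ?_ ?_ (Commute.one_right _)
      (Commute.one_right _),
      mul_one, mul_one, hBA, one_mul, mul_assoc U', hBA, mul_one, hU', one_mul]
    · rw [one_mul, hV, Matrix.diagonal_mul_diagonal]
      congr 1; ext z; by_cases h2 : h z = 1 <;> simp [h2]
    · rw [one_mul, hVd, Matrix.diagonal_mul_diagonal]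
      congr 1; ext z; by_cases h2 : h z = 1 <;> simp [h2]
    · rw [hU]; exact diagonal_commute_diagonal _ _
    · rw [hUd]; exact diagonal_commute_diagonal _ _
  -- If `g` fails, then `U` is trivial.
  have k₂ : B * V' * A * U' * B * V * A * U
      * Matrix.diagonal (fun z => if h z = 1 then (if g z = 1 then (0 : ℂ) else 1) else 0)
      = Matrix.diagonal (fun z => if h z = 1 then (if g z = 1 then (0 : ℂ) else 1) else 0) := by
    rw [prod_mul_congr (u := 1) (u' := 1) cA₂ cB₂ ?_ ?_ rfl rfl (Commute.one_right _)
      (Commute.one_right _) ?_ ?_, mul_one, mul_one, mul_assoc (B * V'), hAB, mul_one, mul_assoc B,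
      hV', mul_one, hBA, one_mul]
    · rw [one_mul, hU, Matrix.diagonal_mul_diagonal]
      congr 1; ext z; by_cases h2 : g z = 1 <;> simp [h2]
    · rw [one_mul, hUd, Matrix.diagonal_mul_diagonal]
      congr 1; ext z; by_cases h2 : g z = 1 <;> simp [h2]
    · rw [hV]; exact diagonal_commute_diagonal _ _
    · rw [hVd]; exact diagonal_commute_diagonal _ _
  -- If both hold, then the factors invert the rotations when they are moved past them.
  have k₃ : B * V' * A * U' * B * V * A * U
      * Matrix.diagonal (fun z => if g z = 1 ∧ h z = 1 then (1 : ℂ) else 0)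
      = E * Matrix.diagonal (fun z => if g z = 1 ∧ h z = 1 then (1 : ℂ) else 0) := by
    rw [prod_mul_congr (u := Matrix.diagonal fun z => c₁ z * bitSign (parity t J z))
      (u' := Matrix.diagonal fun z => (c₁ z)⁻¹ * bitSign (parity t J z))
      (v := Matrix.diagonal fun z => c₂ z * bitSign (parity t J z))
      (v' := Matrix.diagonal fun z => (c₂ z)⁻¹ * bitSign (parity t J z)) cA₃ cB₃ ?_ ?_ ?_ ?_
      (diagonal_commute_diagonal _ _) (diagonal_commute_diagonal _ _)
      (diagonal_commute_diagonal _ _) (diagonal_commute_diagonal _ _), prod_eq_of_flip hAB fx' fy fy' ?_, hB4]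
    · rw [Matrix.diagonal_mul_diagonal, Matrix.diagonal_mul_diagonal,
        Matrix.diagonal_mul_diagonal, ← Matrix.diagonal_one]
      congr 1
      ext z
      have h1 := bitSign_mul_self (parity t J z)
      have h2 := mul_inv_cancel₀ (hn₁ z)
      have h3 := mul_inv_cancel₀ (hn₂ z)
      generalize bitSign (parity t J z) = s at *
      calc _ = (c₁ z * (c₁ z)⁻¹) * (c₂ z * (c₂ z)⁻¹) * (s * s) * (s * s) := by ring
        _ = 1 := by rw [h1, h2, h3]; norm_num
    · rw [hU, Matrix.diagonal_mul_diagonal, Matrix.diagonal_mul_diagonal]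
      congr 1; ext z; by_cases h2 : g z = 1 <;> simp [h2]
    · rw [hUd, Matrix.diagonal_mul_diagonal, Matrix.diagonal_mul_diagonal]
      congr 1; ext z; by_cases h2 : g z = 1 <;> simp [h2, bitSign_inv, mul_comm]
    · rw [hV, Matrix.diagonal_mul_diagonal, Matrix.diagonal_mul_diagonal]
      congr 1; ext z; by_cases h2 : h z = 1 <;> simp [h2]
    · rw [hVd, Matrix.diagonal_mul_diagonal, Matrix.diagonal_mul_diagonal]
      congr 1; ext z; by_cases h2 : h z = 1 <;> simp [h2, bitSign_inv, mul_comm]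
  rw [cC.eq]
  nth_rewrite 1 [← mul_one (B * V' * A * U' * B * V * A * U), ← hsum]
  rw [mul_add, mul_add, k₁, k₂, k₃, ← hsum]
  abel

end Layers

/-! ### From schedules to circuits -/

section Padding

variable {Q : Type*}

namespace Sched

theorem depth_le_cost {A : Sched Q} (h : ∀ s ∈ A, s.2 ≠ []) (τ : GateType) :
    depth τ A ≤ cost τ A := by
  induction A with
  | nil => simp
  | cons s A ih =>
    have ih := ih fun s hs => h s (by simp [hs])
    have := List.length_pos_iff.2 (h s (by simp))
    rw [depth_cons, cost_cons]
    split_ifs <;> omega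

variable [DecidableEq Q]

theorem cost_eq_countP {A : Sched Q} (h : A.Valid) (τ : GateType) :
    A.cost τ = A.gates.countP fun g => decide (g.type = τ) := by
  induction A with
  | nil => rfl
  | cons s A ih =>
    rw [valid_cons] at h
    rw [cost_cons, gates_cons, List.countP_append, ih h.2]
    congr 1
    split_ifs with hs
    · exact (List.countP_eq_length.2 fun g hg => by simp [h.1.1 g hg, hs]).symm
    · exact (List.countP_eq_zero.2 fun g hg => by simp [h.1.1 g hg, hs]).symm

theorem depth_eq_countP {A : Sched Q} (h : A.Valid) (hne : ∀ s ∈ A, s.2 ≠ []) (τ : GateType) :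
    A.depth τ = (A.map Prod.snd).countP fun l => decide (∃ g ∈ l, g.type = τ) := by
  induction A with
  | nil => rfl
  | cons s A ih =>
    rw [valid_cons] at h
    rw [depth_cons, List.map_cons, List.countP_cons, ih h.2 fun s hs => hne s (by simp [hs]),
      add_comm]
    congr 1
    obtain ⟨g, hg⟩ := List.exists_mem_of_ne_nil _ (hne s (by simp))
    have : (∃ g ∈ s.2, g.type = τ) ↔ s.1 = τ :=
      ⟨fun ⟨g, hg, h'⟩ => h.1.1 g hg ▸ h', fun h' => ⟨g, hg, h' ▸ h.1.1 g hg⟩⟩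
    simp only [this, decide_eq_true_eq]

/-- Gates that are executed in the same slot may also be executed one after the other, so the
depths can be increased to any values that do not exceed the costs. -/
theorem exists_depth_eq {A : Sched Q} (h : A.Valid) (hne : ∀ s ∈ A, s.2 ≠ []) {d : GateType → ℕ}
    (hd : ∀ τ, A.depth τ ≤ d τ) (hd' : ∀ τ, d τ ≤ A.cost τ) :
    ∃ B : Sched Q, B.Valid ∧ (∀ s ∈ B, s.2 ≠ []) ∧ B.gates = A.gates ∧ ∀ τ, B.depth τ = d τ := by
  induction A generalizing d with
  | nil => exact ⟨[], valid_nil, by simp, rfl, fun τ => by simpa using (hd' τ).antisymm' (hd τ)⟩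
  | cons s A ih =>
    obtain ⟨τ, l⟩ := s
    have hneA : ∀ s ∈ A, s.2 ≠ [] := fun s hs => hne s (by simp [hs])
    have hl : 0 < l.length := List.length_pos_iff.2 (hne (τ, l) (by simp))
    rw [valid_cons] at h
    have h1 := hd τ
    have h2 := hd' τ
    have h3 := depth_le_cost hneA τ
    rw [depth_cons, if_pos rfl] at h1
    rw [cost_cons, if_pos rfl] at h2
    simp only at h2
    -- The first slot is split into `i` slots with one gate each and one with the other gates.
    obtain ⟨i, hi, h4, h5⟩ : ∃ i, i < l.length ∧ depth τ A + (i + 1) ≤ d τ ∧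
        d τ ≤ cost τ A + (i + 1) := ⟨min (l.length - 1) (d τ - depth τ A - 1), by omega⟩
    obtain ⟨B, hB, hB', hg, hdB⟩ := ih (d := Function.update d τ (d τ - (i + 1))) h.2 hneA
      (fun σ => by
        by_cases hσ : σ = τ
        · subst hσ; rw [Function.update_self]; omega
        · have := hd σ
          rw [depth_cons, if_neg (Ne.symm hσ)] at this
          rw [Function.update_of_ne hσ]; omega)
      (fun σ => by
        by_cases hσ : σ = τ
        · subst hσ; rw [Function.update_self]; omega
        · have := hd' σ
          rw [cost_cons, if_neg (Ne.symm hσ)] at this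
          rw [Function.update_of_ne hσ]; omega)
    refine ⟨(l.take i).map (fun g => (τ, [g])) ++ (τ, l.drop i) :: B, ?_, ?_, ?_, ?_⟩
    · rw [valid_append, valid_cons]
      refine ⟨?_, ⟨fun g hg => h.1.1 g (List.mem_of_mem_drop hg), h.1.2.drop⟩, hB⟩
      intro s hs
      obtain ⟨g, hg, rfl⟩ := List.mem_map.1 hs
      have := h.1.1 g (List.mem_of_mem_take hg)
      simpa using this
    · intro s hs
      rw [List.mem_append, List.mem_cons, List.mem_map] at hs
      rcases hs with ⟨g, -, rfl⟩ | rfl | hs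
      · simp
      · simpa using hi
      · exact hB' s hs
    · have : ∀ l : List (Gate Q), gates (l.map fun g => ((τ, [g]) : GateType × List (Gate Q)))
          = l := by
        intro l
        rw [gates, List.flatMap_map]
        exact List.flatMap_singleton' l
      rw [gates_append, gates_cons, gates_cons, this, hg, ← List.append_assoc,
        List.take_append_drop]
    · intro σ
      have : ∀ l : List (Gate Q), depth σ (l.map fun g => ((τ, [g]) : GateType × List (Gate Q)))
          = if τ = σ then l.length else 0 := by
        intro l
        simp only [depth, List.map_map, Function.comp_def]
        split_ifs <;> simp
      rw [depth_append, depth_cons, this, hdB, List.length_take]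
      by_cases hσ : σ = τ
      · subst hσ
        rw [Function.update_self, if_pos rfl, if_pos rfl]
        omega
      · rw [Function.update_of_ne hσ, if_neg (Ne.symm hσ), if_neg (Ne.symm hσ)]
        omega

/-- A schedule yields circuits with the same gates, and with any depths between those of the
schedule and its costs. -/
theorem exists_circuit {A : Sched Q} (h : A.Valid) {d : GateType → ℕ}
    (hd : ∀ τ, A.depth τ ≤ d τ) (hd' : ∀ τ, d τ ≤ A.cost τ) :
    ∃ K : Circuit Q, K.gates = A.gates ∧ ∀ τ, K.cost τ = A.cost τ ∧ K.depth τ = d τ := by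
  -- Empty slots are removed first.
  have key : ∃ A' : Sched Q, A'.Valid ∧ (∀ s ∈ A', s.2 ≠ []) ∧ A'.gates = A.gates ∧
      ∀ τ, A'.depth τ ≤ A.depth τ := by
    clear hd hd'
    induction A with
    | nil => exact ⟨[], valid_nil, by simp, rfl, fun _ => le_rfl⟩
    | cons s A ih =>
      rw [valid_cons] at h
      obtain ⟨A', h1, h2, h3, h4⟩ := ih h.2
      by_cases hs : s.2 = []
      · refine ⟨A', h1, h2, by rw [gates_cons, hs, h3, List.nil_append], fun τ => ?_⟩
        exact (h4 τ).trans (by rw [depth_cons]; omega)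
      · refine ⟨s :: A', valid_cons.2 ⟨h.1, h1⟩, ?_, by rw [gates_cons, gates_cons, h3], fun τ => ?_⟩
        · simpa using ⟨hs, fun a b => h2 (a, b)⟩
        · rw [depth_cons, depth_cons]
          have := h4 τ
          omega
  obtain ⟨A', h1, h2, h3, h4⟩ := key
  obtain ⟨B, hB, hB', hg, hdB⟩ := exists_depth_eq h1 h2 (fun τ => (h4 τ).trans (hd τ))
    fun τ => by rw [cost_eq_countP h1, h3, ← cost_eq_countP h]; exact hd' τ
  refine ⟨⟨B.map Prod.snd, ?_⟩, ?_, fun τ => ⟨?_, ?_⟩⟩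
  · intro l hl
    obtain ⟨s, hs, rfl⟩ := List.mem_map.1 hl
    exact (hB s hs).2
  · rw [← h3, ← hg, gates, List.flatMap_def]; rfl
  · rw [cost_eq_countP h, ← h3, ← hg, gates, List.flatMap_def]; rfl
  · rw [← hdB, depth_eq_countP hB hB']; rfl

end Sched

end Padding

/-! ### Multi-controlled phase gates on the parity of the targets -/

section Parity

variable {Q ι : Type*} [DecidableEq Q] [Fintype Q] {L : List (Q × Q)} {xb b τ : Q}
  {E : List (Q × Q × Q)} {t : ι → Q} {J : List ι}

theorem phaseZ_eq_bitSign (w b : Fin 2) :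
    phaseZ w b b = if w = 1 then -Complex.I * bitSign b else 1 := by
  unfold phaseZ bitSign
  fin_cases b <;> split_ifs <;> simp_all

/-- Both forms of `midFull` multiply the basis states in which all controls are `1` by a phase that
depends on the target, up to an operator on the dirty ancillas. -/
theorem exists_op_midFull (h : MidNodup L xb b τ E) :
    ∃ (l : List (Gate Q)) (κ : (Q → Fin 2) → (Q → Fin 2)) (c : (Q → Fin 2) → ℂ),
      (E = [] → l = []) ∧ SupportedOn l (nestQubits L xb E) ∧ Tracks (seqOp l) κ ∧
      (∀ z, ∀ q ∉ trips E, κ z q = z q) ∧ (∀ z, c z ≠ 0) ∧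
      (∀ z z', (∀ q ∈ trips E, z q = z' q) → c z = c z') ∧
      (midFull L xb b τ E).op = seqOp l * Matrix.diagonal fun z =>
        if z b * nestVal L xb E z = 1 then c z * bitSign (z τ) else 1 := by
  cases E with
  | nil =>
    refine ⟨[], id, fun _ => -Complex.I, fun _ => rfl, supportedOn_nil _, Tracks.one, fun _ _ _ => rfl,
      fun _ => neg_ne_zero.2 Complex.I_ne_zero, fun _ _ _ => rfl, ?_⟩
    rw [op_midFull_nil h, seqOp, one_mul]
    simp only [phaseZ_eq_bitSign]
  | cons p E =>
    have hnd := h.nodup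
    simp only [List.nodup_cons] at hnd
    refine ⟨(nestOp L xb p E).gates, nestMap L xb (p :: E),
      fun z => (if z p.1 = 1 then -1 else 1) * -Complex.I, by simp, supportedOn_nestOp L xb p E,
      tracks_nestOp h.ladder h.ne_nil hnd.2.2 fun q hq => h.disjoint q (by simp [hq]),
      fun z q hq => nestMap_apply (fun h => hq (fst_mem_trips h)) z, fun z => ?_,
      fun z z' hz => ?_, ?_⟩
    · refine mul_ne_zero ?_ (neg_ne_zero.2 Complex.I_ne_zero)
      split_ifs <;> norm_num
    · simp only [hz p.1 (by simp [trips_cons])]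
    · rw [op_midFull_cons h]
      congr 2
      ext z
      rw [phaseZ_eq_bitSign]
      by_cases h1 : z b * nestVal L xb (p :: E) z = 1
      · simp only [h1, true_and, if_true, mul_assoc]
      · simp [h1]

/-- The parity of the targets is computed on the target `τ` before `mid`, and uncomputed
afterwards. -/
def fanMid (F : Sched Q) (L : List (Q × Q)) (xb b τ : Q) (E : List (Q × Q × Q)) : Sched Q :=
  F ++ (mid L xb b τ E ++ Sched.inv F)

/-- The operator of `fanMid`, with the `H` gates of the ladder before and after it. -/
theorem exists_op_fanMid (h : MidNodup L xb b τ E) {F : Sched Q}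
    (hF : SupportedOn F.gates {q | q ∈ J.map t}) {ρ : (Q → Fin 2) → (Q → Fin 2)}
    (hρ : Tracks F.op ρ) (hρ' : ∀ z q, q ∉ J.map t → ρ z q = z q)
    (hτ : ∀ z, ρ z τ = ((J.map t).map z).sum) (hb : ∀ j ∈ J, t j ≠ b)
    (ht : ∀ j ∈ J, t j ∉ nestQubits L xb E) :
    ∃ (l : List (Gate Q)) (κ : (Q → Fin 2) → (Q → Fin 2)) (c : (Q → Fin 2) → ℂ),
      (E = [] → l = []) ∧ SupportedOn l (nestQubits L xb E) ∧ Tracks (seqOp l) κ ∧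
      (∀ z, ∀ q ∉ trips E, κ z q = z q) ∧ (∀ z, c z ≠ 0) ∧
      (∀ z z', (∀ q ∈ trips E, z q = z' q) → c z = c z') ∧
      (Sched.inv (hLayer L)).op * (fanMid F L xb b τ E).op * (hLayer L).op
        = seqOp l * Matrix.diagonal fun z =>
          if z b * nestVal L xb E z = 1 then c z * bitSign (parity t J z) else 1 := by
  obtain ⟨l, κ, c, h0, h1, h2, h3, h4, h5, h6⟩ := exists_op_midFull h
  refine ⟨l, κ, c, h0, h1, h2, h3, h4, h5, ?_⟩
  have hne : ∀ q ∈ nestQubits L xb E, q ∉ J.map t := by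
    intro q hq hq'
    obtain ⟨j, hj, rfl⟩ := List.mem_map.1 hq'
    exact ht j hj hq
  have hdis : Disjoint {q | q ∈ J.map t} (nestQubits L xb E) := by
    rw [Set.disjoint_left]
    exact fun q hq hq' => hne q hq' hq
  have hH : SupportedOn (hLayer L).gates (nestQubits L xb E) :=
    supportedOn_hLayer fun _ hp => Or.inl (mem_ladderQubits hp).2
  have c1 : Commute F.op (hLayer L).op := Sched.op_commute hF hH hdis
  have c2 : Commute (Sched.inv F).op (Sched.inv (hLayer L)).op :=
    Sched.op_commute (Sched.supportedOn_inv hF) (Sched.supportedOn_inv hH) hdis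
  have c3 : Commute (Sched.inv F).op (seqOp l) := seqOp_commute (Sched.supportedOn_inv hF) h1 hdis
  have e : (Sched.inv (hLayer L)).op * (fanMid F L xb b τ E).op * (hLayer L).op
      = (Sched.inv F).op * (midFull L xb b τ E).op * F.op := by
    simp only [fanMid, midFull, Sched.op_append]
    calc _ = ((Sched.inv (hLayer L)).op * (Sched.inv F).op) * (mid L xb b τ E).op
          * (F.op * (hLayer L).op) := by simp only [mul_assoc]
      _ = _ := by rw [c1.eq, ← c2.eq]; simp only [mul_assoc]
  rw [e, h6, ← mul_assoc, c3.eq, mul_assoc, mul_assoc, ← mul_assoc (Sched.inv F).op,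
    hρ.conj_diagonal (Sched.op_inv_mul F)]
  congr 2
  ext z
  have hcz : c (ρ z) = c z := h5 _ _ fun q hq => hρ' z q (hne q (Or.inr hq))
  have hvz : nestVal L xb E (ρ z) = nestVal L xb E z :=
    nestVal_congr h.ladder fun q hq => hρ' z q (hne q hq)
  have hbz : ρ z b = z b := by
    refine hρ' z b fun hq => ?_
    obtain ⟨j, hj, hj'⟩ := List.mem_map.1 hq
    exact hb j hj hj'
  simp only [Function.comp_apply, hcz, hvz, hbz, hτ, parity, List.map_map, Function.comp_def]

end Parity

/-! ### The circuit -/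

section Assembly

variable {Q ι : Type*} [DecidableEq Q] {t : ι → Q} {J : List ι}

/-- A slot with one rotation on each target. -/
def rotSlot (J : List ι) (g : ι → Gate Q) : Sched Q := [(.rotation, J.map g)]

/-- A slot with the `H` gates after a ladder `L` and those before a ladder `L'`. -/
def hSwitch (L L' : List (Q × Q)) : Sched Q :=
  [(.h, (Sched.inv (hLayer L)).gates ++ (hLayer L').gates)]

theorem valid_rotSlot (ht : Function.Injective t) (hJ : J.Nodup) {g : ι → Gate Q}
    (h : ∀ j, (g j).type = .rotation) (h' : ∀ j, (g j).qubits = {t j}) :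
    (rotSlot J g).Valid := by
  simp only [rotSlot, Sched.valid_cons, List.pairwise_map, List.mem_map]
  refine ⟨⟨?_, hJ.imp fun hij => ?_⟩, Sched.valid_nil⟩
  · rintro _ ⟨j, -, rfl⟩; exact h j
  · rw [h', h', Finset.disjoint_singleton]
    exact fun e => hij (ht e)

theorem valid_hSwitch {L L' : List (Q × Q)} {xb xb' : Q} (h : LadderNodup L xb)
    (h' : LadderNodup L' xb') (hd : ∀ p ∈ L, ∀ p' ∈ L', p.2 ≠ p'.2) : (hSwitch L L').Valid := by
  have h1 := (valid_hLayer h).inv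
  have h2 := valid_hLayer h'
  simp only [hSwitch, hLayer, Sched.inv, Sched.Valid, List.map_cons, List.map_nil,
    List.reverse_singleton, List.mem_singleton, forall_eq, Sched.gates_cons, Sched.gates_nil,
    List.append_nil, List.mem_append, List.pairwise_append] at h1 h2 ⊢
  refine ⟨fun g hg => hg.elim (h1.1 g) (h2.1 g), h1.2, h2.2, ?_⟩
  intro g hg g' hg'
  simp only [List.mem_reverse, List.mem_map] at hg hg'
  obtain ⟨_, ⟨p, hp, rfl⟩, rfl⟩ := hg
  obtain ⟨p', hp', rfl⟩ := hg'
  simpa [Gate.inv, Gate.qubits] using (hd p hp p' hp')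

variable [Fintype Q]

theorem op_hSwitch (L L' : List (Q × Q)) :
    (hSwitch L L').op = (hLayer L').op * (Sched.inv (hLayer L)).op := by
  simp [hSwitch, Sched.op, seqOp_append]

theorem op_rotSlot (ht : Function.Injective t) (hJ : J.Nodup) {g : ι → Gate Q}
    {U : ι → Matrix (Fin 2) (Fin 2) ℂ} (h : ∀ j, (g j).op = controlled ∅ (t j) (U j)) :
    (rotSlot J g).op = layer t J U := by
  rw [rotSlot, Sched.op, Sched.gates_cons, Sched.gates_nil, List.append_nil,
    seqOp_map_eq_layer ht hJ h]

/-- The schedule of the commutator of two multi-controlled phase gates, given by the schedules `S`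
and `S'` and the ladders `L` and `L'`, the second one conjugated by the rotations `Rx (θ j)`. -/
def commSched (t : ι → Q) (J : List ι) (θ : ι → ℝ) (S S' : Sched Q) (L L' : List (Q × Q)) :
    Sched Q :=
  hLayer L ++ (S ++ (hSwitch L L' ++ (rotSlot J (fun j => .rx (θ j) (t j)) ++ (S' ++
    (hSwitch L' L ++ (rotSlot J (fun j => .rx (-θ j) (t j)) ++ (Sched.inv S ++
    (hSwitch L L' ++ (rotSlot J (fun j => .rx (θ j) (t j)) ++ (Sched.inv S' ++
    (Sched.inv (hLayer L') ++ rotSlot J fun j => .rx (-θ j) (t j))))))))))))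

theorem seqOp_commute_layer {l : List (Gate Q)} {S : Set Q} (h : SupportedOn l S)
    (hS : ∀ j ∈ J, t j ∉ S) (U : ι → Matrix (Fin 2) (Fin 2) ℂ) :
    Commute (seqOp l) (layer t J U) := by
  refine Commute.list_prod_right _ _ fun M hM => ?_
  obtain ⟨j, hj, rfl⟩ := List.mem_map.1 hM
  exact (seqOp_commute_controlled h (hS j hj) (U j)).symm

/-- The `H` gates of the ladders do not act on the targets, so they commute with the rotations, and each
of the four phase gates can be surrounded by those of its own ladder. -/
theorem op_commSched (ht : Function.Injective t) (hJ : J.Nodup) (θ : ι → ℝ) (S S' : Sched Q)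
    {L L' : List (Q × Q)} (hL : ∀ j ∈ J, t j ∉ L.map Prod.snd)
    (hL' : ∀ j ∈ J, t j ∉ L'.map Prod.snd) :
    (commSched t J θ S S' L L').op = layer t J (fun j => matRx (-θ j))
      * ((Sched.inv (hLayer L')).op * (Sched.inv S').op * (hLayer L').op)
      * layer t J (fun j => matRx (θ j))
      * ((Sched.inv (hLayer L)).op * (Sched.inv S).op * (hLayer L).op)
      * layer t J (fun j => matRx (-θ j))
      * ((Sched.inv (hLayer L')).op * S'.op * (hLayer L').op)
      * layer t J (fun j => matRx (θ j))
      * ((Sched.inv (hLayer L)).op * S.op * (hLayer L).op) := by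
  have hc : ∀ {L : List (Q × Q)}, (∀ j ∈ J, t j ∉ L.map Prod.snd) →
      ∀ U : ι → Matrix (Fin 2) (Fin 2) ℂ, (hLayer L).op * layer t J U
        = layer t J U * (hLayer L).op := fun h U =>
    seqOp_commute_layer (supportedOn_hLayer (S := {q | q ∈ List.map Prod.snd _})
      fun p hp => List.mem_map_of_mem hp) h U
  have hr : ∀ θ : ι → ℝ, (rotSlot J fun j => .rx (θ j) (t j)).op = layer t J fun j => matRx (θ j) :=
    fun θ => op_rotSlot ht hJ fun j => rfl
  have hc1 := hc hL fun j => matRx (-θ j)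
  have hc2 := hc hL' fun j => matRx (θ j)
  simp only [commSched, Sched.op_append, hr, op_hSwitch]
  generalize layer t J (fun j => matRx (θ j)) = A at *
  generalize layer t J (fun j => matRx (-θ j)) = B at *
  generalize (hLayer L).op = H at *
  generalize (hLayer L').op = H' at *
  have e1 : ∀ r, B * (H * r) = H * (B * r) := fun r => by rw [← mul_assoc, ← hc1, mul_assoc]
  have e2 : ∀ r, A * (H' * r) = H' * (A * r) := fun r => by rw [← mul_assoc, ← hc2, mul_assoc]
  simp only [mul_assoc, e1, e2]

end Assembly

section Assembly

variable {Q ι : Type*} [DecidableEq Q] [Fintype Q] {t : ι → Q} {J : List ι}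
  {L L' : List (Q × Q)} {xb xb' b b' τ : Q} {E : List (Q × Q × Q)} {F : Sched Q}

/-- The controls of two multi-controlled phase gates on `τ`, the targets, and the ancillas of the
first of these gates do not interfere. -/
structure Compatible (t : ι → Q) (J : List ι) (τ : Q) (L : List (Q × Q)) (xb b : Q)
    (E : List (Q × Q × Q)) (L' : List (Q × Q)) (xb' b' : Q) : Prop where
  left : MidNodup L xb b τ E
  right : MidNodup L' xb' b' τ []
  target_left : ∀ j ∈ J, t j ≠ b ∧ t j ∉ nestQubits L xb E
  target_right : ∀ j ∈ J, t j ≠ b' ∧ t j ∉ nestQubits L' xb' []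
  trips : ∀ q ∈ trips E, q ≠ b' ∧ q ∉ nestQubits L' xb' []
  snd : ∀ p ∈ L, ∀ p' ∈ L', p.2 ≠ p'.2

theorem op_commSched_fanMid (ht : Function.Injective t) (hJ : J.Nodup)
    (h : Compatible t J τ L xb b E L' xb' b')
    (hF : SupportedOn F.gates {q | q ∈ J.map t}) {ρ : (Q → Fin 2) → (Q → Fin 2)}
    (hρ : Tracks F.op ρ) (hρ' : ∀ z q, q ∉ J.map t → ρ z q = z q)
    (hτ : ∀ z, ρ z τ = ((J.map t).map z).sum) {C : Finset Q}
    (hC : ∀ z : Q → Fin 2, (z b * nestVal L xb E z = 1 ∧ z b' * nestVal L' xb' [] z = 1) ↔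
      ∀ q ∈ C, z q = 1) (θ : ι → ℝ) :
    (commSched t J θ (fanMid F L xb b τ E) (fanMid F L' xb' b' τ []) L L').op
      = 1 - allOnes C + allOnes C * layer t J fun j => matRx (-(4 * θ j)) := by
  have hsnd : ∀ {L : List (Q × Q)} {xb : Q} {E : List (Q × Q × Q)} {q : Q},
      q ∉ nestQubits L xb E → q ∉ L.map Prod.snd := by
    intro L xb E q hq hq'
    obtain ⟨p, hp, rfl⟩ := List.mem_map.1 hq'
    exact hq (Or.inl (mem_ladderQubits hp).2)
  rw [op_commSched ht hJ θ _ _ (fun j hj => hsnd (h.target_left j hj).2)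
    fun j hj => hsnd (h.target_right j hj).2]
  obtain ⟨l, κ, c, -, h1, h2, h3, h4, h5, h6⟩ := exists_op_fanMid h.left hF hρ hρ' hτ
    (fun j hj => (h.target_left j hj).1) fun j hj => (h.target_left j hj).2
  obtain ⟨l', -, c', h0', -, -, -, h4', h5', h6'⟩ := exists_op_fanMid h.right hF hρ hρ' hτ
    (fun j hj => (h.target_right j hj).1) fun j hj => (h.target_right j hj).2
  rw [h0' rfl, seqOp, one_mul] at h6'
  have hinv : ∀ {H S : Sched Q}, ((Sched.inv H).op * (Sched.inv S).op * H.op)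
      * ((Sched.inv H).op * S.op * H.op) = 1 := by
    intro H S
    calc _ = (Sched.inv H).op * ((Sched.inv S).op * (H.op * (Sched.inv H).op) * S.op) * H.op := by
          simp only [mul_assoc]
      _ = 1 := by rw [Sched.op_mul_inv, mul_one, Sched.op_inv_mul, mul_one, Sched.op_inv_mul]
  have hU := hinv (H := hLayer L) (S := fanMid F L xb b τ E)
  have hV := hinv (H := hLayer L') (S := fanMid F L' xb' b' τ [])
  -- The operator on the ancillas commutes with the second phase gate and with the rotations, so
  -- it cancels in the commutator.
  have cA : ∀ U : ι → Matrix (Fin 2) (Fin 2) ℂ, Commute (seqOp l) (layer t J U) :=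
    seqOp_commute_layer h1 fun j hj => (h.target_left j hj).2
  have cV : Commute (seqOp l) ((Sched.inv (hLayer L')).op * (fanMid F L' xb' b' τ []).op
      * (hLayer L').op) := by
    rw [h6']
    refine (?_ : _ * _ = _ * _).symm
    rw [h2.diagonal_mul]
    congr 2
    ext z
    have hq : ∀ q, q = b' ∨ q ∈ nestQubits L' xb' [] ∨ q ∈ J.map t → κ z q = z q := by
      intro q hq
      refine h3 z q fun hqE => ?_
      rcases hq with hq | hq | hq
      · exact (h.trips q hqE).1 hq
      · exact (h.trips q hqE).2 hq
      · obtain ⟨j, hj, rfl⟩ := List.mem_map.1 hq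
        exact (h.target_left j hj).2 (Or.inr hqE)
    have e1 : parity t J (κ z) = parity t J z := by
      unfold parity
      congr 1
      exact List.map_congr_left fun j hj => hq _ (Or.inr (Or.inr (List.mem_map_of_mem hj)))
    have e2 : nestVal L' xb' [] (κ z) = nestVal L' xb' [] z :=
      nestVal_congr h.right.ladder fun q hq' => hq q (Or.inr (Or.inl hq'))
    have e3 : c' (κ z) = c' z := h5' _ _ fun q hq => by simp [QCircuit.trips] at hq
    rw [Function.comp_apply, e1, e2, e3, hq b' (Or.inl rfl)]
  have key := commutator_eq ht hJ (C := C) (g := fun z => z b * nestVal L xb E z)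
    (h := fun z => z b' * nestVal L' xb' [] z) (c₁ := c) (c₂ := c')
    (fun j hj => (IndepOf.apply (h.target_left j hj).1.symm).comp₂ (· * ·)
      (nestVal_indepOf h.left.ladder (h.target_left j hj).2))
    (fun j hj => (IndepOf.apply (h.target_right j hj).1.symm).comp₂ (· * ·)
      (nestVal_indepOf h.right.ladder (h.target_right j hj).2))
    (fun j hj z x => h5 _ _ fun q hq => Function.update_of_ne
      (by rintro rfl; exact (h.target_left j hj).2 (Or.inr hq)) _ _)
    (fun j hj z x => h5' _ _ fun q hq => by simp [QCircuit.trips] at hq)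
    h4 h4' hC rfl h6' (U' := (Sched.inv (hLayer L)).op * (Sched.inv (fanMid F L xb b τ E)).op
      * (hLayer L).op * seqOp l) (by rw [mul_assoc, ← h6, hU]) hV θ
  rw [← key, h6]
  have cA1 := cA fun j => matRx (θ j)
  have cA2 := cA fun j => matRx (-θ j)
  generalize (Sched.inv (hLayer L')).op * (fanMid F L' xb' b' τ []).op * (hLayer L').op = V at *
  generalize layer t J (fun j => matRx (θ j)) = A at *
  generalize layer t J (fun j => matRx (-θ j)) = B at *
  have := ((cA2.mul_right cV).mul_right cA1).eq
  generalize (Sched.inv (hLayer L')).op * (Sched.inv (fanMid F L' xb' b' τ [])).op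
    * (hLayer L').op = V' at *
  generalize (Sched.inv (hLayer L)).op * (Sched.inv (fanMid F L xb b τ E)).op
    * (hLayer L).op = U' at *
  generalize (Matrix.diagonal fun z => if z b * nestVal L xb E z = 1
    then c z * bitSign (parity t J z) else 1 : Operator Q) = D at *
  calc _ = B * V' * A * U' * (B * V * A * seqOp l) * D := by simp only [mul_assoc]
    _ = _ := by rw [← this]; simp only [mul_assoc]

/-- The schedule of the multi-controlled multi-target gate: the commutator, conjugated by two layers
of rotations. -/
def fullSched (t : ι → Q) (J : List ι) (α β θ : ι → ℝ) (S S' : Sched Q) (L L' : List (Q × Q)) :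
    Sched Q :=
  rotSlot J (fun j => .rx (-α j) (t j)) ++ (rotSlot J (fun j => .rz (-β j) (t j)) ++
    (commSched t J θ S S' L L' ++ (rotSlot J (fun j => .rz (β j) (t j)) ++
    rotSlot J fun j => .rx (α j) (t j))))

theorem op_fullSched (ht : Function.Injective t) (hJ : J.Nodup) {C : Finset Q}
    (hC : ∀ j ∈ J, t j ∉ C) (α β θ : ι → ℝ) {S S' : Sched Q}
    (h : (commSched t J θ S S' L L').op
      = 1 - allOnes C + allOnes C * layer t J fun j => matRx (-(4 * θ j))) :
    (fullSched t J α β θ S S' L L').op = (J.map fun j => controlled C (t j)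
      (matRx (α j) * (matRz (β j) * (matRx (-(4 * θ j)) * (matRz (-β j) * matRx (-α j)))))).prod := by
  have hx : ∀ θ : ι → ℝ, (rotSlot J fun j => .rx (θ j) (t j)).op = layer t J fun j => matRx (θ j) :=
    fun θ => op_rotSlot ht hJ fun j => rfl
  have hz : ∀ θ : ι → ℝ, (rotSlot J fun j => .rz (θ j) (t j)).op = layer t J fun j => matRz (θ j) :=
    fun θ => op_rotSlot ht hJ fun j => rfl
  have e : ∀ U U' : ι → Matrix (Fin 2) (Fin 2) ℂ, (∀ j, U j * U' j = 1) →
      layer t J U * layer t J U' = 1 := by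
    intro U U' hU
    rw [layer_mul ht hJ]
    simp only [hU, layer_one]
  have e1 := e (fun j => matRx (α j)) (fun j => matRx (-α j)) fun j => by
    rw [matRx_mul, add_neg_cancel, matRx_zero]
  have e2 := e (fun j => matRz (β j)) (fun j => matRz (-β j)) fun j => by
    rw [matRz_mul, add_neg_cancel, matRz_zero]
  have c1 := (allOnes_commute_layer hC fun j => matRx (α j)).eq
  have c2 := (allOnes_commute_layer hC fun j => matRz (β j)).eq
  rw [prod_controlled hC]
  simp only [← layer_mul ht hJ]
  simp only [fullSched, Sched.op_append, h, hx, hz]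
  generalize layer t J (fun j => matRx (α j)) = A at *
  generalize layer t J (fun j => matRx (-α j)) = A' at *
  generalize layer t J (fun j => matRz (β j)) = B at *
  generalize layer t J (fun j => matRz (-β j)) = B' at *
  generalize layer t J (fun j => matRx (-(4 * θ j))) = R at *
  generalize allOnes C = P at *
  have e3 : A * B * (B' * A') = 1 := by rw [mul_assoc, ← mul_assoc B, e2, one_mul, e1]
  have c3 : A * B * P = P * (A * B) := by rw [mul_assoc, ← c2, ← mul_assoc, ← c1, mul_assoc]
  calc _ = A * B * (1 - P + P * R) * (B' * A') := by simp only [mul_assoc]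
    _ = A * B * (B' * A') - A * B * P * (B' * A') + A * B * P * R * (B' * A') := by
      simp only [mul_add, add_mul, mul_sub, sub_mul, mul_one, mul_assoc]
    _ = _ := by rw [c3, e3, mul_assoc P, e3, mul_one]; simp only [mul_assoc]

end Assembly

section Costs

variable {Q ι : Type*} {t : ι → Q} {J : List ι} {L L' : List (Q × Q)} {xb xb' b b' τ : Q}
  {E : List (Q × Q × Q)}

theorem cost_fullSched (α β θ : ι → ℝ) (A A' : Sched Q) (σ : GateType) :
    (fullSched t J α β θ A A' L L').cost σ = 2 * A.cost σ + 2 * A'.cost σ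
      + if σ = .rotation then 8 * J.length else if σ = .h then 4 * L.length + 4 * L'.length
        else 0 := by
  cases σ <;> simp [fullSched, commSched, rotSlot, hSwitch, hLayer, Sched.gates_inv] <;> omega

theorem depth_fullSched (α β θ : ι → ℝ) (A A' : Sched Q) (σ : GateType) :
    (fullSched t J α β θ A A' L L').depth σ = 2 * A.depth σ + 2 * A'.depth σ
      + if σ = .rotation then 8 else if σ = .h then 5 else 0 := by
  cases σ <;> simp [fullSched, commSched, rotSlot, hSwitch, hLayer, Sched.gates_inv] <;> omega

variable [DecidableEq Q]

theorem supportedOn_rotSlot {g : ι → Gate Q} {S : Set Q} (h' : ∀ j, (g j).qubits = {t j})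
    (h : ∀ j ∈ J, t j ∈ S) : SupportedOn (rotSlot J g).gates S := by
  simp only [rotSlot, Sched.gates_cons, Sched.gates_nil, List.append_nil]
  refine supportedOn_map fun j hj q hq => ?_
  rw [h', Finset.mem_singleton] at hq
  exact hq ▸ h j hj

theorem supportedOn_hSwitch {S : Set Q} (h : ∀ p ∈ L, p.2 ∈ S) (h' : ∀ p ∈ L', p.2 ∈ S) :
    SupportedOn (hSwitch L L').gates S := by
  simp only [hSwitch, Sched.gates_cons, Sched.gates_nil, List.append_nil]
  exact (Sched.supportedOn_inv (supportedOn_hLayer h)).append (supportedOn_hLayer h')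

theorem supportedOn_fullSched {α β θ : ι → ℝ} {S : Set Q} {A A' : Sched Q}
    (hA : SupportedOn A.gates S) (hA' : SupportedOn A'.gates S) (ht : ∀ j ∈ J, t j ∈ S)
    (h : ∀ p ∈ L, p.2 ∈ S) (h' : ∀ p ∈ L', p.2 ∈ S) :
    SupportedOn (fullSched t J α β θ A A' L L').gates S := by
  have hx : ∀ θ : ι → ℝ, SupportedOn (rotSlot J fun j => .rx (θ j) (t j)).gates S :=
    fun θ => supportedOn_rotSlot (fun j => rfl) ht
  have hz : ∀ θ : ι → ℝ, SupportedOn (rotSlot J fun j => .rz (θ j) (t j)).gates S :=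
    fun θ => supportedOn_rotSlot (fun j => rfl) ht
  have h1 := supportedOn_hSwitch h h'
  have h2 := supportedOn_hSwitch h' h
  have h3 := supportedOn_hLayer h
  have h4 := Sched.supportedOn_inv (supportedOn_hLayer h')
  have h5 := Sched.supportedOn_inv hA
  have h6 := Sched.supportedOn_inv hA'
  simp only [fullSched, commSched, Sched.gates_append]
  exact (hx _).append ((hz _).append ((h3.append (hA.append (h1.append ((hx _).append (hA'.append
    (h2.append ((hx _).append (h5.append (h1.append ((hx _).append (h6.append
    (h4.append (hx _))))))))))))).append ((hz _).append (hx _))))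

theorem valid_fullSched (ht : Function.Injective t) (hJ : J.Nodup)
    (h : Compatible t J τ L xb b E L' xb' b') {α β θ : ι → ℝ} {A A' : Sched Q} (hA : A.Valid)
    (hA' : A'.Valid) : (fullSched t J α β θ A A' L L').Valid := by
  have hx : ∀ θ : ι → ℝ, (rotSlot J fun j => .rx (θ j) (t j)).Valid :=
    fun θ => valid_rotSlot ht hJ (fun j => rfl) fun j => rfl
  have hz : ∀ θ : ι → ℝ, (rotSlot J fun j => .rz (θ j) (t j)).Valid :=
    fun θ => valid_rotSlot ht hJ (fun j => rfl) fun j => rfl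
  have h1 := valid_hSwitch h.left.ladder h.right.ladder h.snd
  have h2 := valid_hSwitch h.right.ladder h.left.ladder fun p hp p' hp' => (h.snd p' hp' p hp).symm
  have h3 := valid_hLayer h.left.ladder
  have h4 := (valid_hLayer h.right.ladder).inv
  exact (hx _).append ((hz _).append ((h3.append (hA.append (h1.append ((hx _).append (hA'.append
    (h2.append ((hx _).append (hA.inv.append (h1.append ((hx _).append (hA'.inv.append
    (h4.append (hx _))))))))))))).append ((hz _).append (hx _))))

end Costs

/-! ### The distribution of the controls -/

section Controls

variable {Q ι : Type*} {t : ι → Q} {J : List ι} {x y xb yb τ : Q} {xs ys : List Q}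
  {E : List (Q × Q × Q)}

theorem fin_two_mul_eq_one (a b : Fin 2) : a * b = 1 ↔ a = 1 ∧ b = 1 := by
  revert a b; decide

theorem map_fst_zip_sublist {α β : Type*} (l : List α) (l' : List β) :
    ((l.zip l').map Prod.fst).Sublist l := by
  induction l generalizing l' with
  | nil => simp
  | cons a l ih => cases l' <;> simp [ih]

theorem map_snd_zip_sublist {α β : Type*} (l : List α) (l' : List β) :
    ((l.zip l').map Prod.snd).Sublist l' := by
  induction l generalizing l' with
  | nil => simp
  | cons a l ih => cases l' <;> simp [ih]

theorem mem_or_of_mem_ladderQubits {q : Q} (h : q ∈ ladderQubits (xs.zip ys) xb) :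
    q = xb ∨ q ∈ xs ∨ q ∈ ys :=
  h.imp id (Or.imp (fun h => (map_fst_zip_sublist xs ys).subset h)
    fun h => (map_snd_zip_sublist xs ys).subset h)

theorem ladderNodup_zip (h : (xb :: (xs ++ ys)).Nodup) : LadderNodup (xs.zip ys) xb :=
  h.sublist (((map_fst_zip_sublist xs ys).append (map_snd_zip_sublist xs ys)).cons_cons xb)

/-- If the controls are distributed in this way, they are pairwise distinct, and so are the
ancillas and the targets, then the two multi-controlled phase gates are compatible: each ladder uses
controls of the other gate as ancillas. -/
theorem compatible_of_nodup
    (h : (x :: y :: xb :: yb :: (xs ++ (ys ++ (trips E ++ J.map t)))).Nodup)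
    (hτ : τ ∈ J.map t) (hx : xs ≠ []) (hy : ys ≠ []) :
    Compatible t J τ (xs.zip (y :: ys)) xb x E (ys.zip (x :: xs)) yb y := by
  have hT : ∀ j ∈ J, t j ∈ J.map t := fun j hj => List.mem_map_of_mem hj
  generalize J.map t = T at *
  simp only [List.nodup_cons, List.nodup_append, List.mem_cons, List.mem_append, not_or] at h
  have hL : ∀ q ∈ ladderQubits (xs.zip (y :: ys)) xb, q = xb ∨ q ∈ xs ∨ q = y ∨ q ∈ ys := by
    intro q hq
    have := mem_or_of_mem_ladderQubits hq
    rwa [List.mem_cons] at this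
  have hL' : ∀ q ∈ ladderQubits (ys.zip (x :: xs)) yb, q = yb ∨ q ∈ ys ∨ q = x ∨ q ∈ xs := by
    intro q hq
    have := mem_or_of_mem_ladderQubits hq
    rwa [List.mem_cons] at this
  refine ⟨⟨ladderNodup_zip ?_, ?_, ?_, ?_⟩, ⟨ladderNodup_zip ?_, ?_, ?_, ?_⟩, ?_, ?_, ?_, ?_⟩
  · simp only [List.nodup_cons, List.nodup_append, List.mem_cons, List.mem_append, not_or]
    grind
  · cases xs <;> simp_all
  · simp only [List.nodup_cons, List.mem_cons, not_or]
    grind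
  · intro q hq hq'
    have := hL q hq'
    grind
  · simp only [List.nodup_cons, List.nodup_append, List.mem_cons, List.mem_append, not_or]
    grind
  · cases ys <;> simp_all
  · simp only [List.nodup_cons, List.mem_cons, not_or, trips]
    grind
  · intro q hq hq'
    have := hL' q hq'
    grind [trips]
  · intro j hj
    have := hT j hj
    refine ⟨by grind, ?_⟩
    rintro (hq | hq)
    · have := hL _ hq
      grind
    · grind
  · intro j hj
    have := hT j hj
    refine ⟨by grind, ?_⟩
    rintro (hq | hq)
    · have := hL' _ hq
      grind
    · simp [trips] at hq
  · intro q hq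
    refine ⟨by grind, ?_⟩
    rintro (hq' | hq')
    · have := hL' _ hq'
      grind
    · simp [trips] at hq'
  · intro p hp p' hp'
    have h1 := (map_snd_zip_sublist xs (y :: ys)).subset (List.mem_map_of_mem hp)
    have h2 := (map_snd_zip_sublist ys (x :: xs)).subset (List.mem_map_of_mem hp')
    rw [List.mem_cons] at h1 h2
    grind

theorem trips_perm (E : List (Q × Q × Q)) : (trips E).Perm
    (E.map Prod.fst ++ ((E.map fun p => p.2.1) ++ E.map fun p => p.2.2)) := by
  induction E with
  | nil => exact List.Perm.refl _
  | cons p E ih =>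
    rw [trips_cons]
    simp only [List.map_cons, List.cons_append]
    refine List.Perm.cons _ ?_
    refine List.Perm.trans ?_ List.perm_middle.symm
    refine List.Perm.cons _ ?_
    refine (ih.cons _).trans ?_
    rw [← List.append_assoc, ← List.append_assoc]
    exact List.perm_middle.symm

/-- A list of `2 * k + r + s + 4` controls and `k` ancillas can be distributed. -/
theorem exists_distribution {l D : List Q} {k r s : ℕ} (hD : D.length = k)
    (hl : l.length = 2 * k + r + s + 4) : ∃ (x y xb yb : Q) (xs ys : List Q) (E : List (Q × Q × Q)),
      xs.length = r ∧ ys.length = s ∧ E.length = k ∧ E.map Prod.fst = D ∧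
      l = (E.map fun p => p.2.1) ++ ((E.map fun p => p.2.2) ++ (xs ++ (ys ++ [x, y, xb, yb]))) := by
  have hsplit : ∀ (l : List Q) (a b : ℕ), l.length = a + b →
      ∃ l₁ l₂, l = l₁ ++ l₂ ∧ l₁.length = a ∧ l₂.length = b := fun l a b h =>
    ⟨l.take a, l.drop a, (List.take_append_drop a l).symm, by simp; omega, by simp; omega⟩
  obtain ⟨e, l, rfl, he, hl⟩ := hsplit l k (k + r + s + 4) (by omega)
  obtain ⟨e', l, rfl, he', hl⟩ := hsplit l k (r + s + 4) (by omega)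
  obtain ⟨xs, l, rfl, hxs, hl⟩ := hsplit l r (s + 4) (by omega)
  obtain ⟨ys, l, rfl, hys, hl⟩ := hsplit l s 4 hl
  match l, hl with
  | [x, y, xb, yb], _ =>
    refine ⟨x, y, xb, yb, xs, ys, D.zip (e.zip e'), hxs, hys, ?_, ?_, ?_⟩
    · simp; omega
    · exact List.map_fst_zip (by simp; omega)
    · have h1 : (D.zip (e.zip e')).map Prod.snd = e.zip e' := List.map_snd_zip (by simp; omega)
      have h2 : ((D.zip (e.zip e')).map fun p => p.2.1) = e := by
        rw [show (fun p : Q × Q × Q => p.2.1) = Prod.fst ∘ Prod.snd from rfl, ← List.map_map, h1]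
        exact List.map_fst_zip (by omega)
      have h3 : ((D.zip (e.zip e')).map fun p => p.2.2) = e' := by
        rw [show (fun p : Q × Q × Q => p.2.2) = Prod.snd ∘ Prod.snd from rfl, ← List.map_map, h1]
        exact List.map_snd_zip (by omega)
      rw [h2, h3]

variable [DecidableEq Q]

theorem nestVal_eq_one_iff {L : List (Q × Q)} (z : Q → Fin 2) : nestVal L xb E z = 1 ↔
    (∀ p ∈ E, z p.2.1 = 1 ∧ z p.2.2 = 1) ∧ ladderTop L xb z = 1 := by
  induction E with
  | nil => simp [nestVal]
  | cons p E ih =>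
    simp only [nestVal, fin_two_mul_eq_one, ih, List.forall_mem_cons]
    tauto

/-- If the first controls of both gates and the values of both ladders are `1`, then so are all
controls: since the ancilla of a rung is a control of the other gate, which is already known to be
`1`, the value of the ladder contains the control of this rung. -/
theorem ladderTop_zip_iff (h1 : xs.length ≤ ys.length + 1) (h2 : ys.length ≤ xs.length)
    (hl : LadderNodup (xs.zip (y :: ys)) xb) (hl' : LadderNodup (ys.zip (x :: xs)) yb)
    (z : Q → Fin 2) (hx : z x = 1) (hy : z y = 1) :
    (ladderTop (xs.zip (y :: ys)) xb z = 1 ∧ ladderTop (ys.zip (x :: xs)) yb z = 1) ↔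
      (∀ q ∈ xs, z q = 1) ∧ (∀ q ∈ ys, z q = 1) ∧ z xb = 1 ∧ z yb = 1 := by
  have e : ∀ a : Fin 2, 1 + (1 + a) = a := by decide
  induction ys generalizing xs x y with
  | nil =>
    match xs, h1 with
    | [], _ => simp [ladderTop, ladderMap, prevVal]
    | [x'], _ =>
      rw [List.zip_cons_cons] at hl
      rw [List.zip_cons_cons, ladderTop_cons hl, hy, e, fin_two_mul_eq_one]
      simp [ladderTop, ladderMap, prevVal, and_assoc]
  | cons y' ys ih =>
    match xs, h2 with
    | x' :: xs, h2 =>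
      rw [List.zip_cons_cons] at hl hl'
      simp only [List.length_cons, Nat.add_le_add_iff_right] at h1 h2
      rw [List.zip_cons_cons, List.zip_cons_cons, ladderTop_cons hl, ladderTop_cons hl', hx, hy, e,
        e, fin_two_mul_eq_one, fin_two_mul_eq_one, List.forall_mem_cons, List.forall_mem_cons]
      have := fun hx' hy' => ih (x := x') (y := y') h1 h2 hl.cons.1 hl'.cons.1 hx' hy'
      tauto

/-- The conditions of the two phase gates hold simultaneously exactly if all controls are `1`. -/
theorem controls_iff (h1 : xs.length ≤ ys.length + 1) (h2 : ys.length ≤ xs.length)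
    (hl : LadderNodup (xs.zip (y :: ys)) xb) (hl' : LadderNodup (ys.zip (x :: xs)) yb)
    (z : Q → Fin 2) :
    (z x * nestVal (xs.zip (y :: ys)) xb E z = 1 ∧ z y * nestVal (ys.zip (x :: xs)) yb [] z = 1) ↔
      z x = 1 ∧ z y = 1 ∧ z xb = 1 ∧ z yb = 1 ∧ (∀ q ∈ xs, z q = 1) ∧ (∀ q ∈ ys, z q = 1) ∧
      (∀ q ∈ E.map fun p => p.2.1, z q = 1) ∧ ∀ q ∈ E.map fun p => p.2.2, z q = 1 := by
  have := ladderTop_zip_iff h1 h2 hl hl' z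
  simp only [fin_two_mul_eq_one, nestVal_eq_one_iff, List.not_mem_nil, List.forall_mem_map,
    forall_and, false_imp_iff, implies_true, true_and]
  tauto

end Controls

section Main

variable {Q ι : Type*} [DecidableEq Q] {t : ι → Q} {J : List ι} {x y xb yb τ : Q} {xs ys : List Q}
  {E : List (Q × Q × Q)} {L : List (Q × Q)} {b : Q} {F : Sched Q}

theorem supportedOn_fanMid {S : Set Q} (hF : SupportedOn F.gates S) (hb : b ∈ S) (hτ : τ ∈ S)
    (h : nestQubits L xb E ⊆ S) : SupportedOn (fanMid F L xb b τ E).gates S := by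
  refine supportedOn_gates_append hF (supportedOn_gates_append (supportedOn_mid.mono ?_)
    (Sched.supportedOn_inv hF))
  rintro q (rfl | rfl | hq)
  exacts [hb, hτ, h hq]

theorem valid_fanMid (hF : F.Valid) (h : MidNodup L xb b τ E) : (fanMid F L xb b τ E).Valid :=
  hF.append ((valid_mid h).append hF.inv)

variable [Fintype Q]

/-- The schedule of the multi-controlled multi-target gate, for a given distribution of the
controls. -/
theorem exists_sched (ht : Function.Injective t) (hJ : J.Nodup) (hJ' : J ≠ [])
    (h : (x :: y :: xb :: yb :: (xs ++ (ys ++ (trips E ++ J.map t)))).Nodup)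
    (h1 : xs.length ≤ ys.length + 1) (h2 : ys.length ≤ xs.length) (hys : ys ≠ [])
    {C : Finset Q} (hC : ∀ z : Q → Fin 2, (∀ q ∈ C, z q = 1) ↔
      z x = 1 ∧ z y = 1 ∧ z xb = 1 ∧ z yb = 1 ∧ (∀ q ∈ xs, z q = 1) ∧ (∀ q ∈ ys, z q = 1) ∧
      (∀ q ∈ E.map fun p => p.2.1, z q = 1) ∧ ∀ q ∈ E.map fun p => p.2.2, z q = 1)
    (hCt : ∀ j ∈ J, t j ∉ C) (W : ι → Matrix.specialUnitaryGroup (Fin 2) ℂ) :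
    ∃ A : Sched Q, A.Valid ∧
      SupportedOn A.gates
        {q | q ∈ x :: y :: xb :: yb :: (xs ++ (ys ++ (trips E ++ J.map t)))} ∧
      A.op = (J.map fun j => controlled C (t j) (W j : Matrix (Fin 2) (Fin 2) ℂ)).prod ∧
      (∀ σ, A.cost σ = match σ with
        | .rotation => 8 * J.length
        | .cnot => 12 * (xs.length + ys.length) + 16 * E.length + 8 * (J.length - 1) + 16
        | .t => 16 * (xs.length + ys.length) + 16 * E.length + 16
        | .h => 8 * (xs.length + ys.length) + 8 * E.length) ∧
      (∀ σ, A.depth σ ≤ match σ with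
        | .rotation => 8
        | .cnot => 8 * (xs.length + ys.length) + 16 * E.length + 8 * Nat.clog 2 J.length + 20
        | .t => 8 * (xs.length + ys.length) + 16 * E.length + 24
        | .h => 4 * (xs.length + ys.length) + 8 * E.length + 5) := by
  obtain ⟨τ, hτ⟩ : ∃ τ, (J.map t).head? = some τ := by
    cases J with
    | nil => exact absurd rfl hJ'
    | cons j J => exact ⟨t j, rfl⟩
  have hτ' : τ ∈ J.map t := List.mem_of_head? hτ
  have hxs : xs ≠ [] := by
    rintro rfl
    exact hys (List.length_eq_zero_iff.1 (Nat.le_zero.1 h2))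
  have hcomp := compatible_of_nodup h hτ' hxs hys
  obtain ⟨F, hFv, hFs, hFc, hFd, ρ, hρ, hρ', hρτ⟩ := exists_fan J.length (J.map t) (by simp)
    (hJ.map ht) τ hτ
  choose α β θ hW using fun j => exists_rotation (W j)
  have hop := op_fullSched ht hJ hCt α β (fun j => -θ j / 4)
    (op_commSched_fanMid ht hJ hcomp hFs hρ hρ' hρτ (fun z => (controls_iff h1 h2
      hcomp.left.ladder hcomp.right.ladder z).trans (hC z).symm) fun j => -θ j / 4)
  have hlen : (xs.zip (y :: ys)).length = xs.length := by simp; omega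
  have hlen' : (ys.zip (x :: xs)).length = ys.length := by simp; omega
  have hq : ∀ q ∈ nestQubits (xs.zip (y :: ys)) xb E,
      q ∈ x :: y :: xb :: yb :: (xs ++ (ys ++ (trips E ++ J.map t))) := by
    rintro q (hq | hq)
    · rcases mem_or_of_mem_ladderQubits hq with hq | hq | hq <;> simp at hq ⊢ <;> tauto
    · simp [hq]
  have hq' : ∀ q ∈ nestQubits (ys.zip (x :: xs)) yb [],
      q ∈ x :: y :: xb :: yb :: (xs ++ (ys ++ (trips E ++ J.map t))) := by
    rintro q (hq | hq)
    · rcases mem_or_of_mem_ladderQubits hq with hq | hq | hq <;> simp at hq ⊢ <;> tauto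
    · simp [trips] at hq
  have hT : ∀ q ∈ J.map t, q ∈ x :: y :: xb :: yb :: (xs ++ (ys ++ (trips E ++ J.map t))) :=
    fun q hq => by
      simp only [List.mem_cons, List.mem_append]
      tauto
  have hFs' := hFs.mono hT
  refine ⟨_, valid_fullSched ht hJ hcomp (valid_fanMid hFv hcomp.left)
    (valid_fanMid hFv hcomp.right),
    supportedOn_fullSched (supportedOn_fanMid hFs' (by simp) (hT _ hτ') hq)
      (supportedOn_fanMid hFs' (by simp) (hT _ hτ') hq')
      (fun j hj => hT _ (List.mem_map_of_mem hj))
      (fun p hp => hq _ (Or.inl (mem_ladderQubits hp).2))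
      fun p hp => hq' _ (Or.inl (mem_ladderQubits hp).2), hop.trans ?_, fun σ => ?_, fun σ => ?_⟩
  · congr 1
    refine List.map_congr_left fun j _ => ?_
    rw [hW, show -(4 * (-θ j / 4)) = θ j by ring]
  · obtain ⟨a1, a2, a3, a4⟩ := cost_mid (L := xs.zip (y :: ys)) (xb := xb) (b := x) (τ := τ) (E := E)
    obtain ⟨b1, b2, b3, b4⟩ := cost_mid (L := ys.zip (x :: xs)) (xb := yb) (b := y) (τ := τ)
      (E := [])
    have := hFc σ
    rw [cost_fullSched]
    simp only [fanMid, Sched.cost_append, Sched.cost_inv]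
    rw [hlen] at *
    rw [hlen'] at *
    cases σ <;> simp at * <;> omega
  · obtain ⟨a1, a2, a3, a4⟩ := depth_mid (L := xs.zip (y :: ys)) (xb := xb) (b := x) (τ := τ)
      (E := E)
    obtain ⟨b1, b2, b3, b4⟩ := depth_mid (L := ys.zip (x :: xs)) (xb := yb) (b := y) (τ := τ)
      (E := [])
    have := hFd σ
    rw [depth_fullSched]
    simp only [fanMid, Sched.depth_append, Sched.depth_inv]
    rw [hlen] at *
    rw [hlen'] at *
    cases σ <;> simp at * <;> omega

end Main

end QCircuit

theorem mainTheorem8 {Q : Type*} [Fintype Q] [DecidableEq Q] (n m k : ℕ)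
    (hn : 6 ≤ n) (hm : 1 ≤ m) (hk : k ≤ (n - 6) / 2)
    (c : Fin n → Q) (t : Fin m → Q) (a : Fin k → Q)
    (hdistinct : Function.Injective (Sum.elim c (Sum.elim t a)))
    (W : Fin m → Matrix.specialUnitaryGroup (Fin 2) ℂ) :
    ∃ K : QCircuit.Circuit Q,
      K.ActsOn (Set.range c ∪ Set.range t ∪ Set.range a) ∧
      K.op = QCircuit.multiTarget c t (fun j => (W j : Matrix (Fin 2) (Fin 2) ℂ)) ∧
      K.cost .rotation = 8 * m ∧
      K.depth .rotation = 8 ∧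
      (K.cost .cnot : ℤ) = 12 * n + 8 * m - 8 * k - 40 ∧
      (K.depth .cnot : ℤ) = 8 * n + 8 * Nat.clog 2 m - 8 ∧
      (K.cost .t : ℤ) = 16 * n - 16 * k - 48 ∧
      (K.depth .t : ℤ) = (if Even n then 8 * (n : ℤ) - 6 else 8 * (n : ℤ) - 3) ∧
      (K.cost .h : ℤ) = 8 * n - 8 * k - 32 ∧
      (K.depth .h : ℤ) = 4 * n - 11 := by
  obtain ⟨hc, hta, hcta⟩ := Sum.elim_injective.1 hdistinct
  obtain ⟨ht, ha, hta'⟩ := Sum.elim_injective.1 hta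
  have hct : ∀ i j, c i ≠ t j := fun i j => hcta i (Sum.inl j)
  have hca : ∀ i j, c i ≠ a j := fun i j => hcta i (Sum.inr j)
  -- Each dirty ancilla takes two controls, and the other `n - 2 * k` controls are divided equally
  -- between the two phase gates; two controls of each of them are not ancillas of a ladder.
  obtain ⟨x, y, xb, yb, xs, ys, E, hxs, hys, hE, hEa, hl⟩ :=
    QCircuit.exists_distribution (l := List.ofFn c) (D := List.ofFn a) (k := k)
      (r := (n - 2 * k + 1) / 2 - 2) (s := (n - 2 * k) / 2 - 2) (by simp) (by simp; omega)
  have hperm : (x :: y :: xb :: yb :: (xs ++ (ys ++ (QCircuit.trips E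
      ++ (List.finRange m).map t)))).Perm (List.ofFn a ++ (List.ofFn c ++ List.ofFn t)) := by
    have := Multiset.coe_eq_coe.2 (QCircuit.trips_perm E)
    rw [hEa] at this
    rw [hl, ← List.ofFn_eq_map, ← Multiset.coe_eq_coe]
    simp only [← Multiset.coe_add, ← Multiset.cons_coe, this, ← Multiset.singleton_add,
      Multiset.coe_nil]
    abel
  have hnodup : (List.ofFn a ++ (List.ofFn c ++ List.ofFn t)).Nodup := by
    simp only [List.nodup_append, List.nodup_ofFn, List.mem_append, List.mem_ofFn]
    refine ⟨ha, ⟨hc, ht, ?_⟩, ?_⟩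
    · rintro _ ⟨i, rfl⟩ _ ⟨j, rfl⟩
      exact hct i j
    · rintro _ ⟨i, rfl⟩ _ (⟨j, rfl⟩ | ⟨j, rfl⟩)
      exacts [(hca j i).symm, (hta' j i).symm]
  have hC : ∀ z : Q → Fin 2, (∀ q ∈ Finset.univ.image c, z q = 1) ↔
      z x = 1 ∧ z y = 1 ∧ z xb = 1 ∧ z yb = 1 ∧ (∀ q ∈ xs, z q = 1) ∧ (∀ q ∈ ys, z q = 1) ∧
      (∀ q ∈ E.map fun p => p.2.1, z q = 1) ∧ ∀ q ∈ E.map fun p => p.2.2, z q = 1 := by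
    intro z
    have : (∀ q ∈ Finset.univ.image c, z q = 1) ↔ ∀ q ∈ List.ofFn c, z q = 1 := by
      simp [List.mem_ofFn]
    rw [this, hl]
    simp only [List.forall_mem_append, List.forall_mem_cons, List.not_mem_nil, false_imp_iff,
      implies_true, and_true]
    tauto
  obtain ⟨A, hA, hAs, hop, hcost, hdepth⟩ := QCircuit.exists_sched ht (List.nodup_finRange m)
    (by simp; omega) (hperm.nodup_iff.2 hnodup) (by omega) (by omega)
    (List.ne_nil_of_length_pos (by omega)) hC (by simpa using fun j i => hct i j) W
  have hclog : Nat.clog 2 m ≤ m - 1 := by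
    refine Nat.clog_le_of_le_pow ?_
    have := Nat.lt_two_pow_self (n := m - 1)
    omega
  have hlen : xs.length + ys.length + 2 * k + 4 = n := by omega
  have hJ : (List.finRange m).length = m := by simp
  simp only [hJ, hE] at hcost hdepth
  obtain ⟨K, hK, hKc⟩ := QCircuit.Sched.exists_circuit hA (d := fun
      | .rotation => 8
      | .cnot => 8 * n + 8 * Nat.clog 2 m - 8
      | .t => if Even n then 8 * n - 6 else 8 * n - 3
      | .h => 4 * n - 11)
    (fun σ => (hdepth σ).trans (by cases σ <;> simp only [] <;> (try split_ifs) <;> omega))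
    (fun σ => by
      rw [hcost]
      cases σ <;> simp only []
      · omega
      · omega
      · split_ifs with h
        · omega
        · rw [Nat.not_even_iff_odd] at h
          obtain ⟨r, rfl⟩ := h
          omega
      · omega)
  refine ⟨K, ?_, ?_, ?_⟩
  · intro g hg q hq
    rw [hK] at hg
    have := hperm.mem_iff.1 (hAs g hg q hq)
    simp only [List.mem_append, List.mem_ofFn] at this
    simp only [Set.mem_union, Set.mem_range]
    tauto
  · rw [QCircuit.Circuit.op, hK, QCircuit.multiTarget, List.ofFn_eq_map]
    exact hop
  · obtain ⟨r1, r2⟩ := hKc .rotation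
    obtain ⟨x1, x2⟩ := hKc .cnot
    obtain ⟨t1, t2⟩ := hKc .t
    obtain ⟨h1, h2⟩ := hKc .h
    rw [r1, r2, x1, x2, t1, t2, h1, h2]
    simp only [hcost]
    refine ⟨trivial, trivial, ?_, ?_, ?_, ?_, ?_, ?_⟩
    · omega
    · omega
    · omega
    · split_ifs <;> omega
    · omega
    · omega
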